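/- A cube is a closed unit cube in $\mathbb{R}^3$ with vertices in $\mathbb{Z}^3$; a dimer is the union of two cubes that share a face; a tiling of a finite union of cubes is a covering of it by dimers, no two of which have a cube in common. A flip on a tiling removes two parallel dimers that form a $2\times 2\times 1$ slab (in any of the three positions) and places them back in the only other possible position. Two tilings lie in the same flip connected component if one is reached from the other by a finite sequence of flips. Let $D\subset\mathbb{R}^2$ be a non-empty finite union of closed unit squares with vertices in $\mathbb{Z}^2$ that is connected and simply connected, and let $R=D\times[0,2]$ be the corresponding duplex region, with top floor $D\times[0,1]$ and bottom floor $D\times[1,2]$. The square $[a,a+1]\times[b,b+1]$ is white if $a+b$ is even and black if it is odd. Let $t$ be a tiling of $R$. A square of $D$ is a jewel of $t$ if the two cubes over it form a dimer of $t$ (a $z$ dimer). Project all other dimers to the plane, and orient those of the top floor from the white square to the black square and those of the bottom floor from the black square to the white square; joining centers of squares, one gets a set of disjoint oriented cycles through the centers of all squares of $D$ that are not jewels. For a jewel $j$ let $k_t(j)$ be the sum of the winding numbers (counterclockwise positive) of these cycles with respect to the center of $j$, and let $$P_t(q)=\sum_{j\text{ black}}q^{k_t(j)}-\sum_{j\text{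 white}}q^{k_t(j)}\in\mathbb{Z}[q,q^{-1}],$$ where $j$ runs over the jewels of $t$. A two-floored box containing $R$ is a set $B=Q\times[0,2]$, where $Q\supseteq D$ is a rectangle with sides parallel to the axes and vertices in $\mathbb{Z}^2$. The embedding of $t$ in $B$ is the tiling $\hat t$ of $B$ that consists of the dimers of $t$ and of the $z$ dimers over the squares of $Q$ that are not in $D$. Theorem. Let $t_0$ and $t_1$ be two tilings of $R$. Then $P_{t_0}=P_{t_1}$ if and only if there exists a two-floored box $B$ containing $R$ such that the embeddings $\hat t_0$ and $\hat t_1$ of $t_0$ and $t_1$ in $B$ lie in the same flip connected component of the tilings of $B$. -/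

import Mathlib

open Finset

/-- The closed unit square `[a, a+1] × [b, b+1]` of the plane is encoded by its corner `(a, b)`. -/
abbrev Square := ℤ × ℤ

/-- The closed unit cube `[a, a+1] × [b, b+1] × [n, n+1]` is encoded by its corner `((a, b), n)`. -/
abbrev Cube := Square × ℤ

/-- The three unit vectors of `ℤ³`. -/
def unitVec : Fin 3 → Cube := ![((1, 0), 0), ((0, 1), 0), ((0, 0), 1)]

/-- A domino brick (dimer): the union of two cubes that share a face. -/
def IsDimer (d : Finset Cube) : Prop := ∃ (c : Cube) (i : Fin 3), d = {c, c + unitVec i}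

/-- A tiling of the (finite) region `R`: a covering of `R` by pairwise disjoint dimers. -/
structure Tiling (R : Finset Cube) where
  dimers : Finset (Finset Cube)
  isDimer : ∀ d ∈ dimers, IsDimer d
  subset : ∀ d ∈ dimers, d ⊆ R
  covers : ∀ c ∈ R, ∃ d ∈ dimers, c ∈ d
  disjoint : ∀ d ∈ dimers, ∀ e ∈ dimers, d ≠ e → Disjoint d e

/-- `t'` is obtained from `t` by a single flip: in a `2 × 2 × 1` slab (in any of the three
positions), two parallel dimers are removed and placed back in the only other position. -/
def IsFlip {R : Finset Cube} (t t' : Tiling R) : Prop :=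
  ∃ (c : Cube) (i k : Fin 3), i ≠ k ∧
    {c, c + unitVec i} ∈ t.dimers ∧
    {c + unitVec k, c + unitVec k + unitVec i} ∈ t.dimers ∧
    {c, c + unitVec k} ∈ t'.dimers ∧
    {c + unitVec i, c + unitVec i + unitVec k} ∈ t'.dimers ∧
    t.dimers \ {{c, c + unitVec i}, {c + unitVec k, c + unitVec k + unitVec i}} =
      t'.dimers \ {{c, c + unitVec k}, {c + unitVec i, c + unitVec i + unitVec k}}

/-- `t` and `t'` lie in the same flip connected component of the space of tilings of `R`. -/
def FlipConnected {R : Finset Cube} (t t' : Tiling R) : Prop :=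
  Relation.ReflTransGen IsFlip t t'

/-- The plane region that is the union of the closed unit squares in `D`. -/
def planeRegion (D : Finset Square) : Set (ℝ × ℝ) :=
  ⋃ s ∈ D, Set.Icc (s.1 : ℝ) (s.1 + 1) ×ˢ Set.Icc (s.2 : ℝ) (s.2 + 1)

/-- The region `D × [0, 2]` with two identical floors. The floor `D × [0, 1]` is the top one. -/
def duplex (D : Finset Square) : Finset Cube := D ×ˢ {0, 1}

/-- The `z` dimer that occupies the two cubes over the square `s`. -/
def zDimer (s : Square) : Finset Cube := {(s, 0), (s, 1)}

theorem isDimer_zDimer (s : Square) : IsDimer (zDimer s) :=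
  ⟨(s, 0), 2, by obtain ⟨a, b⟩ := s; simp [zDimer, unitVec]⟩

theorem mem_zDimer {s : Square} {c : Cube} : c ∈ zDimer s ↔ c.1 = s ∧ (c.2 = 0 ∨ c.2 = 1) := by
  obtain ⟨u, n⟩ := c
  simp [zDimer, Prod.ext_iff, and_or_left]

theorem mem_duplex {D : Finset Square} {c : Cube} :
    c ∈ duplex D ↔ c.1 ∈ D ∧ (c.2 = 0 ∨ c.2 = 1) := by
  simp [duplex, Finset.mem_product]

namespace Tiling

variable {D : Finset Square}

/-- The embedding of `t` in a larger two-floored region: the space between the two regions is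
filled with `z` dimers. -/
def embed (t : Tiling (duplex D)) {E : Finset Square} (h : D ⊆ E) : Tiling (duplex E) where
  dimers := t.dimers ∪ (E \ D).image zDimer
  isDimer d hd := by
    rcases mem_union.1 hd with hd | hd
    · exact t.isDimer d hd
    · obtain ⟨s, -, rfl⟩ := mem_image.1 hd
      exact isDimer_zDimer s
  subset d hd c hc := by
    rcases mem_union.1 hd with hd | hd
    · have := mem_duplex.1 (t.subset d hd hc)
      exact mem_duplex.2 ⟨h this.1, this.2⟩
    · obtain ⟨s, hs, rfl⟩ := mem_image.1 hd
      obtain ⟨rfl, h2⟩ := mem_zDimer.1 hc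
      exact mem_duplex.2 ⟨(mem_sdiff.1 hs).1, h2⟩
  covers c hc := by
    obtain ⟨h1, h2⟩ := mem_duplex.1 hc
    by_cases hD : c.1 ∈ D
    · obtain ⟨d, hd, hcd⟩ := t.covers c (mem_duplex.2 ⟨hD, h2⟩)
      exact ⟨d, mem_union_left _ hd, hcd⟩
    · exact ⟨zDimer c.1, mem_union_right _ (mem_image_of_mem _ (mem_sdiff.2 ⟨h1, hD⟩)),
        mem_zDimer.2 ⟨rfl, h2⟩⟩
  disjoint d hd e he hne := by
    have key : ∀ d ∈ t.dimers, ∀ e ∈ (E \ D).image zDimer, Disjoint d e := by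
      intro d hd e he
      obtain ⟨s, hs, rfl⟩ := mem_image.1 he
      refine Finset.disjoint_left.2 fun c hc hc' => ?_
      have h1 := (mem_duplex.1 (t.subset d hd hc)).1
      rw [(mem_zDimer.1 hc').1] at h1
      exact (mem_sdiff.1 hs).2 h1
    rcases mem_union.1 hd with hd | hd <;> rcases mem_union.1 he with he | he
    · exact t.disjoint d hd e he hne
    · exact key d hd e he
    · exact (key e he d hd).symm
    · obtain ⟨s, -, rfl⟩ := mem_image.1 hd
      obtain ⟨s', -, rfl⟩ := mem_image.1 he
      refine Finset.disjoint_left.2 fun c hc hc' => hne ?_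
      rw [← (mem_zDimer.1 hc).1, (mem_zDimer.1 hc').1]

/-- The oriented dominoes of the associated drawing, as pairs (tail, head) of squares: the non-`z`
dimers of the bottom floor are projected to the top floor and oriented from black to white, those
of the top floor are oriented from white to black. A square `s` is white if `s.1 + s.2` is even
and black otherwise. Joining the centers of the squares, these arcs form disjoint oriented
cycles. -/
def arcs (t : Tiling (duplex D)) : Finset (Square × Square) :=
  (D ×ˢ D).filter fun p =>
    (Even (p.1.1 + p.1.2) ∧ {(p.1, 0), (p.2, 0)} ∈ t.dimers) ∨
    (¬ Even (p.1.1 + p.1.2) ∧ {(p.1, 1), (p.2, 1)} ∈ t.dimers)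

/-- The jewels of the associated drawing: the squares where a `z` dimer occurs. -/
def jewels (t : Tiling (duplex D)) : Finset Square :=
  D.filter fun s => zDimer s ∈ t.dimers

end Tiling

/-- The signed number of times that the unit segment from the center of `u` to the center of `v`
crosses the ray that starts slightly below the center of `j` and points to the left (in the
direction of decreasing first coordinate): `1` if the ray is crossed downwards, that is,
counterclockwise around `j`, and `-1` if it is crossed upwards. -/
def crossing (j u v : Square) : ℤ :=
  if u.1 < j.1 ∧ v.1 = u.1 then
    if u.2 = j.2 ∧ v.2 = j.2 - 1 then 1 else if u.2 = j.2 - 1 ∧ v.2 = j.2 then -1 else 0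
  else 0

namespace Tiling

variable {D : Finset Square}

/-- `k_t(j)`: the sum of the winding numbers around the jewel `j` of all the cycles of the
associated drawing. The winding number of a closed polygon is computed as the signed number of
times that it crosses a ray from `j`; see `two_pi_mul_winding` for its expression as the total
variation of the angle. -/
def winding (t : Tiling (duplex D)) (j : Square) : ℤ :=
  ∑ p ∈ t.arcs, crossing j p.1 p.2

/-- The polynomial invariant `P_t(q) = ∑_{j black} q ^ k_t(j) - ∑_{j white} q ^ k_t(j)`, where
`j` runs over the jewels, in `ℤ[q, q⁻¹]`. -/
noncomputable def invariant (t : Tiling (duplex D)) : LaurentPolynomial ℤ :=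
  ∑ j ∈ t.jewels with ¬ Even (j.1 + j.2), LaurentPolynomial.T (t.winding j) -
    ∑ j ∈ t.jewels with Even (j.1 + j.2), LaurentPolynomial.T (t.winding j)

end Tiling

/-- Two squares that share a side. -/
def SquareAdj (u v : Square) : Prop :=
  (u.2 = v.2 ∧ (v.1 = u.1 + 1 ∨ u.1 = v.1 + 1)) ∨ (u.1 = v.1 ∧ (v.2 = u.2 + 1 ∨ u.2 = v.2 + 1))

/-- The vector from the center of `j` to the center of `u`, as a complex number. -/
noncomputable def relPos (j u : Square) : ℂ := ⟨(u.1 : ℝ) - j.1, (u.2 : ℝ) - j.2⟩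

theorem relPos_ne_zero {j u : Square} (h : u ≠ j) : relPos j u ≠ 0 := by
  intro h0
  apply h
  have h1 := congrArg Complex.re h0
  have h2 := congrArg Complex.im h0
  simp only [relPos, Complex.zero_re, Complex.zero_im, sub_eq_zero, Int.cast_inj] at h1 h2
  exact Prod.ext h1 h2

theorem crossing_spec {j u v : Square} (h : SquareAdj u v) :
    ((0 ≤ u.2 - j.2 ↔ 0 ≤ v.2 - j.2) → crossing j u v = 0) ∧
    (u.1 < j.1 → 0 ≤ u.2 - j.2 → ¬ 0 ≤ v.2 - j.2 → crossing j u v = 1) ∧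
    (u.1 < j.1 → ¬ 0 ≤ u.2 - j.2 → 0 ≤ v.2 - j.2 → crossing j u v = -1) := by
  unfold SquareAdj at h
  unfold crossing
  refine ⟨fun _ => ?_, fun _ _ _ => ?_, fun _ _ _ => ?_⟩ <;> split_ifs <;> first | rfl | omega

theorem arg_relPos_div {j u v : Square} (hu : u ≠ j) (hv : v ≠ j) (huv : SquareAdj u v) :
    Complex.arg (relPos j v / relPos j u) =
      Complex.arg (relPos j v) - Complex.arg (relPos j u) + 2 * Real.pi * crossing j u v := by
  have spec := crossing_spec (j := j) huv
  unfold SquareAdj at huv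
  have hu0 := relPos_ne_zero hu
  have hv0 := relPos_ne_zero hv
  obtain ⟨x, hx⟩ : ∃ x, x = relPos j u := ⟨_, rfl⟩
  obtain ⟨y, hy⟩ : ∃ y, y = relPos j v := ⟨_, rfl⟩
  rw [← hx, ← hy]
  rw [← hx] at hu0
  rw [← hy] at hv0
  have hpi := Real.pi_pos
  have hang : ((y.arg - x.arg + 2 * Real.pi * crossing j u v : ℝ) : Real.Angle) =
      ((y / x).arg : Real.Angle) := by
    rw [Complex.arg_div_coe_angle hv0 hu0, ← Real.Angle.coe_sub, Real.Angle.angle_eq_iff_two_pi_dvd_sub]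
    exact ⟨crossing j u v, by ring⟩
  have hrange : y.arg - x.arg + 2 * Real.pi * crossing j u v ∈ Set.Ioc (-Real.pi) Real.pi := by
    have a1 := Complex.neg_pi_lt_arg x
    have a2 := Complex.arg_le_pi x
    have b1 := Complex.neg_pi_lt_arg y
    have b2 := Complex.arg_le_pi y
    have xre : x.re = ((u.1 - j.1 : ℤ) : ℝ) := by simp [hx, relPos]
    have xim : x.im = ((u.2 - j.2 : ℤ) : ℝ) := by simp [hx, relPos]
    have yre : y.re = ((v.1 - j.1 : ℤ) : ℝ) := by simp [hy, relPos]
    have yim : y.im = ((v.2 - j.2 : ℤ) : ℝ) := by simp [hy, relPos]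
    have hu' : ¬ (u.1 = j.1 ∧ u.2 = j.2) := fun h => hu (Prod.ext h.1 h.2)
    have hv' : ¬ (v.1 = j.1 ∧ v.2 = j.2) := fun h => hv (Prod.ext h.1 h.2)
    have X0 := @Complex.arg_nonneg_iff x
    have Y0 := @Complex.arg_nonneg_iff y
    rw [xim, Int.cast_nonneg_iff] at X0
    rw [yim, Int.cast_nonneg_iff] at Y0
    by_cases hs : (0 ≤ u.2 - j.2 ↔ 0 ≤ v.2 - j.2)
    · have hc : crossing j u v = 0 := spec.1 hs
      rw [hc]
      simp only [Int.cast_zero, mul_zero, add_zero]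
      by_cases h0 : 0 ≤ u.2 - j.2
      · have p1 := X0.2 h0
        have p2 := Y0.2 (hs.1 h0)
        refine ⟨?_, by linarith⟩
        by_contra hcon
        have q1 : x.arg = Real.pi := by linarith
        have q2 : y.arg = 0 := by linarith
        have r1 := (@Complex.arg_eq_pi_iff x).1 q1
        have r2 := (@Complex.arg_eq_zero_iff y).1 q2
        rw [xre, xim, Int.cast_lt_zero, Int.cast_eq_zero] at r1
        rw [yre, yim, Int.cast_nonneg_iff, Int.cast_eq_zero] at r2
        omega
      · have p1 := not_le.1 (mt X0.1 h0)
        have p2 := not_le.1 (mt Y0.1 (mt hs.2 h0))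
        constructor <;> linarith
    · have hvert : u.1 = v.1 := by
        omega
      rcases lt_or_ge (u.1) j.1 with hl | hl
      · have hxr : x.re < 0 := by rw [xre, Int.cast_lt_zero]; omega
        have hyr : y.re < 0 := by rw [yre, Int.cast_lt_zero]; omega
        by_cases h0 : 0 ≤ u.2 - j.2
        · have hc : crossing j u v = 1 := spec.2.1 hl h0 (fun h => hs (iff_of_true h0 h))
          rw [hc]
          have hyi : y.im < 0 := by rw [yim, Int.cast_lt_zero]; omega
          have e1 : x.arg = Real.pi := (@Complex.arg_eq_pi_iff x).2 ⟨hxr, by rw [xim, Int.cast_eq_zero]; omega⟩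
          have e2 : y.arg < -(Real.pi / 2) := by
            rw [← not_le, Complex.neg_pi_div_two_le_arg_iff]; push Not
            exact ⟨hyr, hyi⟩
          push_cast
          constructor <;> linarith
        · have hc : crossing j u v = -1 := by
            refine spec.2.2 hl h0 ?_
            by_contra h
            exact hs (iff_of_false h0 h)
          rw [hc]
          have hxi : x.im < 0 := by rw [xim, Int.cast_lt_zero]; omega
          have e1 : y.arg = Real.pi := (@Complex.arg_eq_pi_iff y).2 ⟨hyr, by rw [yim, Int.cast_eq_zero]; omega⟩
          have e2 : x.arg < -(Real.pi / 2) := by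
            rw [← not_le, Complex.neg_pi_div_two_le_arg_iff]; push Not
            exact ⟨hxr, hxi⟩
          push_cast
          constructor <;> linarith
      · have hc : crossing j u v = 0 := by
          unfold crossing
          rw [if_neg (by omega)]
        have hxr : 0 < x.re := by
          rw [xre, Int.cast_pos]; omega
        have hyr : 0 < y.re := by
          rw [yre, Int.cast_pos]; omega
        have e1 := abs_lt.1 ((@Complex.abs_arg_lt_pi_div_two_iff x).2 (Or.inl hxr))
        have e2 := abs_lt.1 ((@Complex.abs_arg_lt_pi_div_two_iff y).2 (Or.inl hyr))
        rw [hc]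
        push_cast
        constructor <;> linarith
  rw [← Complex.arg_coe_angle_toReal_eq_arg (y / x), ← hang,
    Real.Angle.toReal_coe_eq_self_iff_mem_Ioc.2 hrange]

namespace Tiling

variable {D : Finset Square}

theorem eq_of_mem (t : Tiling (duplex D)) {d e : Finset Cube} (hd : d ∈ t.dimers)
    (he : e ∈ t.dimers) {c : Cube} (h1 : c ∈ d) (h2 : c ∈ e) : d = e := by
  by_contra hne
  exact Finset.disjoint_left.1 (t.disjoint d hd e he hne) h1 h2

/-- Every square without a jewel is matched to an adjacent square in each floor. -/
theorem exists_partner (t : Tiling (duplex D)) {s : Square} (hs : s ∈ D) (hj : s ∉ t.jewels)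
    {n : ℤ} (hn : n = 0 ∨ n = 1) :
    ∃ s' ∈ D, SquareAdj s s' ∧ {(s, n), (s', n)} ∈ t.dimers := by
  obtain ⟨d, hd, hcd⟩ := t.covers (s, n) (mem_duplex.2 ⟨hs, hn⟩)
  have hsub := t.subset d hd
  obtain ⟨c, i, rfl⟩ := t.isDimer d hd
  obtain ⟨⟨a, b⟩, m⟩ := c
  obtain ⟨x, y⟩ := s
  have m1 := mem_duplex.1 (hsub (mem_insert_self _ _))
  have m2 := mem_duplex.1 (hsub (mem_insert_of_mem (mem_singleton_self _)))
  fin_cases i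
  · simp [unitVec] at hcd m1 m2 hd
    rcases hcd with ⟨⟨rfl, rfl⟩, rfl⟩ | ⟨⟨rfl, rfl⟩, rfl⟩
    · exact ⟨_, m2.1, by simp [SquareAdj], hd⟩
    · exact ⟨_, m1.1, by simp [SquareAdj], by rwa [Finset.pair_comm]⟩
  · simp [unitVec] at hcd m1 m2 hd
    rcases hcd with ⟨⟨rfl, rfl⟩, rfl⟩ | ⟨⟨rfl, rfl⟩, rfl⟩
    · exact ⟨_, m2.1, by simp [SquareAdj], hd⟩
    · exact ⟨_, m1.1, by simp [SquareAdj], by rwa [Finset.pair_comm]⟩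
  · exfalso
    simp [unitVec] at hcd m1 m2 hd
    have hm : m = 0 := by omega
    subst hm
    apply hj
    have : x = a ∧ y = b := by omega
    obtain ⟨rfl, rfl⟩ := this
    refine mem_filter.2 ⟨hs, ?_⟩
    simpa [zDimer] using hd

theorem adj_of_mem (t : Tiling (duplex D)) {u v : Square} {n : ℤ}
    (h : {(u, n), (v, n)} ∈ t.dimers) : SquareAdj u v := by
  obtain ⟨c, i, hc⟩ := t.isDimer _ h
  obtain ⟨⟨a, b⟩, m⟩ := c
  obtain ⟨x, y⟩ := u
  obtain ⟨z, w⟩ := v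
  have h1 : (((a, b), m) : Cube) ∈ ({((x, y), n), ((z, w), n)} : Finset Cube) := by
    rw [hc]; simp
  have h2 : (((a, b), m) + unitVec i : Cube) ∈ ({((x, y), n), ((z, w), n)} : Finset Cube) := by
    rw [hc]; simp
  fin_cases i <;> simp [unitVec] at h1 h2 <;> simp only [SquareAdj] <;> omega

theorem notMem_jewels_of_mem (t : Tiling (duplex D)) {u v : Square} {n : ℤ} (hn : n = 0 ∨ n = 1)
    (h : {(u, n), (v, n)} ∈ t.dimers) : u ∉ t.jewels := by
  intro hj
  have := t.eq_of_mem h (mem_filter.1 hj).2 (mem_insert_self _ _) (mem_zDimer.2 ⟨rfl, hn⟩)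
  have h0 : ((u, 1 - n) : Cube) ∈ ({(u, n), (v, n)} : Finset Cube) := by
    rw [this, mem_zDimer]
    exact ⟨rfl, by simp only; omega⟩
  simp at h0
  omega

theorem partner_unique (t : Tiling (duplex D)) {u v w : Square} {n : ℤ}
    (h : {(u, n), (v, n)} ∈ t.dimers) (h' : {(u, n), (w, n)} ∈ t.dimers) : v = w := by
  have e := t.eq_of_mem h h' (mem_insert_self _ _) (mem_insert_self _ _)
  have h1 : ((v, n) : Cube) ∈ ({(u, n), (w, n)} : Finset Cube) := by rw [← e]; simp
  have h2 : ((w, n) : Cube) ∈ ({(u, n), (v, n)} : Finset Cube) := by rw [e]; simp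
  simp at h1 h2
  rcases h1 with rfl | h1
  · rcases h2 with h2 | h2 <;> exact h2.symm
  · exact h1

theorem parity_of_adj {u v : Square} (h : SquareAdj u v) :
    Even (u.1 + u.2) ↔ ¬ Even (v.1 + v.2) := by
  unfold SquareAdj at h
  rw [Int.even_iff, Int.even_iff]
  omega

theorem mem_arcs {t : Tiling (duplex D)} {p : Square × Square} :
    p ∈ t.arcs ↔ (p.1 ∈ D ∧ p.2 ∈ D) ∧
      ((Even (p.1.1 + p.1.2) ∧ {(p.1, 0), (p.2, 0)} ∈ t.dimers) ∨
        (¬ Even (p.1.1 + p.1.2) ∧ {(p.1, 1), (p.2, 1)} ∈ t.dimers)) := by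
  rw [arcs, mem_filter, mem_product]

theorem adj_of_mem_arcs (t : Tiling (duplex D)) {p : Square × Square} (hp : p ∈ t.arcs) :
    SquareAdj p.1 p.2 := by
  rcases (mem_arcs.1 hp).2 with h | h <;> exact t.adj_of_mem h.2

/-- Each square without a jewel is the tail of exactly one arc. -/
theorem sum_arcs_fst (t : Tiling (duplex D)) (f : Square → ℝ) :
    ∑ p ∈ t.arcs, f p.1 = ∑ s ∈ D \ t.jewels, f s := by
  refine Finset.sum_nbij Prod.fst ?_ ?_ ?_ fun _ _ => rfl
  · intro p hp
    obtain ⟨h1, h2⟩ := mem_arcs.1 hp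
    refine mem_sdiff.2 ⟨h1.1, ?_⟩
    rcases h2 with h | h
    · exact t.notMem_jewels_of_mem (Or.inl rfl) h.2
    · exact t.notMem_jewels_of_mem (Or.inr rfl) h.2
  · rintro ⟨u, v⟩ hp ⟨u', v'⟩ hp' (rfl : u = u')
    have h := (mem_arcs.1 hp).2
    have h' := (mem_arcs.1 hp').2
    simp only at h h'
    rcases h with h | h <;> rcases h' with h' | h'
    · rw [t.partner_unique h.2 h'.2]
    · exact absurd h.1 h'.1
    · exact absurd h'.1 h.1
    · rw [t.partner_unique h.2 h'.2]
  · intro s hs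
    obtain ⟨hs, hj⟩ := mem_sdiff.1 hs
    by_cases he : Even (s.1 + s.2)
    · obtain ⟨s', hs', -, h⟩ := t.exists_partner hs hj (Or.inl rfl)
      exact ⟨(s, s'), mem_arcs.2 ⟨⟨hs, hs'⟩, Or.inl ⟨he, h⟩⟩, rfl⟩
    · obtain ⟨s', hs', -, h⟩ := t.exists_partner hs hj (Or.inr rfl)
      exact ⟨(s, s'), mem_arcs.2 ⟨⟨hs, hs'⟩, Or.inr ⟨he, h⟩⟩, rfl⟩

/-- Each square without a jewel is the head of exactly one arc. -/
theorem sum_arcs_snd (t : Tiling (duplex D)) (f : Square → ℝ) :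
    ∑ p ∈ t.arcs, f p.2 = ∑ s ∈ D \ t.jewels, f s := by
  refine Finset.sum_nbij Prod.snd ?_ ?_ ?_ fun _ _ => rfl
  · intro p hp
    obtain ⟨h1, h2⟩ := mem_arcs.1 hp
    refine mem_sdiff.2 ⟨h1.2, ?_⟩
    rcases h2 with h | h
    · exact t.notMem_jewels_of_mem (Or.inl rfl) (by rw [Finset.pair_comm]; exact h.2)
    · exact t.notMem_jewels_of_mem (Or.inr rfl) (by rw [Finset.pair_comm]; exact h.2)
  · rintro ⟨u, v⟩ hp ⟨u', v'⟩ hp' (rfl : v = v')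
    have h := (mem_arcs.1 hp).2
    have h' := (mem_arcs.1 hp').2
    have p1 := parity_of_adj (t.adj_of_mem_arcs hp)
    have p2 := parity_of_adj (t.adj_of_mem_arcs hp')
    simp only at h h' p1 p2
    rw [Finset.pair_comm (u, 0), Finset.pair_comm (u, 1)] at h
    rw [Finset.pair_comm (u', 0), Finset.pair_comm (u', 1)] at h'
    rcases h with h | h <;> rcases h' with h' | h'
    · rw [t.partner_unique h.2 h'.2]
    · exact absurd (p2.2 (p1.1 h.1)) h'.1
    · exact absurd (p1.2 (p2.1 h'.1)) h.1
    · rw [t.partner_unique h.2 h'.2]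
  · intro s hs
    obtain ⟨hs, hj⟩ := mem_sdiff.1 hs
    by_cases he : Even (s.1 + s.2)
    · obtain ⟨s', hs', ha, h⟩ := t.exists_partner hs hj (Or.inr rfl)
      rw [Finset.pair_comm] at h
      exact ⟨(s', s), mem_arcs.2 ⟨⟨hs', hs⟩, Or.inr ⟨(parity_of_adj ha).1 he, h⟩⟩, rfl⟩
    · obtain ⟨s', hs', ha, h⟩ := t.exists_partner hs hj (Or.inl rfl)
      rw [Finset.pair_comm] at h
      exact ⟨(s', s), mem_arcs.2 ⟨⟨hs', hs⟩, Or.inl ⟨not_not.1 (mt (parity_of_adj ha).2 he), h⟩⟩, rfl⟩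

/-- The winding number is the total variation of the angle along the cycles, divided by `2π`. -/
theorem two_pi_mul_winding (t : Tiling (duplex D)) {j : Square} (hj : j ∈ t.jewels) :
    2 * Real.pi * t.winding j =
      ∑ p ∈ t.arcs, Complex.arg (relPos j p.2 / relPos j p.1) := by
  have h : ∀ p ∈ t.arcs, Complex.arg (relPos j p.2 / relPos j p.1) =
      Complex.arg (relPos j p.2) - Complex.arg (relPos j p.1) +
        2 * Real.pi * crossing j p.1 p.2 := by
    intro p hp
    have h2 := (mem_arcs.1 hp).2
    refine arg_relPos_div ?_ ?_ (t.adj_of_mem_arcs hp)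
    · rintro rfl
      rcases h2 with h | h
      · exact t.notMem_jewels_of_mem (Or.inl rfl) h.2 hj
      · exact t.notMem_jewels_of_mem (Or.inr rfl) h.2 hj
    · rintro rfl
      rw [Finset.pair_comm (p.1, 0), Finset.pair_comm (p.1, 1)] at h2
      rcases h2 with h | h
      · exact t.notMem_jewels_of_mem (Or.inl rfl) h.2 hj
      · exact t.notMem_jewels_of_mem (Or.inr rfl) h.2 hj
  rw [Finset.sum_congr rfl h, Finset.sum_add_distrib, Finset.sum_sub_distrib,
    t.sum_arcs_fst fun s => Complex.arg (relPos j s),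
    t.sum_arcs_snd fun s => Complex.arg (relPos j s), sub_self, zero_add, ← Finset.mul_sum,
    winding, Int.cast_sum]

end Tiling

/-! Cut the region into rows along the second coordinate. Each row is a piece of the ladder `ℤ × {0,
1}`, and a tiling consists of bricks (dimers inside a row; the `z` dimers are the rungs) and posts
(dimers that join two successive rows). Call a site occupied below a row if the presence of a post
there agrees with a checkerboard parity (`Occ`). With this twist the occupied set passes unchanged
through a row, except that each brick has exactly one occupied end and exchanges the states of its
ends: a particle hops along an edge. Read upwards, a tiling of a rectangle is a word of hops that
starts at the half-filled state `base`; if the height is even the word is closed. The bricks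
determine the tiling.

Flips become moves on words: a hop and its inverse can be inserted or deleted, and two neighbouring
rungs with the particles on a diagonal can be replaced by the two rails of the square. After adding
space, bricks can also be delayed by even numbers of rows, so disjoint hops commute. Hence two
tilings that reach homotopic words are flip connected in a larger region (`Reaches.htpy`,
`Reaches.stablyConnected`).

It remains to classify closed words. Words without rungs (`Vertical`) are determined up to homotopy
by their ends, since particles on a line cannot pass each other (`Vertical.htpy`). A rung carries a
letter: its level, which is the excess of particles to its left, and the floor that the particle
leaves. Rungs with the same letter differ by rungless words (`rungEq_of_level`), letters can be
interchanged when there is room, and letters of equal level and opposite floors cancel. So a closed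
word with as many letters `(k, false)` as `(k, true)`, for every `k`, is null-homotopic in a wide
enough strip (`htpy_nil_of_count`). The level is the winding number of the jewel, and the floor
encodes its colour (`level_eq_winding`, `invariant_eq_sum_weight`), so the invariant is the signed
count of letters. If two tilings have the same invariant, the word of one followed by the reversed
word of the other is null-homotopic.

Conversely, the jewels that a flip creates or destroys come in neighbouring pairs of opposite
colours and equal winding numbers, and the others keep their winding numbers
(`IsFlip.invariant_eq`). Since `D` is simply connected, the angle around a square outside `D` has a
continuous branch on `D`; so the `z` dimers added by an embedding have winding number zero, and both
invariants change by the same constant. -/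

/-- A site of the ladder `ℤ × {0, 1}`. -/
abbrev Site := ℤ × Bool

/-- An edge of the ladder: `Sum.inl (x, f)` joins `(x, f)` to `(x + 1, f)`, and `Sum.inr x` is the
rung that joins `(x, false)` to `(x, true)`. -/
abbrev Edge := (ℤ × Bool) ⊕ ℤ

/-! ### Words of hops on the ladder and their homotopies -/

namespace Edge

/-- The first end of an edge. -/
def fst : Edge → Site
  | Sum.inl p => p
  | Sum.inr x => (x, false)

/-- The second end of an edge. -/
def snd : Edge → Site
  | Sum.inl p => (p.1 + 1, p.2)
  | Sum.inr x => (x, true)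

@[simp] theorem fst_inl (p : ℤ × Bool) : fst (Sum.inl p) = p := rfl
@[simp] theorem snd_inl (p : ℤ × Bool) : snd (Sum.inl p) = (p.1 + 1, p.2) := rfl
@[simp] theorem fst_inr (x : ℤ) : fst (Sum.inr x) = (x, false) := rfl
@[simp] theorem snd_inr (x : ℤ) : snd (Sum.inr x) = (x, true) := rfl

theorem fst_ne_snd (d : Edge) : d.fst ≠ d.snd := by
  rcases d with ⟨x, f⟩ | x <;> simp

/-- The two ends of an edge. -/
def sites (d : Edge) : Finset Site := {d.fst, d.snd}

theorem mem_sites {d : Edge} {p : Site} : p ∈ d.sites ↔ p = d.fst ∨ p = d.snd := by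
  simp [sites]

theorem fst_mem_sites (d : Edge) : d.fst ∈ d.sites := mem_sites.2 (Or.inl rfl)
theorem snd_mem_sites (d : Edge) : d.snd ∈ d.sites := mem_sites.2 (Or.inr rfl)

/-- The edge lies over the interval `[lo, hi]`. -/
def Fits (lo hi : ℤ) (d : Edge) : Prop := lo ≤ d.fst.1 ∧ d.snd.1 ≤ hi

/-- Exactly one end of the edge is occupied, so that a particle can hop along it. -/
def Valid (s : Finset Site) (d : Edge) : Prop := d.fst ∈ s ↔ d.snd ∉ s

/-- The set of occupied sites after a hop along an edge. -/
def toggle (s : Finset Site) (d : Edge) : Finset Site := symmDiff s d.sites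

theorem mem_toggle {s : Finset Site} {d : Edge} {p : Site} :
    p ∈ toggle s d ↔ (p ∈ s ↔ p ∉ d.sites) := by
  rw [toggle, Finset.mem_symmDiff]; tauto

theorem mem_toggle_of_notMem {s : Finset Site} {d : Edge} {p : Site} (h : p ∉ d.sites) :
    p ∈ toggle s d ↔ p ∈ s := by
  rw [mem_toggle]; tauto

theorem mem_toggle_of_mem {s : Finset Site} {d : Edge} {p : Site} (h : p ∈ d.sites) :
    p ∈ toggle s d ↔ p ∉ s := by
  rw [mem_toggle]; tauto

@[simp] theorem toggle_toggle (s : Finset Site) (d : Edge) : toggle (toggle s d) d = s := by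
  simp [toggle]

theorem toggle_comm (s : Finset Site) (d e : Edge) :
    toggle (toggle s d) e = toggle (toggle s e) d := by
  simp only [toggle, symmDiff_assoc, symmDiff_comm d.sites]

theorem valid_toggle_self {s : Finset Site} {d : Edge} : Valid (toggle s d) d ↔ Valid s d := by
  rw [Valid, Valid, mem_toggle_of_mem d.fst_mem_sites, mem_toggle_of_mem d.snd_mem_sites]
  tauto

theorem valid_toggle_of_disjoint {s : Finset Site} {d e : Edge} (h : Disjoint d.sites e.sites) :
    Valid (toggle s d) e ↔ Valid s e := by
  rw [Valid, Valid, mem_toggle_of_notMem (Finset.disjoint_right.1 h e.fst_mem_sites),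
    mem_toggle_of_notMem (Finset.disjoint_right.1 h e.snd_mem_sites)]

/-- The set of occupied sites after a sequence of hops. -/
def run (s : Finset Site) (w : List Edge) : Finset Site := w.foldl toggle s

@[simp] theorem run_nil (s : Finset Site) : run s [] = s := rfl
@[simp] theorem run_cons (s : Finset Site) (d : Edge) (w : List Edge) :
    run s (d :: w) = run (toggle s d) w := rfl
@[simp] theorem run_append (s : Finset Site) (w w' : List Edge) :
    run s (w ++ w') = run (run s w) w' := by simp [run]

/-- All hops of the word can be performed in turn. -/
def Ok (lo hi : ℤ) : Finset Site → List Edge → Prop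
  | _, [] => True
  | s, d :: w => (Fits lo hi d ∧ Valid s d) ∧ Ok lo hi (toggle s d) w

variable {lo hi : ℤ} {s : Finset Site} {w w' : List Edge}

@[simp] theorem ok_nil : Ok lo hi s [] := trivial
@[simp] theorem ok_cons {d : Edge} :
    Ok lo hi s (d :: w) ↔ (Fits lo hi d ∧ Valid s d) ∧ Ok lo hi (toggle s d) w := Iff.rfl
@[simp] theorem ok_append :
    Ok lo hi s (w ++ w') ↔ Ok lo hi s w ∧ Ok lo hi (run s w) w' := by
  induction w generalizing s with
  | nil => simp
  | cons d w ih => simp [ih, and_assoc]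

theorem run_reverse : run (run s w) w.reverse = s := by
  induction w generalizing s with
  | nil => rfl
  | cons d w ih => simp [ih]

theorem ok_reverse (h : Ok lo hi s w) : Ok lo hi (run s w) w.reverse := by
  induction w generalizing s with
  | nil => simp
  | cons d w ih =>
    simp only [run_cons, List.reverse_cons, ok_append, run_reverse]
    exact ⟨ih h.2, ⟨h.1.1, valid_toggle_self.2 h.1.2⟩, trivial⟩

/-- Elementary homotopies of words of hops that start at `s`. -/
inductive Step (lo hi : ℤ) (s : Finset Site) : List Edge → List Edge → Prop
  | cancel (A B : List Edge) (d : Edge) : Step lo hi s (A ++ d :: d :: B) (A ++ B)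
  | insert (A B : List Edge) (d : Edge) : Fits lo hi d → Valid (run s A) d →
      Step lo hi s (A ++ B) (A ++ d :: d :: B)
  | comm (A B : List Edge) (d e : Edge) : Disjoint d.sites e.sites →
      Step lo hi s (A ++ d :: e :: B) (A ++ e :: d :: B)
  | flip (A B : List Edge) (x : ℤ) : Valid (run s A) (Sum.inl (x, false)) →
      Valid (run s A) (Sum.inl (x, true)) → Step lo hi s
        (A ++ Sum.inr x :: Sum.inr (x + 1) :: B) (A ++ Sum.inl (x, false) :: Sum.inl (x, true) :: B)

/-- Each of the four corners of the square lies on exactly one edge of either pair, so both pairs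
complement the state at all four corners. -/
theorem run_rungs (s : Finset Site) (x : ℤ) : toggle (toggle s (Sum.inr x)) (Sum.inr (x + 1)) =
    toggle (toggle s (Sum.inl (x, false))) (Sum.inl (x, true)) := by
  ext ⟨y, f⟩
  simp only [mem_toggle, mem_sites, fst_inr, snd_inr, fst_inl, snd_inl, Prod.mk.injEq]
  cases f <;> simp <;> by_cases h1 : y = x <;> by_cases h2 : y = x + 1 <;> simp_all

theorem Step.run_eq (h : Step lo hi s w w') : run s w = run s w' := by
  cases h with
  | cancel A B d => simp
  | insert A B d => simp
  | comm A B d e => simp [toggle_comm]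
  | flip A B x => simp only [run_append, run_cons, run_rungs]

theorem disjoint_inl_not (x : ℤ) : Disjoint (sites (Sum.inl (x, false))) (sites (Sum.inl (x, true))) := by
  simp [sites]

theorem disjoint_inr {x y : ℤ} (h : x ≠ y) : Disjoint (sites (Sum.inr x)) (sites (Sum.inr y)) := by
  simp [sites]; tauto

theorem Step.ok (h : Step lo hi s w w') (hw : Ok lo hi s w) : Ok lo hi s w' := by
  cases h with
  | cancel A B d => simp at hw ⊢; tauto
  | insert A B d h1 h2 => simp [valid_toggle_self] at hw ⊢; tauto
  | comm A B d e h =>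
    simp only [ok_append, ok_cons, valid_toggle_of_disjoint h, valid_toggle_of_disjoint h.symm,
      toggle_comm _ e d] at hw ⊢
    tauto
  | flip A B x h1 h2 =>
    simp only [ok_append, ok_cons, valid_toggle_of_disjoint (disjoint_inl_not x),
      run_rungs, Fits, fst_inl, snd_inl, fst_inr, snd_inr] at hw ⊢
    obtain ⟨a, ⟨⟨b, c⟩, c'⟩, ⟨⟨e, f⟩, f'⟩, g⟩ := hw
    exact ⟨a, ⟨⟨b, f⟩, h1⟩, ⟨⟨b, f⟩, h2⟩, g⟩

/-- Two words of hops that can be performed from `s` are homotopic. -/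
def Htpy (lo hi : ℤ) (s : Finset Site) (w w' : List Edge) : Prop :=
  Ok lo hi s w ∧ Relation.ReflTransGen (Step lo hi s) w w'

theorem Htpy.refl (h : Ok lo hi s w) : Htpy lo hi s w w := ⟨h, .refl⟩

theorem Htpy.ok_left (h : Htpy lo hi s w w') : Ok lo hi s w := h.1

theorem Htpy.ok_right (h : Htpy lo hi s w w') : Ok lo hi s w' := by
  obtain ⟨h, h'⟩ := h
  induction h' with
  | refl => exact h
  | tail _ hs ih => exact hs.ok ih

theorem Htpy.run_eq (h : Htpy lo hi s w w') : run s w = run s w' := by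
  obtain ⟨h, h'⟩ := h
  induction h' with
  | refl => rfl
  | tail _ hs ih => rw [ih, hs.run_eq]

theorem Htpy.trans {w'' : List Edge} (h : Htpy lo hi s w w') (h' : Htpy lo hi s w' w'') :
    Htpy lo hi s w w'' := ⟨h.1, h.2.trans h'.2⟩

theorem Step.append_right (h : Step lo hi s w w') (u : List Edge) :
    Step lo hi s (w ++ u) (w' ++ u) := by
  cases h with
  | cancel A B d => simpa using Step.cancel A (B ++ u) d
  | insert A B d h1 h2 => simpa using Step.insert A (B ++ u) d h1 h2
  | comm A B d e h => simpa using Step.comm A (B ++ u) d e h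
  | flip A B x h1 h2 => simpa using Step.flip A (B ++ u) x h1 h2

theorem Step.append_left {u : List Edge} (h : Step lo hi (run s u) w w') :
    Step lo hi s (u ++ w) (u ++ w') := by
  cases h with
  | cancel A B d => simpa using Step.cancel (u ++ A) B d
  | insert A B d h1 h2 => simpa using Step.insert (u ++ A) B d h1 (by simpa using h2)
  | comm A B d e h => simpa using Step.comm (u ++ A) B d e h
  | flip A B x h1 h2 =>
    simpa using Step.flip (u ++ A) B x (by simpa using h1) (by simpa using h2)

theorem Htpy.append {u u' : List Edge} (h : Htpy lo hi s w w') (h' : Htpy lo hi (run s w) u u') :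
    Htpy lo hi s (w ++ u) (w' ++ u') := by
  refine ⟨ok_append.2 ⟨h.1, h'.1⟩, ?_⟩
  have h1 : Relation.ReflTransGen (Step lo hi s) (w ++ u) (w ++ u') :=
    h'.2.lift (fun v => w ++ v) fun a b hab => hab.append_left
  exact h1.trans (h.2.lift (fun v => v ++ u') fun a b hab => hab.append_right _)

theorem Htpy.append_left {u : List Edge} (hu : Ok lo hi s u) (h : Htpy lo hi (run s u) w w') :
    Htpy lo hi s (u ++ w) (u ++ w') := (Htpy.refl hu).append h

theorem Htpy.append_right {u : List Edge} (h : Htpy lo hi s w w') (hu : Ok lo hi (run s w) u) :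
    Htpy lo hi s (w ++ u) (w' ++ u) := h.append (Htpy.refl hu)

theorem Htpy.cons {d : Edge} (hf : Fits lo hi d) (hv : Valid s d)
    (h : Htpy lo hi (toggle s d) w w') : Htpy lo hi s (d :: w) (d :: w') :=
  Htpy.append_left (u := [d]) ⟨⟨hf, hv⟩, trivial⟩ h

theorem htpy_cancel {d : Edge} (h : Ok lo hi s (d :: d :: w)) : Htpy lo hi s (d :: d :: w) w :=
  ⟨h, .single (Step.cancel [] w d)⟩

theorem htpy_insert {d : Edge} (h : Ok lo hi s w) (hf : Fits lo hi d) (hv : Valid s d) :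
    Htpy lo hi s w (d :: d :: w) :=
  ⟨h, .single (Step.insert [] w d hf hv)⟩

theorem htpy_comm {d e : Edge} (h : Ok lo hi s (d :: e :: w)) (hd : Disjoint d.sites e.sites) :
    Htpy lo hi s (d :: e :: w) (e :: d :: w) :=
  ⟨h, .single (Step.comm [] w d e hd)⟩

theorem htpy_append_reverse (h : Ok lo hi s w) : Htpy lo hi s (w ++ w.reverse) [] := by
  induction w generalizing s with
  | nil => exact Htpy.refl trivial
  | cons d w ih =>
    have h1 : Htpy lo hi (toggle s d) (w ++ w.reverse ++ [d]) ([] ++ [d]) := by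
      refine (ih h.2).append_right ?_
      rw [run_append, run_reverse]
      exact ⟨⟨h.1.1, valid_toggle_self.2 h.1.2⟩, trivial⟩
    have h2 := Htpy.cons h.1.1 h.1.2 h1
    simp only [List.nil_append] at h2
    have := h2.trans (htpy_cancel h2.ok_right)
    simpa using this

theorem htpy_reverse_append (h : Ok lo hi s w) : Htpy lo hi (run s w) (w.reverse ++ w) [] := by
  simpa using htpy_append_reverse (ok_reverse h)

theorem htpy_nil_append_reverse (h : Ok lo hi s w) : Htpy lo hi s [] (w ++ w.reverse) := by
  induction w generalizing s with
  | nil => exact Htpy.refl trivial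
  | cons d w ih =>
    have h1 : Htpy lo hi (toggle s d) ([] ++ [d]) (w ++ w.reverse ++ [d]) := by
      refine (ih h.2).append_right ?_
      exact ⟨⟨h.1.1, valid_toggle_self.2 h.1.2⟩, trivial⟩
    have h2 := Htpy.cons h.1.1 h.1.2 h1
    simpa using (htpy_insert ok_nil h.1.1 h.1.2).trans h2

/-- Two rungs next to each other, with the particles on a diagonal, can be replaced by the other
two sides of the square. -/
theorem htpy_flip {x : ℤ} (h : Ok lo hi s (Sum.inr x :: Sum.inr (x + 1) :: w))
    (h1 : Valid s (Sum.inl (x, false))) (h2 : Valid s (Sum.inl (x, true))) :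
    Htpy lo hi s (Sum.inr x :: Sum.inr (x + 1) :: w)
      (Sum.inl (x, false) :: Sum.inl (x, true) :: w) :=
  ⟨h, .single (Step.flip [] w x h1 h2)⟩

/-- After the rails `v v'` the particles sit on the other diagonal, and there the loop `z z' z' z`
of rungs can be inserted. Its first half flips to `v v'`, which cancels against the initial `v v'`
once its two hops are interchanged. The remaining `z' z` commutes to `z z'`. -/
theorem htpy_flip_symm {x : ℤ} (hlo : lo ≤ x) (hhi : x + 1 ≤ hi)
    (h1 : Valid s (Sum.inl (x, false))) (h2 : Valid s (Sum.inl (x, true)))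
    (h3 : Valid s (Sum.inr x)) (h4 : Valid s (Sum.inr (x + 1))) :
    Htpy lo hi s [Sum.inl (x, false), Sum.inl (x, true)] [Sum.inr x, Sum.inr (x + 1)] := by
  set v : Edge := Sum.inl (x, false)
  set v' : Edge := Sum.inl (x, true)
  set z : Edge := Sum.inr x
  set z' : Edge := Sum.inr (x + 1)
  have dv : Disjoint v.sites v'.sites := disjoint_inl_not x
  have dz : Disjoint z.sites z'.sites := disjoint_inr (by omega)
  have fv : Fits lo hi v := ⟨hlo, hhi⟩
  have fv' : Fits lo hi v' := ⟨hlo, hhi⟩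
  have fz : Fits lo hi z := ⟨hlo, by simp [z]; omega⟩
  have fz' : Fits lo hi z' := ⟨by simp [z']; omega, hhi⟩
  have hvv : Ok lo hi s [v, v'] := ⟨⟨fv, h1⟩, ⟨fv', (valid_toggle_of_disjoint dv).2 h2⟩, trivial⟩
  have hzz : Ok lo hi s [z, z'] := ⟨⟨fz, h3⟩, ⟨fz', (valid_toggle_of_disjoint dz).2 h4⟩, trivial⟩
  have hr : run s [z, z'] = run s [v, v'] := run_rungs s x
  have hzz' : Ok lo hi (run s [v, v']) [z', z] := by
    rw [← hr]; exact ok_reverse hzz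
  have e0 : Htpy lo hi (run s [v, v']) [] ([z, z'] ++ [z', z]) := by
    have a : Ok lo hi (run s [v, v']) [z, z'] := by
      simp only [ok_cons] at hzz' ⊢
      rw [valid_toggle_of_disjoint dz.symm] at hzz'
      rw [valid_toggle_of_disjoint dz]
      tauto
    exact htpy_nil_append_reverse a
  have c : Ok lo hi (run s [v, v']) [v', v] := ok_reverse hvv
  have e1 : Htpy lo hi (run s [v, v']) ([z, z'] ++ [z', z]) ([v, v'] ++ [z', z]) := by
    refine htpy_flip e0.ok_right ?_ ?_
    · simp only [ok_cons] at c
      rw [valid_toggle_of_disjoint dv.symm] at c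
      exact c.2.1.2
    · exact c.1.2
  have e2 := Htpy.append_left hvv (e0.trans e1)
  have e3 : Htpy lo hi s ([v, v'] ++ ([v, v'] ++ [z', z])) ([v, v'] ++ ([v', v] ++ [z', z])) := by
    refine Htpy.append_left hvv ?_
    have := e1.ok_right
    exact htpy_comm this dv
  have e4 : Htpy lo hi s ([v, v'] ++ [v', v] ++ [z', z]) ([] ++ [z', z]) := by
    refine (htpy_append_reverse hvv).append_right ?_
    exact (ok_append.1 (ok_append.1 e3.ok_right).2).2
  have e5 : Htpy lo hi s [z', z] [z, z'] := by
    refine htpy_comm ?_ dz.symm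
    simpa using e4.ok_right
  simp only [List.append_assoc, List.nil_append, List.append_nil] at e2 e3 e4
  exact e2.trans (e3.trans (e4.trans e5))

theorem Step.symm (h : Step lo hi s w w') (hw : Ok lo hi s w) : Htpy lo hi s w' w := by
  have hw' := h.ok hw
  cases h with
  | cancel A B d =>
    simp only [ok_append, ok_cons] at hw
    exact ⟨hw', .single (Step.insert A B d hw.2.1.1 hw.2.1.2)⟩
  | insert A B d h1 h2 => exact ⟨hw', .single (Step.cancel A B d)⟩
  | comm A B d e h => exact ⟨hw', .single (Step.comm A B e d h.symm)⟩
  | flip A B x h1 h2 =>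
    simp only [ok_append, ok_cons] at hw hw'
    have dz : Disjoint (sites (Sum.inr x)) (sites (Sum.inr (x + 1))) := disjoint_inr (by omega)
    have h4 := hw.2.2.1.2
    rw [valid_toggle_of_disjoint dz] at h4
    have := htpy_flip_symm hw'.2.1.1.1 hw'.2.1.1.2 h1 h2 hw.2.1.2 h4
    have h5 := Htpy.append_left hw'.1 (this.append_right hw'.2.2.2)
    simpa using h5

theorem Htpy.symm (h : Htpy lo hi s w w') : Htpy lo hi s w' w := by
  obtain ⟨h, h'⟩ := h
  induction h' with
  | refl => exact Htpy.refl h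
  | tail h1 hs ih => exact (hs.symm (Htpy.ok_right ⟨h, h1⟩)).trans ih

end Edge

/-! ### Words without rungs: pushing all particles down -/

namespace Edge
variable {lo hi : ℤ} {s : Finset Site} {w w' : List Edge}

/-- The occupied sites lie over the interval `[lo, hi]`. -/
def InBox (lo hi : ℤ) (s : Finset Site) : Prop := ∀ p ∈ s, lo ≤ p.1 ∧ p.1 ≤ hi

theorem fst_le_snd (d : Edge) : d.fst.1 ≤ d.snd.1 := by
  rcases d with ⟨x, f⟩ | x <;> simp

theorem InBox.toggle (h : InBox lo hi s) {d : Edge} (hd : Fits lo hi d) :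
    InBox lo hi (toggle s d) := by
  intro p hp
  by_cases hpd : p ∈ d.sites
  · have := fst_le_snd d
    rcases mem_sites.1 hpd with rfl | rfl
    · exact ⟨hd.1, this.trans hd.2⟩
    · exact ⟨hd.1.trans this, hd.2⟩
  · exact h p ((mem_toggle_of_notMem hpd).1 hp)

theorem InBox.run (h : InBox lo hi s) (hw : Ok lo hi s w) : InBox lo hi (run s w) := by
  induction w generalizing s with
  | nil => exact h
  | cons d w ih => exact ih (h.toggle hw.1.1) hw.2

/-- The words that contain no rung. -/
def Vertical (w : List Edge) : Prop := ∀ d ∈ w, ∃ p, d = Sum.inl p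

theorem vertical_nil : Vertical [] := by simp [Vertical]

theorem Vertical.append (h : Vertical w) (h' : Vertical w') : Vertical (w ++ w') := by
  intro d hd
  rcases List.mem_append.1 hd with hd | hd
  · exact h d hd
  · exact h' d hd

theorem Vertical.reverse (h : Vertical w) : Vertical w.reverse := fun d hd =>
  h d (List.mem_reverse.1 hd)

/-- A hop of a particle from `(x + 1, f)` to `(x, f)`, where `(x, f)` is in a prescribed set. -/
def Down (lo hi : ℤ) (Q : Set Site) (s : Finset Site) (d : Edge) : Prop :=
  ∃ p ∈ Q, d = Sum.inl p ∧ lo ≤ p.1 ∧ p.1 + 1 ≤ hi ∧ p ∉ s ∧ (p.1 + 1, p.2) ∈ s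

/-- Words of downward hops. -/
def Downs (lo hi : ℤ) (Q : Set Site) : Finset Site → List Edge → Prop
  | _, [] => True
  | s, d :: w => Down lo hi Q s d ∧ Downs lo hi Q (toggle s d) w

/-- The sum of the heights of the particles. -/
def height (lo : ℤ) (s : Finset Site) : ℕ := ∑ p ∈ s, (p.1 - lo).toNat

variable {Q : Set Site} {d e : Edge}

theorem Down.fits (h : Down lo hi Q s d) : Fits lo hi d := by
  obtain ⟨p, -, rfl, h1, h2, -⟩ := h
  exact ⟨h1, h2⟩

theorem Down.valid (h : Down lo hi Q s d) : Valid s d := by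
  obtain ⟨p, -, rfl, h1, h2, h3, h4⟩ := h
  simp [Valid, h3, h4]

theorem Down.toggle_eq {p : Site} (h3 : p ∉ s) (h4 : (p.1 + 1, p.2) ∈ s) :
    toggle s (Sum.inl p) = insert p (s.erase (p.1 + 1, p.2)) := by
  ext q
  have : p ≠ (p.1 + 1, p.2) := fst_ne_snd (Sum.inl p)
  simp only [mem_toggle, mem_sites, fst_inl, snd_inl, mem_insert, mem_erase]
  by_cases h1 : q = p
  · subst h1; simp [h3]
  · by_cases h2 : q = (p.1 + 1, p.2)
    · subst h2; simp [h4, this.symm]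
    · simp [h1, h2]

theorem Down.height_lt (h : Down lo hi Q s d) : height lo (toggle s d) < height lo s := by
  obtain ⟨p, -, rfl, h1, h2, h3, h4⟩ := h
  rw [Down.toggle_eq h3 h4, height, height, sum_insert (by simp [h3]),
    ← add_sum_erase s _ h4]
  have : (p.1 - lo).toNat < (p.1 + 1 - lo).toNat := by omega
  exact Nat.add_lt_add_right this _

/-- A common site would either be empty for one hop and occupied for the other, or play the same
role in both, and then the hops coincide. -/
theorem Down.disjoint (h : Down lo hi Q s d) (h' : Down lo hi Q s e) (hne : d ≠ e) :
    Disjoint d.sites e.sites := by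
  obtain ⟨⟨x, f⟩, -, rfl, -, -, h3, h4⟩ := h
  obtain ⟨⟨y, g⟩, -, rfl, -, -, h3', h4'⟩ := h'
  rw [Finset.disjoint_left]
  rintro q hq hq'
  simp only [mem_sites, fst_inl, snd_inl] at *
  rcases hq with rfl | rfl <;> rcases hq' with h | h <;> simp only [Prod.mk.injEq] at h <;>
    obtain ⟨h, rfl⟩ := h
  · exact hne (by rw [h])
  · subst h; exact h3 h4'
  · subst h; exact h3' h4
  · have : x = y := by omega
    exact hne (by rw [this])

theorem Down.toggle_of_disjoint (h' : Down lo hi Q s e) (hd : Disjoint d.sites e.sites) :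
    Down lo hi Q (toggle s d) e := by
  obtain ⟨p, hQ, rfl, h1, h2, h3, h4⟩ := h'
  refine ⟨p, hQ, rfl, h1, h2, ?_, ?_⟩
  · exact fun h => h3 ((mem_toggle_of_notMem
      (Finset.disjoint_right.1 hd (fst_mem_sites (Sum.inl p)))).1 h)
  · exact (mem_toggle_of_notMem (Finset.disjoint_right.1 hd (snd_mem_sites (Sum.inl p)))).2 h4

theorem Downs.ok (h : Downs lo hi Q s w) : Ok lo hi s w := by
  induction w generalizing s with
  | nil => trivial
  | cons d w ih => exact ⟨⟨h.1.fits, h.1.valid⟩, ih h.2⟩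

theorem Downs.mem (h : Downs lo hi Q s w) (hd : d ∈ w) : ∃ p ∈ Q, d = Sum.inl p := by
  induction w generalizing s with
  | nil => simp at hd
  | cons e w ih =>
    rcases List.mem_cons.1 hd with rfl | hd
    · obtain ⟨p, hp, rfl, -⟩ := h.1
      exact ⟨p, hp, rfl⟩
    · exact ih h.2 hd

/-- A sequence of downward hops that cannot be continued. -/
def Complete (lo hi : ℤ) (Q : Set Site) (s : Finset Site) (w : List Edge) : Prop :=
  Downs lo hi Q s w ∧ ∀ d, ¬ Down lo hi Q (run s w) d

theorem Complete.cons (h : Down lo hi Q s d) (h' : Complete lo hi Q (toggle s d) w) :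
    Complete lo hi Q s (d :: w) := ⟨⟨h, h'.1⟩, h'.2⟩

/-- Every downward hop lowers `height`, so the process stops. -/
theorem exists_complete (lo hi : ℤ) (Q : Set Site) (s : Finset Site) :
    ∃ w, Complete lo hi Q s w := by
  induction hn : height lo s using Nat.strong_induction_on generalizing s with
  | _ n ih =>
    by_cases h : ∃ d, Down lo hi Q s d
    · obtain ⟨d, hd⟩ := h
      obtain ⟨w, hw⟩ := ih _ (hn ▸ hd.height_lt) _ rfl
      exact ⟨d :: w, hw.cons hd⟩
    · exact ⟨[], trivial, not_exists.1 h⟩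

/-- The diamond argument: two different first hops are disjoint, hence each stays possible after the
other and they commute. Both words are compared with one that performs both hops, by induction on
`height`. -/
theorem Complete.htpy (h : Complete lo hi Q s w) (h' : Complete lo hi Q s w') :
    Htpy lo hi s w w' := by
  induction hn : height lo s using Nat.strong_induction_on generalizing s w w' with
  | _ n ih =>
    subst hn
    rcases w with - | ⟨d, u⟩
    · rcases w' with - | ⟨d', u'⟩
      · exact Htpy.refl trivial
      · exact absurd h'.1.1 (h.2 _)
    · rcases w' with - | ⟨d', u'⟩
      · exact absurd h.1.1 (h'.2 _)
      · have hd := h.1.1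
        have hd' := h'.1.1
        by_cases heq : d = d'
        · subst heq
          exact Htpy.cons hd.fits hd.valid (ih _ hd.height_lt ⟨h.1.2, h.2⟩ ⟨h'.1.2, h'.2⟩ rfl)
        · have hdis := hd.disjoint hd' heq
          have h1 := hd'.toggle_of_disjoint hdis
          have h2 := hd.toggle_of_disjoint hdis.symm
          obtain ⟨c, hc⟩ := exists_complete lo hi Q (toggle (toggle s d) d')
          have hc' := hc
          rw [toggle_comm] at hc'
          have e1 := Htpy.cons hd.fits hd.valid
            (ih _ hd.height_lt ⟨h.1.2, h.2⟩ (hc.cons h1) rfl)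
          have e2 := Htpy.cons hd'.fits hd'.valid
            (ih _ hd'.height_lt ⟨h'.1.2, h'.2⟩ (hc'.cons h2) rfl)
          exact e1.trans ((htpy_comm e1.ok_right hdis).trans e2.symm)

/-- The completed descent serves as a normal form: prefixing it by rungless hops does not change its
homotopy class. It suffices to absorb the hops one at a time. -/
theorem Vertical.htpy_complete (hv : Vertical w) (h : Ok lo hi s w) {c c' : List Edge}
    (hc : Complete lo hi Set.univ s c) (hc' : Complete lo hi Set.univ (run s w) c') :
    Htpy lo hi s (w ++ c') c := by
  induction w generalizing s c with
  | nil => exact hc'.htpy hc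
  | cons d w ih =>
    obtain ⟨c₁, hc₁⟩ := exists_complete lo hi Set.univ (toggle s d)
    have e1 := Htpy.cons h.1.1 h.1.2 (ih (fun e he => hv e (List.mem_cons_of_mem _ he)) h.2 hc₁ hc')
    refine e1.trans ?_
    obtain ⟨p, rfl⟩ := hv d List.mem_cons_self
    have hval := h.1.2
    simp only [Valid, fst_inl, snd_inl] at hval
    by_cases hp : p ∈ s
    · have hd : Down lo hi Set.univ (toggle s (Sum.inl p)) (Sum.inl p) := by
        refine ⟨p, trivial, rfl, h.1.1.1, h.1.1.2, ?_, ?_⟩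
        · exact fun h => (mem_toggle_of_mem (fst_mem_sites (Sum.inl p))).1 h hp
        · exact (mem_toggle_of_mem (snd_mem_sites (Sum.inl p))).2 (hval.1 hp)
      have e2 : Complete lo hi Set.univ (toggle s (Sum.inl p)) (Sum.inl p :: c) := by
        refine Complete.cons hd ?_
        rwa [toggle_toggle]
      have e3 := Htpy.cons h.1.1 h.1.2 (hc₁.htpy e2)
      exact e3.trans (htpy_cancel e3.ok_right)
    · have hd : Down lo hi Set.univ s (Sum.inl p) := 
        ⟨p, trivial, rfl, h.1.1.1, h.1.1.2, hp, by tauto⟩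
      exact (hc₁.cons hd).htpy hc

/-- Particles on two lines cannot be braided. -/
theorem Vertical.htpy (hv : Vertical w) (hv' : Vertical w') (h : Ok lo hi s w)
    (h' : Ok lo hi s w') (hr : run s w = run s w') : Htpy lo hi s w w' := by
  obtain ⟨c, hc⟩ := exists_complete lo hi Set.univ s
  obtain ⟨c', hc'⟩ := exists_complete lo hi Set.univ (run s w)
  -- Followed by the same descent `c'`, both words are homotopic to `c`; then `c'` is undone.
  have e := hv.htpy_complete h hc hc'
  have e' := hv'.htpy_complete h' hc (hr ▸ hc')
  have k := hc'.1.ok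
  have f : Htpy lo hi s (w ++ (c' ++ c'.reverse)) (w ++ []) :=
    Htpy.append_left h (htpy_append_reverse k)
  have f' : Htpy lo hi s (w' ++ (c' ++ c'.reverse)) (w' ++ []) :=
    Htpy.append_left h' (htpy_append_reverse (hr ▸ k))
  have g : Htpy lo hi s (w ++ c' ++ c'.reverse) (w' ++ c' ++ c'.reverse) := by
    refine (e.trans e'.symm).append_right ?_
    rw [run_append]
    exact ok_reverse k
  simp only [List.append_nil, List.append_assoc] at f f' g
  exact f.symm.trans (g.trans f')

end Edge

/-! ### Counting particles; words that avoid a rung -/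

namespace Edge
variable {lo hi : ℤ} {s s' : Finset Site} {w w' : List Edge} {Q : Set Site} {d e : Edge}

/-- The number of particles of the floor `g` over `[a, b)`. -/
def cnt (s : Finset Site) (g : Bool) (a b : ℤ) : ℕ :=
  #{p ∈ s | p.2 = g ∧ a ≤ p.1 ∧ p.1 < b}

theorem cnt_add {a b c : ℤ} (hab : a ≤ b) (hbc : b ≤ c) (s : Finset Site) (g : Bool) :
    cnt s g a b + cnt s g b c = cnt s g a c := by
  rw [cnt, cnt, cnt, ← card_union_of_disjoint]
  · congr 1
    ext p
    simp only [mem_union, mem_filter]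
    constructor
    · rintro (⟨h1, h2, h3, h4⟩ | ⟨h1, h2, h3, h4⟩)
      · exact ⟨h1, h2, h3, by omega⟩
      · exact ⟨h1, h2, by omega, h4⟩
    · rintro ⟨h1, h2, h3, h4⟩
      by_cases h : p.1 < b
      · exact Or.inl ⟨h1, h2, h3, h⟩
      · exact Or.inr ⟨h1, h2, by omega, h4⟩
  · rw [Finset.disjoint_left]
    intro p hp hp'
    have h1 := (mem_filter.1 hp).2.2.2
    have h2 := (mem_filter.1 hp').2.2.1
    omega

theorem cnt_congr {a b : ℤ} {g : Bool} (h : ∀ x, a ≤ x → x < b → ((x, g) ∈ s ↔ (x, g) ∈ s')) :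
    cnt s g a b = cnt s' g a b := by
  rw [cnt, cnt]
  congr 1
  ext ⟨x, f⟩
  simp only [mem_filter]
  constructor
  · rintro ⟨h1, rfl, h2⟩
    exact ⟨(h x h2.1 h2.2).1 h1, rfl, h2⟩
  · rintro ⟨h1, rfl, h2⟩
    exact ⟨(h x h2.1 h2.2).2 h1, rfl, h2⟩

theorem cnt_self (s : Finset Site) (g : Bool) (a : ℤ) : cnt s g a a = 0 := by
  rw [cnt, card_eq_zero, filter_eq_empty_iff]
  rintro p - ⟨-, h⟩
  omega

theorem cnt_single (s : Finset Site) (g : Bool) (x : ℤ) :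
    cnt s g x (x + 1) = if (x, g) ∈ s then 1 else 0 := by
  rw [cnt]
  split_ifs with h
  · rw [card_eq_one]
    refine ⟨(x, g), ?_⟩
    ext ⟨y, f⟩
    simp only [mem_filter, mem_singleton, Prod.mk.injEq]
    constructor
    · rintro ⟨-, h1, h2, h3⟩
      exact ⟨by omega, h1⟩
    · rintro ⟨rfl, rfl⟩
      exact ⟨h, rfl, by omega, by omega⟩
  · rw [card_eq_zero, filter_eq_empty_iff]
    rintro ⟨y, f⟩ hp ⟨h1, h2, h3⟩
    apply h
    have : x = y := by simp only at h2 h3; omega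
    simp only at h1
    rwa [this, ← h1]

theorem cnt_succ {a b : ℤ} (h : a ≤ b) (s : Finset Site) (g : Bool) :
    cnt s g a (b + 1) = cnt s g a b + if (b, g) ∈ s then 1 else 0 := by
  rw [← cnt_add h (by omega : b ≤ b + 1), cnt_single]

theorem cnt_le {a b : ℤ} (h : a ≤ b) (s : Finset Site) (g : Bool) : (cnt s g a b : ℤ) ≤ b - a := by
  obtain ⟨n, rfl⟩ := Int.le.dest h
  clear h
  induction n with
  | zero => simp [cnt_self]
  | succ n ih =>
    push_cast at ih ⊢
    rw [← add_assoc, cnt_succ (by omega)]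
    split_ifs <;> push_cast <;> omega

theorem cnt_toggle_of_mem_iff {a b : ℤ} {g : Bool} (hv : Valid s d)
    (h : (d.fst.2 = g ∧ a ≤ d.fst.1 ∧ d.fst.1 < b) ↔ (d.snd.2 = g ∧ a ≤ d.snd.1 ∧ d.snd.1 < b)) :
    cnt (toggle s d) g a b = cnt s g a b := by
  by_cases hP : d.fst.2 = g ∧ a ≤ d.fst.1 ∧ d.fst.1 < b
  · have hne := fst_ne_snd d
    have key : ∀ (s : Finset Site) (p q : Site), p ≠ q → p ∉ s → q ∈ s →
        (p.2 = g ∧ a ≤ p.1 ∧ p.1 < b) → (q.2 = g ∧ a ≤ q.1 ∧ q.1 < b) →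
        cnt (insert p (s.erase q)) g a b = cnt s g a b := by
      intro s p q hne hp hq h1 h2
      rw [cnt, cnt, filter_insert, if_pos h1, filter_erase, card_insert_of_notMem,
        card_erase_add_one]
      · exact mem_filter.2 ⟨hq, h2⟩
      · simp [hp]
    have hP' := h.1 hP
    by_cases h1 : d.fst ∈ s
    · rw [show toggle s d = insert d.snd (s.erase d.fst) from ?_]
      · exact key s _ _ hne.symm (hv.1 h1) h1 hP' hP
      · ext p
        have := hv.1 h1
        simp only [mem_toggle, mem_sites, mem_insert, mem_erase]
        by_cases e1 : p = d.fst
        · subst e1; simp [h1, hne]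
        · by_cases e2 : p = d.snd
          · subst e2; simp [this]
          · simp [e1, e2]
    · have h2 : d.snd ∈ s := by by_contra h2; exact h1 (hv.2 h2)
      rw [show toggle s d = insert d.fst (s.erase d.snd) from ?_]
      · exact key s _ _ hne h1 h2 hP hP'
      · ext p
        simp only [mem_toggle, mem_sites, mem_insert, mem_erase]
        by_cases e1 : p = d.fst
        · subst e1; simp [h1]
        · by_cases e2 : p = d.snd
          · subst e2; simp [h2, e1]
          · simp [e1, e2]
  · have hP' := fun h' => hP (h.2 h')
    refine cnt_congr fun x h1 h2 => ?_
    refine mem_toggle_of_notMem fun hx => ?_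
    rcases mem_sites.1 hx with h3 | h3
    · apply hP; rw [← h3]; exact ⟨rfl, h1, h2⟩
    · apply hP'; rw [← h3]; exact ⟨rfl, h1, h2⟩

/-- The sites whose edge to the right neighbour avoids the rung at `r`. -/
def avoid (r : ℤ) : Set Site := {p | p.1 ≠ r ∧ p.1 + 1 ≠ r}

theorem Downs.cnt_run {a b : ℤ} {g : Bool} (hw : Downs lo hi Q s w)
    (hQ : ∀ p ∈ Q, lo ≤ p.1 → p.1 + 1 ≤ hi →
      ((a ≤ p.1 ∧ p.1 < b) ↔ (a ≤ p.1 + 1 ∧ p.1 + 1 < b))) :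
    cnt (run s w) g a b = cnt s g a b := by
  induction w generalizing s with
  | nil => rfl
  | cons d w ih =>
    rw [run_cons, ih hw.2]
    have hv := hw.1.valid
    obtain ⟨p, hp, rfl, h1, h2, -⟩ := hw.1
    refine cnt_toggle_of_mem_iff hv ?_
    simp only [fst_inl, snd_inl]
    rw [hQ p hp h1 h2]

theorem mem_run_of_forall_notMem {p : Site} (h : ∀ d ∈ w, p ∉ d.sites) : p ∈ run s w ↔ p ∈ s := by
  induction w generalizing s with
  | nil => rfl
  | cons d w ih =>
    rw [run_cons, ih fun e he => h e (List.mem_cons_of_mem _ he),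
      mem_toggle_of_notMem (h d List.mem_cons_self)]

theorem notMem_sites_of_mem_avoid {r : ℤ} {p q : Site} (hp : p ∈ avoid r) (hq : q.1 = r) :
    q ∉ sites (Sum.inl p) := by
  intro h
  rcases mem_sites.1 h with rfl | rfl
  · exact hp.1 hq
  · exact hp.2 hq

/-- Inside `[a, b)` both states are initial segments of the floor `g`, and these are ordered by
their cardinalities. If `x` were only in `s`, then `s'` would stop before `x` and have strictly
fewer particles. -/
theorem mem_of_closed {a b : ℤ} {g : Bool}
    (hs : ∀ x, a ≤ x → x + 1 < b → (x + 1, g) ∈ s → (x, g) ∈ s)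
    (hs' : ∀ x, a ≤ x → x + 1 < b → (x + 1, g) ∈ s' → (x, g) ∈ s')
    (hc : cnt s g a b ≤ cnt s' g a b) {x : ℤ} (hx : a ≤ x) (hx' : x < b) (hm : (x, g) ∈ s) :
    (x, g) ∈ s' := by
  by_contra hn
  have h1 : ∀ n : ℕ, a ≤ x - n → (x - n, g) ∈ s := by
    intro n
    induction n with
    | zero => intro _; simpa using hm
    | succ n ih =>
      intro h
      push_cast at h ⊢
      have := ih (by omega)
      rw [show x - (n : ℤ) = x - (n + 1) + 1 by ring] at this
      exact hs _ h (by omega) this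
  have h2 : ∀ n : ℕ, x + n < b → (x + n, g) ∉ s' := by
    intro n
    induction n with
    | zero => intro _; simpa using hn
    | succ n ih =>
      intro h hmem
      push_cast at h hmem
      rw [← add_assoc] at h hmem
      exact ih (by omega) (hs' _ (by omega) h hmem)
  refine absurd hc (not_le.2 (card_lt_card ?_))
  rw [Finset.ssubset_iff_of_subset]
  · exact ⟨(x, g), mem_filter.2 ⟨hm, rfl, hx, hx'⟩, fun h => hn (mem_filter.1 h).1⟩
  · rintro ⟨y, f⟩ hy
    obtain ⟨hy1, hf, hy2, hy3⟩ := mem_filter.1 hy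
    simp only at hf hy2 hy3
    subst hf
    refine mem_filter.2 ⟨?_, rfl, hy2, hy3⟩
    rcases le_or_gt x y with h | h
    · obtain ⟨n, rfl⟩ := Int.le.dest h
      exact absurd hy1 (h2 n hy3)
    · have := h1 (x - y).toNat (by omega)
      rwa [show x - ((x - y).toNat : ℤ) = y by omega] at this

/-- Two states that agree at the rung `r` and have the same numbers of particles on both sides of
it are joined by a word that avoids the rung. -/
theorem exists_word_avoid {r : ℤ} (hs : InBox lo hi s) (hs' : InBox lo hi s') (hr : lo ≤ r)
    (hr' : r ≤ hi) (h0 : ∀ g, (r, g) ∈ s ↔ (r, g) ∈ s') (h1 : ∀ g, cnt s g lo r = cnt s' g lo r)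
    (h2 : ∀ g, cnt s g (r + 1) (hi + 1) = cnt s' g (r + 1) (hi + 1)) :
    ∃ u, Ok lo hi s u ∧ run s u = s' ∧ ∀ d ∈ u, ∃ p ∈ avoid r, d = Sum.inl p := by
  -- Push the particles of both states down separately on either side of the rung. The two results
  -- coincide because the counts do; so descend from `s` and climb back to `s'`.
  obtain ⟨c, hc⟩ := exists_complete lo hi (avoid r) s
  obtain ⟨c', hc'⟩ := exists_complete lo hi (avoid r) s'
  have closed : ∀ (s : Finset Site) (c : List Edge), Complete lo hi (avoid r) s c →
      ∀ x g, lo ≤ x → x + 1 ≤ hi → x ≠ r → x + 1 ≠ r → (x + 1, g) ∈ run s c → (x, g) ∈ run s c := by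
    intro s c hc x g hx hx' hxr hxr' hm
    by_contra hn
    exact hc.2 (Sum.inl (x, g)) ⟨(x, g), ⟨hxr, hxr'⟩, rfl, hx, hx', hn, hm⟩
  have avoids : ∀ (s : Finset Site) (c : List Edge), Complete lo hi (avoid r) s c →
      ∀ g, (r, g) ∈ run s c ↔ (r, g) ∈ s := fun s c hc g =>
    mem_run_of_forall_notMem fun d hd => by
      obtain ⟨p, hp, rfl⟩ := hc.1.mem hd
      exact notMem_sites_of_mem_avoid hp rfl
  have left : ∀ (s : Finset Site) (c : List Edge), Complete lo hi (avoid r) s c →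
      ∀ g, cnt (run s c) g lo r = cnt s g lo r := fun s c hc g =>
    hc.1.cnt_run fun p hp h1 h2 => by
      have := hp.1; have := hp.2; omega
  have right : ∀ (s : Finset Site) (c : List Edge), Complete lo hi (avoid r) s c →
      ∀ g, cnt (run s c) g (r + 1) (hi + 1) = cnt s g (r + 1) (hi + 1) := fun s c hc g =>
    hc.1.cnt_run fun p hp h1 h2 => by
      have := hp.1; have := hp.2; omega
  have half : ∀ (s s' : Finset Site) (c c' : List Edge), Complete lo hi (avoid r) s c →
      Complete lo hi (avoid r) s' c' → InBox lo hi s → (∀ g, (r, g) ∈ s ↔ (r, g) ∈ s') →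
      (∀ g, cnt s g lo r = cnt s' g lo r) →
      (∀ g, cnt s g (r + 1) (hi + 1) = cnt s' g (r + 1) (hi + 1)) → run s c ⊆ run s' c' := by
    rintro s s' c c' hc hc' hs h0 h1 h2 ⟨x, g⟩ hx
    have hxb := hs.run hc.1.ok _ hx
    simp only at hxb
    rcases lt_trichotomy x r with h | rfl | h
    · refine mem_of_closed (a := lo) (b := r) ?_ ?_ ?_ hxb.1 h hx
      · intro y hy hy'; exact closed s c hc y g hy (by omega) (by omega) (by omega)
      · intro y hy hy'; exact closed s' c' hc' y g hy (by omega) (by omega) (by omega)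
      · rw [left s c hc, left s' c' hc', h1]
    · rwa [avoids s' c' hc', ← h0, ← avoids s c hc]
    · refine mem_of_closed (a := r + 1) (b := hi + 1) ?_ ?_ ?_ (by omega) (by omega) hx
      · intro y hy hy'; exact closed s c hc y g (by omega) (by omega) (by omega) (by omega)
      · intro y hy hy'; exact closed s' c' hc' y g (by omega) (by omega) (by omega) (by omega)
      · rw [right s c hc, right s' c' hc', h2]
  have heq : run s c = run s' c' := subset_antisymm (half s s' c c' hc hc' hs h0 h1 h2)
    (half s' s c' c hc' hc hs' (fun g => (h0 g).symm) (fun g => (h1 g).symm) fun g => (h2 g).symm)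
  refine ⟨c ++ c'.reverse, ok_append.2 ⟨hc.1.ok, heq ▸ ok_reverse hc'.1.ok⟩, ?_, ?_⟩
  · rw [run_append, heq, run_reverse]
  · intro d hd
    rcases List.mem_append.1 hd with hd | hd
    · exact hc.1.mem hd
    · exact hc'.1.mem (List.mem_reverse.1 hd)

end Edge

/-! ### Moving a rung past its neighbour -/

namespace Edge
variable {lo hi : ℤ} {s s' s₁ s₂ s₃ : Finset Site} {w w' : List Edge} {r r₁ r₂ r₃ : ℤ} {f : Bool}

/-- The particle at `(r, f)` can hop to the other floor. -/
structure HopAt (lo hi : ℤ) (f : Bool) (s : Finset Site) (r : ℤ) : Prop where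
  inBox : InBox lo hi s
  lo_le : lo ≤ r
  le_hi : r ≤ hi
  mem : (r, f) ∈ s
  notMem : (r, !f) ∉ s

theorem HopAt.valid (h : HopAt lo hi f s r) : Valid s (Sum.inr r) := by
  have h1 := h.mem
  have h2 := h.notMem
  cases f <;> simp_all [Valid]

theorem HopAt.fits (h : HopAt lo hi f s r) : Fits lo hi (Sum.inr r) := ⟨h.lo_le, h.le_hi⟩

/-- Two rungs are equivalent if vertical words carry one into the other. -/
def RungEq (lo hi : ℤ) (s₁ : Finset Site) (r₁ : ℤ) (s₂ : Finset Site) (r₂ : ℤ) : Prop :=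
  ∃ u u', Vertical u ∧ Vertical u' ∧ Ok lo hi s₁ u ∧ run s₁ u = s₂ ∧
    Htpy lo hi s₁ (u ++ [Sum.inr r₂]) (Sum.inr r₁ :: u')

theorem RungEq.symm (h : RungEq lo hi s₁ r₁ s₂ r₂) : RungEq lo hi s₂ r₂ s₁ r₁ := by
  obtain ⟨u, u', hu, hu', hok, rfl, hh⟩ := h
  have hok' : Ok lo hi (toggle s₁ (Sum.inr r₁)) u' := hh.ok_right.2
  refine ⟨u.reverse, u'.reverse, hu.reverse, hu'.reverse, ok_reverse hok, run_reverse, ?_⟩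
  have h1 : Ok lo hi s₁ [Sum.inr r₁] := ⟨hh.ok_right.1, trivial⟩
  have h2 : Htpy lo hi s₁ [Sum.inr r₁] ([Sum.inr r₁] ++ (u' ++ u'.reverse)) := by
    simpa using Htpy.append_left h1 (htpy_nil_append_reverse hok')
  have h3 : Htpy lo hi s₁ (Sum.inr r₁ :: u' ++ u'.reverse) (u ++ [Sum.inr r₂] ++ u'.reverse) :=
    hh.symm.append_right (ok_reverse hok')
  have h4 : Htpy lo hi s₁ [Sum.inr r₁] (u ++ ([Sum.inr r₂] ++ u'.reverse)) := by
    simpa using h2.trans h3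
  have h5 : Htpy lo hi (run s₁ u) (u.reverse ++ [Sum.inr r₁])
      (u.reverse ++ (u ++ ([Sum.inr r₂] ++ u'.reverse))) := by
    refine Htpy.append_left (ok_reverse hok) ?_
    rwa [run_reverse]
  have h6 : Htpy lo hi (run s₁ u) (u.reverse ++ u ++ ([Sum.inr r₂] ++ u'.reverse))
      ([] ++ ([Sum.inr r₂] ++ u'.reverse)) := by
    refine (htpy_reverse_append hok).append_right ?_
    rw [run_append, run_reverse]
    exact (ok_append.1 h4.ok_right).2
  rw [List.append_assoc] at h6
  exact h5.trans h6

theorem RungEq.trans (h : RungEq lo hi s₁ r₁ s₂ r₂) (h' : RungEq lo hi s₂ r₂ s₃ r₃) :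
    RungEq lo hi s₁ r₁ s₃ r₃ := by
  obtain ⟨u, u', hu, hu', hok, rfl, hh⟩ := h
  obtain ⟨v, v', hv, hv', hok', rfl, hh'⟩ := h'
  refine ⟨u ++ v, u' ++ v', hu.append hv, hu'.append hv', ok_append.2 ⟨hok, hok'⟩, by simp, ?_⟩
  have h1 := Htpy.append_left hok hh'
  have h2 := hh.append_right (u := v') (by
    have := (ok_append.1 h1.ok_right).2
    rw [run_append]
    exact this.2)
  rw [List.append_assoc] at h2
  rw [List.append_assoc]
  exact h1.trans h2

theorem htpy_append_singleton {d : Edge} (hf : Fits lo hi d) (hd : Valid s d) (hw : Ok lo hi s w)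
    (h : ∀ e ∈ w, Disjoint d.sites e.sites) : Htpy lo hi s (w ++ [d]) (d :: w) := by
  induction w generalizing s with
  | nil => exact Htpy.refl ⟨⟨hf, hd⟩, trivial⟩
  | cons e w ih =>
    have he := h e List.mem_cons_self
    have h1 := Htpy.cons hw.1.1 hw.1.2 (ih ((valid_toggle_of_disjoint he.symm).2 hd) hw.2
      fun e' he' => h e' (List.mem_cons_of_mem _ he'))
    exact h1.trans (htpy_comm h1.ok_right he.symm)

/-- The two states are joined by a word that avoids the rung, and such a word commutes with the
rung. -/
theorem rungEq_of_cnt (h₁ : HopAt lo hi f s₁ r) (h₂ : HopAt lo hi f s₂ r)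
    (hl : ∀ g, cnt s₁ g lo r = cnt s₂ g lo r)
    (hr : ∀ g, cnt s₁ g (r + 1) (hi + 1) = cnt s₂ g (r + 1) (hi + 1)) :
    RungEq lo hi s₁ r s₂ r := by
  have h0 : ∀ g, (r, g) ∈ s₁ ↔ (r, g) ∈ s₂ := by
    intro g
    have := h₁.mem; have := h₁.notMem; have := h₂.mem; have := h₂.notMem
    cases f <;> cases g <;> simp_all
  obtain ⟨u, hu, hrun, hav⟩ := exists_word_avoid h₁.inBox h₂.inBox h₁.lo_le h₁.le_hi h0 hl hr
  have hvert : Vertical u := fun d hd => let ⟨p, _, hp⟩ := hav d hd; ⟨p, hp⟩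
  refine ⟨u, u, hvert, hvert, hu, hrun, htpy_append_singleton h₁.fits h₁.valid hu ?_⟩
  intro e he
  obtain ⟨p, hp, rfl⟩ := hav e he
  rw [Finset.disjoint_left]
  intro q hq
  refine notMem_sites_of_mem_avoid hp ?_
  rcases mem_sites.1 hq with rfl | rfl <;> rfl

/-- The state that agrees with `s₁` to the left of `r`, with `X` over `{r, r + 1}`, and with `s₂`
to the right of `r + 1`. -/
def splice (s₁ X s₂ : Finset Site) (r : ℤ) : Finset Site :=
  {p ∈ s₁ | p.1 < r} ∪ {p ∈ X | p.1 = r ∨ p.1 = r + 1} ∪ {p ∈ s₂ | r + 1 < p.1}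

theorem mem_splice {X : Finset Site} {p : Site} : p ∈ splice s₁ X s₂ r ↔
    (p ∈ s₁ ∧ p.1 < r) ∨ (p ∈ X ∧ (p.1 = r ∨ p.1 = r + 1)) ∨ (p ∈ s₂ ∧ r + 1 < p.1) := by
  simp [splice]

theorem mem_splice_left {X : Finset Site} {g : Bool} :
    (r, g) ∈ splice s₁ X s₂ r ↔ (r, g) ∈ X := by
  simp [mem_splice]

theorem mem_splice_right {X : Finset Site} {g : Bool} :
    (r + 1, g) ∈ splice s₁ X s₂ r ↔ (r + 1, g) ∈ X := by
  simp [mem_splice]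

theorem cnt_splice_left (X : Finset Site) (g : Bool) :
    cnt (splice s₁ X s₂ r) g lo r = cnt s₁ g lo r := by
  refine cnt_congr fun x _ hx => ?_
  rw [mem_splice]
  constructor
  · rintro (h | h | h)
    · exact h.1
    · simp only at h; omega
    · simp only at h; omega
  · intro h
    exact Or.inl ⟨h, hx⟩

theorem cnt_splice_right (X : Finset Site) (g : Bool) :
    cnt (splice s₁ X s₂ r) g (r + 1 + 1) (hi + 1) = cnt s₂ g (r + 1 + 1) (hi + 1) := by
  refine cnt_congr fun x hx _ => ?_
  rw [mem_splice]
  constructor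
  · rintro (h | h | h)
    · simp only at h; omega
    · simp only at h; omega
    · exact h.1
  · intro h
    exact Or.inr (Or.inr ⟨h, by simp only; omega⟩)

theorem inBox_splice (X : Finset Site) (h₁ : InBox lo hi s₁) (h₂ : InBox lo hi s₂) (hl : lo ≤ r)
    (hr : r + 1 ≤ hi) : InBox lo hi (splice s₁ X s₂ r) := by
  intro p hp
  rcases mem_splice.1 hp with h | h | h
  · exact h₁ p h.1
  · omega
  · exact h₂ p h.1

theorem cnt_total {b : ℤ} (hl : lo ≤ r) (hr : r < b) (s : Finset Site) (g : Bool) :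
    cnt s g lo b = cnt s g lo r + (if (r, g) ∈ s then 1 else 0) + cnt s g (r + 1) b := by
  rw [← cnt_single, cnt_add hl (by omega), cnt_add (by omega) (by omega)]

theorem eq_or_eq_not (f g : Bool) : g = f ∨ g = !f := by cases f <;> cases g <;> simp

/-- This brings the columns `r` and `r + 1` into the arrangement `X` without changing the class of
the rung at `r`. The condition `hc` says that `s₁` to the left together with `X` accounts for the
particles of `s₂` in all columns up to `r + 1`, so the right part of `s₂` fits. -/
theorem rungEq_splice_left {X : Finset Site} (h₁ : HopAt lo hi f s₁ r) (h₂ : HopAt lo hi f s₂ (r + 1))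
    (ht : ∀ g, cnt s₁ g lo (hi + 1) = cnt s₂ g lo (hi + 1))
    (hf : (r, f) ∈ X) (hf' : (r, !f) ∉ X)
    (hc : ∀ g, cnt s₁ g lo r + (if (r, g) ∈ X then 1 else 0) + (if (r + 1, g) ∈ X then 1 else 0) =
      cnt s₂ g lo (r + 1) + if g = f then 1 else 0) :
    HopAt lo hi f (splice s₁ X s₂ r) r ∧ RungEq lo hi s₁ r (splice s₁ X s₂ r) r := by
  have h3 : HopAt lo hi f (splice s₁ X s₂ r) r :=
    ⟨inBox_splice X h₁.inBox h₂.inBox h₁.lo_le h₂.le_hi, h₁.lo_le, h₁.le_hi,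
      mem_splice_left.2 hf, fun h => hf' (mem_splice_left.1 h)⟩
  refine ⟨h3, rungEq_of_cnt h₁ h3 (fun g => (cnt_splice_left X g).symm) fun g => ?_⟩
  have hr := h₂.le_hi
  have e1 := cnt_total h₁.lo_le (by omega : r < hi + 1) s₁ g
  have e2 := cnt_total h₂.lo_le (by omega : r + 1 < hi + 1) s₂ g
  have e3 := cnt_total (le_refl (r + 1)) (by omega : r + 1 < hi + 1) (splice s₁ X s₂ r) g
  rw [cnt_splice_right, cnt_self] at e3
  simp only [mem_splice_right] at e3
  have e4 := ht g
  have e5 := hc g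
  have i1 : (r, g) ∈ s₁ ↔ g = f := by
    have := h₁.mem; have := h₁.notMem
    rcases eq_or_eq_not f g with rfl | rfl <;> simp_all
  have i2 : (r + 1, g) ∈ s₂ ↔ g = f := by
    have := h₂.mem; have := h₂.notMem
    rcases eq_or_eq_not f g with rfl | rfl <;> simp_all
  have i3 : (r, g) ∈ X ↔ g = f := by
    rcases eq_or_eq_not f g with rfl | rfl <;> simp_all
  simp only [i1] at e1
  simp only [i2] at e2
  simp only [i3] at e5
  omega

theorem rungEq_splice_right {X : Finset Site} (h₁ : HopAt lo hi f s₁ r) (h₂ : HopAt lo hi f s₂ (r + 1))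
    (hf : (r + 1, f) ∈ X) (hf' : (r + 1, !f) ∉ X)
    (hc : ∀ g, cnt s₁ g lo r + (if (r, g) ∈ X then 1 else 0) = cnt s₂ g lo (r + 1)) :
    HopAt lo hi f (splice s₁ X s₂ r) (r + 1) ∧
      RungEq lo hi (splice s₁ X s₂ r) (r + 1) s₂ (r + 1) := by
  have h3 : HopAt lo hi f (splice s₁ X s₂ r) (r + 1) :=
    ⟨inBox_splice X h₁.inBox h₂.inBox h₁.lo_le h₂.le_hi, h₂.lo_le, h₂.le_hi,
      mem_splice_right.2 hf, fun h => hf' (mem_splice_right.1 h)⟩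
  refine ⟨h3, rungEq_of_cnt h3 h₂ (fun g => ?_) fun g => cnt_splice_right X g⟩
  rw [cnt_succ h₁.lo_le, cnt_splice_left]
  simp only [mem_splice_left]
  exact hc g

/-- Arrange two particles on the floor `f` at `r` and `r + 1`, opposite two empty sites. The rung at
`r + 1` is homotopic to itself preceded by the rung at `r` twice. After the first of the three hops
the particles lie on a diagonal, so the last two flip to rails: one rung at `r` followed by a
rungless word. -/
theorem rungEq_of_succ_same (h₁ : HopAt lo hi f s₁ r) (h₂ : HopAt lo hi f s₂ (r + 1))
    (ht : ∀ g, cnt s₁ g lo (hi + 1) = cnt s₂ g lo (hi + 1))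
    (hf : cnt s₂ f lo (r + 1) = cnt s₁ f lo r + 1)
    (hf' : cnt s₂ (!f) lo (r + 1) = cnt s₁ (!f) lo r) : RungEq lo hi s₁ r s₂ (r + 1) := by
  set X : Finset Site := {(r, f), (r + 1, f)} with hX
  have hr := h₂.le_hi
  obtain ⟨h3, e1⟩ := rungEq_splice_left (X := X) h₁ h₂ ht (by simp [hX]) (by simp [hX]) (by
    intro g
    rcases eq_or_eq_not f g with rfl | rfl
    · simp [hX]; omega
    · simp [hX]; omega)
  obtain ⟨h4, e2⟩ := rungEq_splice_right (X := X) h₁ h₂ (by simp [hX]) (by simp [hX]) (by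
    intro g
    rcases eq_or_eq_not f g with rfl | rfl
    · simp [hX]; omega
    · simp [hX]; omega)
  refine e1.trans (RungEq.trans ?_ e2)
  generalize splice s₁ X s₂ r = t at h3 h4
  have dz : Disjoint (sites (Sum.inr r)) (sites (Sum.inr (r + 1))) := disjoint_inr (by omega)
  refine ⟨[], [Sum.inl (r, false), Sum.inl (r, true)], vertical_nil, ?_, trivial, rfl, ?_⟩
  · intro d hd; simp at hd; rcases hd with rfl | rfl <;> exact ⟨_, rfl⟩
  have a1 : Htpy lo hi t [Sum.inr (r + 1)] (Sum.inr r :: Sum.inr r :: [Sum.inr (r + 1)]) :=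
    htpy_insert ⟨⟨h4.fits, h4.valid⟩, trivial⟩ h3.fits h3.valid
  refine a1.trans (Htpy.cons h3.fits h3.valid (htpy_flip a1.ok_right.2 ?_ ?_))
  all_goals
    have := h3.mem; have := h3.notMem; have := h4.mem; have := h4.notMem
    cases f <;> simp_all [Valid, mem_toggle, mem_sites]

/-- Arrange the particles on a diagonal, `X`; the two rails lead to the other diagonal `Y`. With
`z`, `z'` the rungs at `r`, `r + 1`, the rails flip to `z z'`, so the rails followed by `z'` are
homotopic to `z z' z'`, that is, to `z`. -/
theorem rungEq_of_succ_other (h₁ : HopAt lo hi f s₁ r) (h₂ : HopAt lo hi f s₂ (r + 1))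
    (ht : ∀ g, cnt s₁ g lo (hi + 1) = cnt s₂ g lo (hi + 1))
    (hf : cnt s₂ f lo (r + 1) = cnt s₁ f lo r)
    (hf' : cnt s₂ (!f) lo (r + 1) = cnt s₁ (!f) lo r + 1) : RungEq lo hi s₁ r s₂ (r + 1) := by
  set X : Finset Site := {(r, f), (r + 1, !f)} with hX
  set Y : Finset Site := {(r, !f), (r + 1, f)} with hY
  have hr := h₂.le_hi
  obtain ⟨h3, e1⟩ := rungEq_splice_left (X := X) h₁ h₂ ht (by simp [hX]) (by simp [hX]) (by
    intro g
    rcases eq_or_eq_not f g with rfl | rfl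
    · simp [hX]; omega
    · simp [hX]; omega)
  obtain ⟨h4, e2⟩ := rungEq_splice_right (X := Y) h₁ h₂ (by simp [hY]) (by simp [hY]) (by
    intro g
    rcases eq_or_eq_not f g with rfl | rfl
    · simp [hY]; omega
    · simp [hY]; omega)
  refine e1.trans (RungEq.trans ?_ e2)
  have hrun : run (splice s₁ X s₂ r) [Sum.inl (r, false), Sum.inl (r, true)] =
      splice s₁ Y s₂ r := by
    ext ⟨y, g⟩
    simp only [run_cons, run_nil, mem_toggle, mem_splice, mem_sites, fst_inl, snd_inl, hX, hY,
      mem_insert, mem_singleton, Prod.mk.injEq]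
    by_cases c1 : y = r
    · subst c1; cases f <;> cases g <;> simp
    · by_cases c2 : y = r + 1
      · subst c2; cases f <;> cases g <;> simp
      · simp [c1, c2]
  have m1 := (mem_splice_left (s₁ := s₁) (X := X) (s₂ := s₂) (r := r) (g := f)).2 (by simp [hX])
  have m2 := mt (mem_splice_left (s₁ := s₁) (X := X) (s₂ := s₂) (r := r) (g := !f)).1
    (by simp [hX])
  have m3 := (mem_splice_right (s₁ := s₁) (X := X) (s₂ := s₂) (r := r) (g := !f)).2 (by simp [hX])
  have m4 := mt (mem_splice_right (s₁ := s₁) (X := X) (s₂ := s₂) (r := r) (g := f)).1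
    (by simp [hX])
  have hb := h3.inBox
  rw [← hrun] at h4 ⊢
  generalize splice s₁ X s₂ r = t at *
  have v1 : Valid t (Sum.inl (r, false)) := by cases f <;> simp_all [Valid]
  have v2 : Valid t (Sum.inl (r, true)) := by cases f <;> simp_all [Valid]
  have v3 : Valid t (Sum.inr r) := by cases f <;> simp_all [Valid]
  have v4 : Valid t (Sum.inr (r + 1)) := by cases f <;> simp_all [Valid]
  have e := htpy_flip_symm h₁.lo_le h₂.le_hi v1 v2 v3 v4
  refine ⟨[Sum.inl (r, false), Sum.inl (r, true)], [], ?_, vertical_nil, e.ok_left, rfl, ?_⟩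
  · intro d hd; simp at hd; rcases hd with rfl | rfl <;> exact ⟨_, rfl⟩
  have a := e.append_right (u := [Sum.inr (r + 1)]) ⟨⟨h4.fits, h4.valid⟩, trivial⟩
  exact a.trans (Htpy.cons a.ok_right.1.1 a.ok_right.1.2 (htpy_cancel a.ok_right.2))

end Edge

/-! ### Levels, and the equivalence of rungs at the same level -/

namespace Edge
variable {lo hi : ℤ} {s s' s₁ s₂ s₃ : Finset Site} {w w' : List Edge} {r r₁ r₂ r₃ : ℤ} {f : Bool}

theorem cnt_eq_of_forall {g : Bool} {a b c d : ℤ} (hac : a ≤ c) (hcd : c ≤ d) (hdb : d ≤ b)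
    (h : ∀ x, a ≤ x → x < b → ((x, g) ∈ s ↔ c ≤ x ∧ x < d)) : (cnt s g a b : ℤ) = d - c := by
  rw [cnt, show {p ∈ s | p.2 = g ∧ a ≤ p.1 ∧ p.1 < b} = (Ico c d).map ⟨fun x => (x, g), fun x y h =>
    congrArg Prod.fst h⟩ from ?_, card_map, Int.card_Ico, Int.toNat_of_nonneg (by omega)]
  ext ⟨x, f⟩
  simp only [mem_filter, mem_map, mem_Ico]
  constructor
  · rintro ⟨h1, rfl, h2, h3⟩
    exact ⟨x, (h x h2 h3).1 h1, rfl⟩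
  · rintro ⟨y, ⟨h1, h2⟩, hy⟩
    obtain ⟨rfl, rfl⟩ := Prod.mk.inj hy
    exact ⟨(h y (by omega) (by omega)).2 ⟨h1, h2⟩, rfl, by omega, by omega⟩

open Classical in
/-- The state whose occupied sites are those of the box with a given property. -/
noncomputable def ofPred (lo hi : ℤ) (P : ℤ → Bool → Prop) : Finset Site :=
  {p ∈ Icc lo hi ×ˢ univ | P p.1 p.2}

theorem mem_ofPred {P : ℤ → Bool → Prop} {x : ℤ} {g : Bool} :
    (x, g) ∈ ofPred lo hi P ↔ (lo ≤ x ∧ x ≤ hi) ∧ P x g := by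
  simp [ofPred]

theorem inBox_ofPred (P : ℤ → Bool → Prop) : InBox lo hi (ofPred lo hi P) := by
  rintro ⟨x, g⟩ h
  exact (mem_ofPred.1 h).1

/-- The inequalities say that the prescribed particles fit into the columns on both sides of `r`.
The state packs those on the left against the wall `lo`, and those on the right directly after `r`.
-/
theorem exists_hopAt (hl : lo ≤ r) (hr : r ≤ hi) {i j a b : ℤ} (hi0 : 0 ≤ i) (hj0 : 0 ≤ j)
    (hi1 : i ≤ r - lo) (hj1 : j ≤ r - lo) (ha : i < a) (hb : j ≤ b) (ha1 : a - 1 - i ≤ hi - r)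
    (hb1 : b - j ≤ hi - r) : ∃ s, HopAt lo hi f s r ∧ (cnt s f lo r : ℤ) = i ∧
      (cnt s (!f) lo r : ℤ) = j ∧ (cnt s f lo (hi + 1) : ℤ) = a ∧
      (cnt s (!f) lo (hi + 1) : ℤ) = b := by
  set s := ofPred lo hi fun x g => (g = f ∧ (x < lo + i ∨ x = r ∨ (r < x ∧ x < r + a - i))) ∨
    (g = (!f) ∧ (x < lo + j ∨ (r < x ∧ x < r + 1 + b - j))) with hs
  have m1 : ∀ x, (x, f) ∈ s ↔ (lo ≤ x ∧ x ≤ hi) ∧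
      (x < lo + i ∨ x = r ∨ (r < x ∧ x < r + a - i)) := by
    intro x; rw [hs, mem_ofPred]; simp
  have m2 : ∀ x, (x, !f) ∈ s ↔ (lo ≤ x ∧ x ≤ hi) ∧
      (x < lo + j ∨ (r < x ∧ x < r + 1 + b - j)) := by
    intro x; rw [hs, mem_ofPred]; simp
  have c1 : (cnt s f lo r : ℤ) = lo + i - lo := by
    refine cnt_eq_of_forall le_rfl (by omega) (by omega) fun x h1 h2 => ?_
    rw [m1]; omega
  have c2 : (cnt s (!f) lo r : ℤ) = lo + j - lo := by
    refine cnt_eq_of_forall le_rfl (by omega) (by omega) fun x h1 h2 => ?_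
    rw [m2]; omega
  have c3 : (cnt s f (r + 1) (hi + 1) : ℤ) = (r + a - i) - (r + 1) := by
    refine cnt_eq_of_forall le_rfl (by omega) (by omega) fun x h1 h2 => ?_
    rw [m1]; omega
  have c4 : (cnt s (!f) (r + 1) (hi + 1) : ℤ) = (r + 1 + b - j) - (r + 1) := by
    refine cnt_eq_of_forall le_rfl (by omega) (by omega) fun x h1 h2 => ?_
    rw [m2]; omega
  have n1 : (r, f) ∈ s := by rw [m1]; omega
  have n2 : (r, !f) ∉ s := by rw [m2]; omega
  refine ⟨s, ⟨inBox_ofPred _, hl, hr, n1, n2⟩, by omega, by omega, ?_, ?_⟩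
  · rw [cnt_total hl (by omega), if_pos n1]; push_cast; omega
  · rw [cnt_total hl (by omega), if_neg n2]; push_cast; omega

/-- Iterates `rungEq_of_succ_same`: each step to the right puts one more particle of the floor `f`
to the left of the rung. The point is that the intermediate states exist. -/
theorem rungEq_of_add_same (n : ℕ) (h₁ : HopAt lo hi f s₁ r) (h₂ : HopAt lo hi f s₂ (r + n))
    (ht : ∀ g, cnt s₁ g lo (hi + 1) = cnt s₂ g lo (hi + 1))
    (hf : cnt s₂ f lo (r + n) = cnt s₁ f lo r + n)
    (hf' : cnt s₂ (!f) lo (r + n) = cnt s₁ (!f) lo r) : RungEq lo hi s₁ r s₂ (r + n) := by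
  induction n generalizing s₂ with
  | zero =>
    simp only [Nat.cast_zero, add_zero] at *
    have hr := h₁.le_hi
    refine rungEq_of_cnt h₁ h₂ (fun g => ?_) fun g => ?_
    · rcases eq_or_eq_not f g with rfl | rfl <;> omega
    · have e1 := cnt_total h₁.lo_le (by omega : r < hi + 1) s₁ g
      have e2 := cnt_total h₁.lo_le (by omega : r < hi + 1) s₂ g
      have := ht g
      rcases eq_or_eq_not f g with rfl | rfl
      · rw [if_pos h₁.mem] at e1; rw [if_pos h₂.mem] at e2; omega
      · rw [if_neg h₁.notMem] at e1; rw [if_neg h₂.notMem] at e2; omega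
  | succ n ih =>
    push_cast at *
    rw [← add_assoc] at *
    have l1 := h₁.lo_le
    have l2 := h₂.le_hi
    have e1 := cnt_total l1 (by omega : r < hi + 1) s₁ f
    have e2 := cnt_total l1 (by omega : r < hi + 1) s₁ (!f)
    have e3 := cnt_total h₂.lo_le (by omega : r + n + 1 < hi + 1) s₂ f
    have e4 := cnt_total h₂.lo_le (by omega : r + n + 1 < hi + 1) s₂ (!f)
    rw [if_pos h₁.mem] at e1
    rw [if_neg h₁.notMem] at e2
    rw [if_pos h₂.mem] at e3
    rw [if_neg h₂.notMem] at e4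
    have b1 := cnt_le l1 s₁ f
    have b2 := cnt_le l1 s₁ (!f)
    have b3 := cnt_le (by omega : r + n + 1 + 1 ≤ hi + 1) s₂ f
    have b4 := cnt_le (by omega : r + n + 1 + 1 ≤ hi + 1) s₂ (!f)
    have t1 := ht f
    have t2 := ht (!f)
    obtain ⟨t, h3, c1, c2, c3, c4⟩ := exists_hopAt (f := f) (r := r + n) (lo := lo) (hi := hi)
      (i := cnt s₁ f lo r + n) (j := cnt s₁ (!f) lo r) (a := cnt s₁ f lo (hi + 1))
      (b := cnt s₁ (!f) lo (hi + 1)) (by omega) (by omega) (by omega) (by omega) (by omega)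
      (by omega) (by omega) (by omega) (by omega) (by omega)
    have ht' : ∀ g, cnt s₁ g lo (hi + 1) = cnt t g lo (hi + 1) := by
      intro g
      rcases eq_or_eq_not f g with rfl | rfl <;> omega
    refine (ih h3 ht' (by omega) (by omega)).trans ?_
    exact rungEq_of_succ_same h3 h₂ (fun g => (ht' g).symm.trans (ht g)) (by omega) (by omega)

theorem rungEq_of_add_other (n : ℕ) (h₁ : HopAt lo hi f s₁ r) (h₂ : HopAt lo hi f s₂ (r + n))
    (ht : ∀ g, cnt s₁ g lo (hi + 1) = cnt s₂ g lo (hi + 1))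
    (hf : cnt s₂ f lo (r + n) = cnt s₁ f lo r)
    (hf' : cnt s₂ (!f) lo (r + n) = cnt s₁ (!f) lo r + n) : RungEq lo hi s₁ r s₂ (r + n) := by
  induction n generalizing s₂ with
  | zero => exact rungEq_of_add_same 0 h₁ h₂ ht hf hf'
  | succ n ih =>
    push_cast at *
    rw [← add_assoc] at *
    have l1 := h₁.lo_le
    have l2 := h₂.le_hi
    have e1 := cnt_total l1 (by omega : r < hi + 1) s₁ f
    have e2 := cnt_total l1 (by omega : r < hi + 1) s₁ (!f)
    have e3 := cnt_total h₂.lo_le (by omega : r + n + 1 < hi + 1) s₂ f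
    have e4 := cnt_total h₂.lo_le (by omega : r + n + 1 < hi + 1) s₂ (!f)
    rw [if_pos h₁.mem] at e1
    rw [if_neg h₁.notMem] at e2
    rw [if_pos h₂.mem] at e3
    rw [if_neg h₂.notMem] at e4
    have b1 := cnt_le l1 s₁ f
    have b2 := cnt_le l1 s₁ (!f)
    have b3 := cnt_le (by omega : r + n + 1 + 1 ≤ hi + 1) s₂ f
    have b4 := cnt_le (by omega : r + n + 1 + 1 ≤ hi + 1) s₂ (!f)
    have b5 := cnt_le (by omega : r + 1 ≤ hi + 1) s₁ (!f)
    have t1 := ht f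
    have t2 := ht (!f)
    obtain ⟨t, h3, c1, c2, c3, c4⟩ := exists_hopAt (f := f) (r := r + n) (lo := lo) (hi := hi)
      (i := cnt s₁ f lo r) (j := cnt s₁ (!f) lo r + n) (a := cnt s₁ f lo (hi + 1))
      (b := cnt s₁ (!f) lo (hi + 1)) (by omega) (by omega) (by omega) (by omega) (by omega)
      (by omega) (by omega) (by omega) (by omega) (by omega)
    have ht' : ∀ g, cnt s₁ g lo (hi + 1) = cnt t g lo (hi + 1) := by
      intro g
      rcases eq_or_eq_not f g with rfl | rfl <;> omega
    refine (ih h3 ht' (by omega) (by omega)).trans ?_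
    exact rungEq_of_succ_other h3 h₂ (fun g => (ht' g).symm.trans (ht g)) (by omega) (by omega)

/-- The excess of particles to the left of `x`. -/
def level (lo : ℤ) (s : Finset Site) (x : ℤ) : ℤ :=
  cnt s false lo x + cnt s true lo x - (x - lo)

theorem level_eq (f : Bool) (lo : ℤ) (s : Finset Site) (x : ℤ) :
    level lo s x = cnt s f lo x + cnt s (!f) lo x - (x - lo) := by
  cases f <;> simp [level, add_comm]

/-- Rungs at the same level are equivalent. -/
theorem rungEq_of_level (h₁ : HopAt lo hi f s₁ r₁) (h₂ : HopAt lo hi f s₂ r₂)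
    (ht : ∀ g, cnt s₁ g lo (hi + 1) = cnt s₂ g lo (hi + 1)) (hn : level lo s₁ (hi + 1) = 0)
    (hk : level lo s₁ r₁ = level lo s₂ r₂) : RungEq lo hi s₁ r₁ s₂ r₂ := by
  rw [level_eq f] at hn
  rw [level_eq f, level_eq f] at hk
  have l1 := h₁.lo_le
  have l2 := h₁.le_hi
  have l3 := h₂.lo_le
  have l4 := h₂.le_hi
  have e1 := cnt_total l1 (by omega : r₁ < hi + 1) s₁ f
  have e2 := cnt_total l1 (by omega : r₁ < hi + 1) s₁ (!f)
  have e3 := cnt_total l3 (by omega : r₂ < hi + 1) s₂ f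
  have e4 := cnt_total l3 (by omega : r₂ < hi + 1) s₂ (!f)
  rw [if_pos h₁.mem] at e1
  rw [if_neg h₁.notMem] at e2
  rw [if_pos h₂.mem] at e3
  rw [if_neg h₂.notMem] at e4
  have b1 := cnt_le l1 s₁ f
  have b2 := cnt_le l1 s₁ (!f)
  have b3 := cnt_le l3 s₂ f
  have b4 := cnt_le l3 s₂ (!f)
  have b5 := cnt_le (by omega : r₁ + 1 ≤ hi + 1) s₁ f
  have b6 := cnt_le (by omega : r₁ + 1 ≤ hi + 1) s₁ (!f)
  have b7 := cnt_le (by omega : r₂ + 1 ≤ hi + 1) s₂ f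
  have b8 := cnt_le (by omega : r₂ + 1 ≤ hi + 1) s₂ (!f)
  have t1 := ht f
  have t2 := ht (!f)
  -- The intermediate rung has the left count of `s₂` on the floor `f` and that of `s₁` on the other
  -- floor; this position gives it the common level. Thus each half of the path changes the left
  -- count of one floor only. The half filling `hn` turns the bounds on the counts into the room
  -- needed on the right.
  obtain ⟨r, hr⟩ : ∃ r, r = r₁ + cnt s₂ f lo r₂ - cnt s₁ f lo r₁ := ⟨_, rfl⟩
  obtain ⟨t, h3, c1, c2, c3, c4⟩ := exists_hopAt (f := f) (r := r) (lo := lo) (hi := hi)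
    (i := cnt s₂ f lo r₂) (j := cnt s₁ (!f) lo r₁) (a := cnt s₁ f lo (hi + 1))
    (b := cnt s₁ (!f) lo (hi + 1)) (by omega) (by omega) (by omega) (by omega) (by omega)
    (by omega) (by omega) (by omega) (by omega) (by omega)
  have ht₁ : ∀ g, cnt s₁ g lo (hi + 1) = cnt t g lo (hi + 1) := by
    intro g
    rcases eq_or_eq_not f g with rfl | rfl <;> omega
  have ht₂ : ∀ g, cnt t g lo (hi + 1) = cnt s₂ g lo (hi + 1) := fun g =>
    (ht₁ g).symm.trans (ht g)
  have q1 : RungEq lo hi s₁ r₁ t r := by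
    rcases le_total r₁ r with h | h
    · obtain ⟨n, rfl⟩ := Int.le.dest h
      exact rungEq_of_add_same n h₁ h3 ht₁ (by omega) (by omega)
    · obtain ⟨n, rfl⟩ := Int.le.dest h
      exact (rungEq_of_add_same n h3 h₁ (fun g => (ht₁ g).symm) (by omega) (by omega)).symm
  have q2 : RungEq lo hi t r s₂ r₂ := by
    rcases le_total r r₂ with h | h
    · obtain ⟨n, rfl⟩ := Int.le.dest h
      exact rungEq_of_add_other n h3 h₂ ht₂ (by omega) (by omega)
    · obtain ⟨n, rfl⟩ := Int.le.dest h
      exact (rungEq_of_add_other n h₂ h3 (fun g => (ht₂ g).symm) (by omega) (by omega)).symm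
  exact q1.trans q2

end Edge

/-! ### The letters of a word, and the cancellation of inverse letters -/

namespace Edge
variable {lo hi : ℤ} {s s' s₁ s₂ s₃ : Finset Site} {w w' : List Edge} {r r₁ r₂ x y : ℤ} {f : Bool}

/-- The levels and the initial floors of the particles that change floor. -/
def letters (lo : ℤ) : Finset Site → List Edge → List (ℤ × Bool)
  | _, [] => []
  | s, Sum.inl p :: w => letters lo (toggle s (Sum.inl p)) w
  | s, Sum.inr x :: w =>
      (level lo s x, decide ((x, true) ∈ s)) :: letters lo (toggle s (Sum.inr x)) w

@[simp] theorem letters_nil : letters lo s [] = [] := rfl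
@[simp] theorem letters_inl (p : ℤ × Bool) :
    letters lo s (Sum.inl p :: w) = letters lo (toggle s (Sum.inl p)) w := rfl
@[simp] theorem letters_inr : letters lo s (Sum.inr x :: w) =
    (level lo s x, decide ((x, true) ∈ s)) :: letters lo (toggle s (Sum.inr x)) w := rfl

@[simp] theorem letters_append :
    letters lo s (w ++ w') = letters lo s w ++ letters lo (run s w) w' := by
  induction w generalizing s with
  | nil => rfl
  | cons d w ih => rcases d with p | x <;> simp [ih]

theorem Vertical.letters_eq (h : Vertical w) : letters lo s w = [] := by
  induction w generalizing s with
  | nil => rfl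
  | cons d w ih =>
    obtain ⟨p, rfl⟩ := h d List.mem_cons_self
    exact ih fun e he => h e (List.mem_cons_of_mem _ he)

theorem vertical_of_letters_eq (h : letters lo s w = []) : Vertical w := by
  induction w generalizing s with
  | nil => exact vertical_nil
  | cons d w ih =>
    rcases d with p | x
    · intro e he
      rcases List.mem_cons.1 he with rfl | he
      · exact ⟨p, rfl⟩
      · exact ih h e he
    · simp at h

theorem exists_of_letters_cons {A : ℤ × Bool} {q : List (ℤ × Bool)} (h : letters lo s w = A :: q) :
    ∃ u x w₁, w = u ++ Sum.inr x :: w₁ ∧ Vertical u ∧ level lo (run s u) x = A.1 ∧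
      decide ((x, true) ∈ run s u) = A.2 ∧ letters lo (toggle (run s u) (Sum.inr x)) w₁ = q := by
  induction w generalizing s with
  | nil => simp at h
  | cons d w ih =>
    rcases d with p | x
    · obtain ⟨u, x, w₁, rfl, hu, h'⟩ := ih h
      refine ⟨Sum.inl p :: u, x, w₁, rfl, ?_, h'⟩
      intro e he
      rcases List.mem_cons.1 he with rfl | he
      · exact ⟨p, rfl⟩
      · exact hu e he
    · rw [letters_inr, List.cons.injEq] at h
      exact ⟨[], x, w, rfl, vertical_nil, congrArg Prod.fst h.1, congrArg Prod.snd h.1, h.2⟩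

theorem exists_of_letters_append {p q : List (ℤ × Bool)} (h : letters lo s w = p ++ q) :
    ∃ w₁ w₂, w = w₁ ++ w₂ ∧ letters lo s w₁ = p ∧ letters lo (run s w₁) w₂ = q := by
  induction p generalizing s w with
  | nil => exact ⟨[], w, rfl, rfl, h⟩
  | cons A p ih =>
    obtain ⟨u, x, w₁, rfl, hu, h1, h2, h3⟩ := exists_of_letters_cons h
    obtain ⟨w₂, w₃, rfl, h4, h5⟩ := ih h3
    refine ⟨u ++ Sum.inr x :: w₂, w₃, by simp, ?_, by simpa using h5⟩
    simp [hu.letters_eq, h1, h2, h4]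

theorem hopAt_of_valid (hs : InBox lo hi s) (hf : Fits lo hi (Sum.inr x))
    (hv : Valid s (Sum.inr x)) (h : decide ((x, true) ∈ s) = f) : HopAt lo hi f s x := by
  simp only [Valid, fst_inr, snd_inr] at hv
  refine ⟨hs, hf.1, hf.2, ?_, ?_⟩ <;> cases f <;> simp_all

theorem HopAt.decide_eq (h : HopAt lo hi f s x) : decide ((x, true) ∈ s) = f := by
  have h1 := h.mem
  have h2 := h.notMem
  cases f <;> simp_all

theorem HopAt.toggle_self (h : HopAt lo hi f s x) :
    HopAt lo hi (!f) (toggle s (Sum.inr x)) x := by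
  refine ⟨h.inBox.toggle h.fits, h.lo_le, h.le_hi, ?_, ?_⟩
  · rw [mem_toggle_of_mem (by cases f <;> simp [mem_sites])]; exact h.notMem
  · rw [mem_toggle_of_mem (by cases f <;> simp [mem_sites])]; simpa using h.mem

theorem HopAt.toggle_of_ne (h : HopAt lo hi f s x) (hne : y ≠ x) (hf : Fits lo hi (Sum.inr y)) :
    HopAt lo hi f (toggle s (Sum.inr y)) x := by
  have h1 : ∀ g : Bool, (x, g) ∉ sites (Sum.inr y) := by
    intro g; simp [mem_sites, hne.symm]
  refine ⟨h.inBox.toggle hf, h.lo_le, h.le_hi, ?_, ?_⟩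
  · rw [mem_toggle_of_notMem (h1 _)]; exact h.mem
  · rw [mem_toggle_of_notMem (h1 _)]; exact h.notMem

theorem cnt_toggle_inr_of_lt {a b : ℤ} (g : Bool) (h : ¬ (a ≤ x ∧ x < b)) :
    cnt (toggle s (Sum.inr x)) g a b = cnt s g a b := by
  refine cnt_congr fun y h1 h2 => mem_toggle_of_notMem fun hy => h ?_
  rcases mem_sites.1 hy with hy | hy <;> obtain rfl := congrArg Prod.fst hy <;> exact ⟨h1, h2⟩

/-- The level counts both floors together, so a rung cannot change it, and a rail changes it only if
it crosses the cut at `x`. -/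
theorem level_toggle {d : Edge} (hv : Valid s d) (hlo : lo ≤ d.fst.1)
    (hx : d.fst.1 < x ↔ d.snd.1 < x) : level lo (toggle s d) x = level lo s x := by
  have hle := fst_le_snd d
  rcases d with p | y
  · rw [level, level, cnt_toggle_of_mem_iff hv, cnt_toggle_of_mem_iff hv]
    all_goals
      simp only [fst_inl, snd_inl] at *
      exact and_congr Iff.rfl (by omega)
  · rcases lt_or_ge y x with h | h
    · simp only [fst_inr] at hlo
      rw [level, level, cnt_total hlo h, cnt_total hlo h, cnt_total hlo h s, cnt_total hlo h s,
        cnt_toggle_inr_of_lt _ (by omega), cnt_toggle_inr_of_lt _ (by omega),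
        cnt_toggle_inr_of_lt _ (by omega), cnt_toggle_inr_of_lt _ (by omega)]
      simp only [Valid, fst_inr, snd_inr] at hv
      by_cases h1 : (y, false) ∈ s
      · have h2 := hv.1 h1
        simp [mem_toggle, mem_sites, h1, h2]; ring
      · have h2 : (y, true) ∈ s := by tauto
        simp [mem_toggle, mem_sites, h1, h2]; ring
    · rw [level, level, cnt_toggle_inr_of_lt _ (by omega), cnt_toggle_inr_of_lt _ (by omega)]

theorem level_run (hw : Ok lo hi s w) : level lo (run s w) (hi + 1) = level lo s (hi + 1) := by
  induction w generalizing s with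
  | nil => rfl
  | cons d w ih =>
    have := fst_le_snd d
    have := hw.1.1.2
    rw [run_cons, ih hw.2, level_toggle hw.1.2 hw.1.1.1 (by omega)]

theorem Vertical.cnt_run (hu : Vertical w) (hw : Ok lo hi s w) (g : Bool) :
    cnt (run s w) g lo (hi + 1) = cnt s g lo (hi + 1) := by
  induction w generalizing s with
  | nil => rfl
  | cons d w ih =>
    have h1 := fst_le_snd d
    have h2 := hw.1.1.2
    have h3 := hw.1.1.1
    rw [run_cons, ih (fun e he => hu e (List.mem_cons_of_mem _ he)) hw.2,
      cnt_toggle_of_mem_iff hw.1.2]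
    obtain ⟨p, rfl⟩ := hu d List.mem_cons_self
    simp only [fst_inl, snd_inl] at *
    exact and_congr Iff.rfl (by omega)

theorem cnt_le_cnt_toggle_inr {a b : ℤ} (g : Bool) :
    cnt s g a b ≤ cnt (toggle s (Sum.inr x)) g a b + 1 := by
  refine le_trans (card_le_card (t := insert (x, g) _) ?_) (card_insert_le _ _)
  rintro ⟨y, f⟩ hp
  obtain ⟨h1, rfl, h2⟩ := mem_filter.1 hp
  by_cases h : y = x
  · subst h; simp
  · refine mem_insert_of_mem (mem_filter.2 ⟨?_, rfl, h2⟩)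
    rwa [mem_toggle_of_notMem]
    simp [mem_sites, h]

/-- Only rungs take particles from a floor, one each. This lets the room needed in the middle of a
word be measured at its start. -/
theorem cnt_le_cnt_run (hw : Ok lo hi s w) (g : Bool) :
    cnt s g lo (hi + 1) ≤ cnt (run s w) g lo (hi + 1) + (letters lo s w).length := by
  induction w generalizing s with
  | nil => simp
  | cons d w ih =>
    have := ih hw.2
    rcases d with p | x
    · have h : cnt (toggle s (Sum.inl p)) g lo (hi + 1) = cnt s g lo (hi + 1) :=
        Vertical.cnt_run (w := [Sum.inl p]) (fun d hd => ⟨p, by simpa using hd⟩) ⟨hw.1, trivial⟩ g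
      rw [h] at this
      exact this
    · have h := cnt_le_cnt_toggle_inr (s := s) (x := x) (a := lo) (b := hi + 1) g
      simp only [run_cons, letters_inr, List.length_cons] at this ⊢
      omega

theorem cnt_toggle_inr (hs : HopAt lo hi f s₁ x) (hs' : HopAt lo hi f s₂ y)
    (h : ∀ g, cnt s₁ g lo (hi + 1) = cnt s₂ g lo (hi + 1)) (g : Bool) :
    cnt (toggle s₁ (Sum.inr x)) g lo (hi + 1) = cnt (toggle s₂ (Sum.inr y)) g lo (hi + 1) := by
  have key : ∀ {s : Finset Site} {x : ℤ}, HopAt lo hi f s x →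
      cnt (toggle s (Sum.inr x)) g lo (hi + 1) + (if g = f then 1 else 0) =
        cnt s g lo (hi + 1) + (if g = f then 0 else 1) := by
    intro s x hs
    have hx := hs.le_hi
    rw [cnt_total hs.lo_le (by omega : x < hi + 1), cnt_total hs.lo_le (by omega : x < hi + 1) s,
      cnt_toggle_inr_of_lt _ (by omega), cnt_toggle_inr_of_lt _ (by omega)]
    have h1 := hs.mem
    have h2 := hs.notMem
    have h3 := hs.toggle_self.mem
    have h4 := hs.toggle_self.notMem
    rw [Bool.not_not] at h4
    rcases eq_or_eq_not f g with rfl | rfl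
    · simp [h1, h4]; omega
    · simp [h2, h3]; omega
  have h1 := key hs
  have h2 := key hs'
  have h3 := h g
  omega

/-- The equivalence solved for the first rung: a rung can be replaced by an equivalent one between
two rungless words. -/
theorem RungEq.exists_htpy (h : RungEq lo hi s₁ r₁ s₂ r₂) : ∃ α γ, Vertical α ∧ Vertical γ ∧
    run s₁ α = s₂ ∧ Htpy lo hi s₁ [Sum.inr r₁] (α ++ Sum.inr r₂ :: γ) := by
  obtain ⟨u, u', hu, hu', hok, hrun, hh⟩ := h
  refine ⟨u, u'.reverse, hu, hu'.reverse, hrun, ?_⟩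
  have hok' : Ok lo hi (toggle s₁ (Sum.inr r₁)) u' := hh.ok_right.2
  have h1 : Ok lo hi s₁ [Sum.inr r₁] := ⟨hh.ok_right.1, trivial⟩
  have h2 : Htpy lo hi s₁ [Sum.inr r₁] ([Sum.inr r₁] ++ (u' ++ u'.reverse)) := by
    simpa using Htpy.append_left h1 (htpy_nil_append_reverse hok')
  have h3 : Htpy lo hi s₁ (Sum.inr r₁ :: u' ++ u'.reverse) (u ++ [Sum.inr r₂] ++ u'.reverse) :=
    hh.symm.append_right (ok_reverse hok')
  simpa using h2.trans h3

/-- Two rungs at the same level, crossed in opposite directions, cancel. -/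
theorem exists_htpy_cancel {v : List Edge} (hs : InBox lo hi s) (hl : level lo s (hi + 1) = 0)
    (hv : Vertical v) (hok : Ok lo hi s (Sum.inr x :: (v ++ [Sum.inr y])))
    (hx : decide ((x, true) ∈ s) = f)
    (hy : decide ((y, true) ∈ run (toggle s (Sum.inr x)) v) = !f)
    (hxy : level lo s x = level lo (run (toggle s (Sum.inr x)) v) y) :
    ∃ α, Vertical α ∧ Htpy lo hi s (Sum.inr x :: (v ++ [Sum.inr y])) α := by
  obtain ⟨hok1, hok2⟩ := hok
  obtain ⟨hokv, hok3⟩ := ok_append.1 hok2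
  set s₃ := run (toggle s (Sum.inr x)) v with hs₃
  have h1 := hopAt_of_valid hs hok1.1 hok1.2 hx
  have h3 : HopAt lo hi (!f) s₃ y :=
    hopAt_of_valid ((hs.toggle hok1.1).run hokv) hok3.1.1 hok3.1.2 hy
  have h4 := h3.toggle_self
  rw [Bool.not_not] at h4
  have ht : ∀ g, cnt s g lo (hi + 1) = cnt (toggle s₃ (Sum.inr y)) g lo (hi + 1) := by
    intro g
    have := cnt_toggle_inr h1.toggle_self h3 (fun g => (hv.cnt_run hokv g).symm) g
    rwa [toggle_toggle] at this
  have hlev : level lo s x = level lo (toggle s₃ (Sum.inr y)) y := by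
    rw [level_toggle h3.valid h3.lo_le Iff.rfl, hxy]
  -- Transport the first rung to the second one, crossed backwards, as `α y γ`. Then `γ v` is a
  -- rungless loop and contracts, the two hops along `y` cancel, and `α` remains.
  obtain ⟨α, γ, hα, hγ, hrun, hh⟩ := (rungEq_of_level h1 h4 ht hl hlev).exists_htpy
  refine ⟨α, hα, ?_⟩
  have hokα := (ok_append.1 hh.ok_right).1
  have hokγ : Ok lo hi s₃ γ := by
    have := (ok_append.1 hh.ok_right).2.2
    rwa [hrun, toggle_toggle] at this
  have hrunγ : run s₃ γ = toggle s (Sum.inr x) := by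
    have := hh.run_eq
    simp only [run_append, run_cons, run_nil, hrun, toggle_toggle] at this
    exact this.symm
  have e1 : Htpy lo hi s (Sum.inr x :: (v ++ [Sum.inr y]))
      (α ++ Sum.inr y :: (γ ++ v ++ [Sum.inr y])) := by
    simpa using hh.append_right (u := v ++ [Sum.inr y]) hok2
  have e2 : Htpy lo hi s₃ (γ ++ v ++ [Sum.inr y]) ([] ++ [Sum.inr y]) := by
    refine Htpy.append_right (Vertical.htpy (hγ.append hv) vertical_nil ?_ trivial ?_) ?_
    · rw [ok_append, hrunγ]; exact ⟨hokγ, hokv⟩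
    · rw [run_append, hrunγ]; rfl
    · rw [run_append, hrunγ]; exact hok3
  have e3 : Htpy lo hi (run s α) (Sum.inr y :: (γ ++ v ++ [Sum.inr y])) [] := by
    rw [hrun]
    have := Htpy.cons h4.fits h4.valid (w := γ ++ v ++ [Sum.inr y]) (by rwa [toggle_toggle])
    exact this.trans (htpy_cancel this.ok_right)
  have e4 := e1.trans (Htpy.append_left hokα e3)
  rwa [List.append_nil] at e4

/-- A state in which particles can change floor at two given levels. -/
theorem exists_hopAt_pair (k₁ k₂ : ℤ) (f₁ f₂ : Bool) (c : Bool → ℕ)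
    (hc : (c false : ℤ) + c true = hi + 1 - lo) (hroom : ∀ g, |k₁| + |k₂| + 2 ≤ c g) :
    ∃ s r₁ r₂, r₁ ≠ r₂ ∧ HopAt lo hi f₁ s r₁ ∧ HopAt lo hi f₂ s r₂ ∧ level lo s r₁ = k₁ ∧
      level lo s r₂ = k₂ ∧ ∀ g, cnt s g lo (hi + 1) = c g := by
  -- The positive and negative parts of the prescribed levels.
  obtain ⟨u₁, v₁, hu₁, hv₁, hk₁, ha₁⟩ : ∃ u v : ℤ, 0 ≤ u ∧ 0 ≤ v ∧ k₁ = u - v ∧ |k₁| = u + v := by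
    rcases le_total 0 k₁ with h | h
    · exact ⟨k₁, 0, h, le_rfl, by simp, by simp [abs_of_nonneg h]⟩
    · exact ⟨0, -k₁, le_rfl, by omega, by simp, by simp [abs_of_nonpos h]⟩
  obtain ⟨u₂, v₂, hu₂, hv₂, hk₂, ha₂⟩ : ∃ u v : ℤ, 0 ≤ u ∧ 0 ≤ v ∧ k₂ = u - v ∧ |k₂| = u + v := by
    rcases le_total 0 k₂ with h | h
    · exact ⟨k₂, 0, h, le_rfl, by simp, by simp [abs_of_nonneg h]⟩
    · exact ⟨0, -k₂, le_rfl, by omega, by simp, by simp [abs_of_nonpos h]⟩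
  have hA := hroom false
  have hB := hroom true
  rw [ha₁, ha₂] at hA hB
  clear hroom
  -- Each rung gets a block: `u` full columns, `v` empty columns, the rung, `v` full columns, `u`
  -- empty columns. The level is `u - v` at the rung and zero again after the block, so the two
  -- blocks do not interfere.
  obtain ⟨r₁, hr₁⟩ : ∃ r, r = lo + u₁ + v₁ := ⟨_, rfl⟩
  obtain ⟨e₁, he₁⟩ : ∃ e, e = r₁ + 1 + u₁ + v₁ := ⟨_, rfl⟩
  obtain ⟨r₂, hr₂⟩ : ∃ r, r = e₁ + u₂ + v₂ := ⟨_, rfl⟩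
  obtain ⟨e₂, he₂⟩ : ∃ e, e = r₂ + 1 + u₂ + v₂ := ⟨_, rfl⟩
  -- After the blocks every column has one particle, on the floor `false` before `t` and on the
  -- floor `true` from `t` on. The value of `t` adjusts the totals of the floors to `c`.
  obtain ⟨t, ht⟩ : ∃ t : ℤ, t = e₂ + c false - u₁ - v₁ - u₂ - v₂ - (if false = f₁ then 1 else 0) -
    (if false = f₂ then 1 else 0) := ⟨_, rfl⟩
  have ht0 : e₂ ≤ t := by rw [ht]; split_ifs <;> omega
  have ht1 : t ≤ hi + 1 := by rw [ht]; split_ifs <;> omega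
  set s := ofPred lo hi fun x g => x < lo + u₁ ∨ (r₁ < x ∧ x < r₁ + 1 + v₁) ∨
    (e₁ ≤ x ∧ x < e₁ + u₂) ∨ (r₂ < x ∧ x < r₂ + 1 + v₂) ∨ (x = r₁ ∧ g = f₁) ∨ (x = r₂ ∧ g = f₂) ∨
    (e₂ ≤ x ∧ (x < t ↔ g = false)) with hs
  have m : ∀ x g, (x, g) ∈ s ↔ (lo ≤ x ∧ x ≤ hi) ∧ (x < lo + u₁ ∨ (r₁ < x ∧ x < r₁ + 1 + v₁) ∨
    (e₁ ≤ x ∧ x < e₁ + u₂) ∨ (r₂ < x ∧ x < r₂ + 1 + v₂) ∨ (x = r₁ ∧ g = f₁) ∨ (x = r₂ ∧ g = f₂) ∨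
    (e₂ ≤ x ∧ (x < t ↔ g = false))) := fun x g => by rw [hs, mem_ofPred]
  clear_value s
  have c1 : ∀ g, (cnt s g lo r₁ : ℤ) = lo + u₁ - lo := by
    intro g
    refine cnt_eq_of_forall le_rfl (by omega) (by omega) fun x h1 h2 => ?_
    rw [m]; omega
  have c2 : ∀ g, (cnt s g (r₁ + 1) e₁ : ℤ) = r₁ + 1 + v₁ - (r₁ + 1) := by
    intro g
    refine cnt_eq_of_forall le_rfl (by omega) (by omega) fun x h1 h2 => ?_
    rw [m]; omega
  have c3 : ∀ g, (cnt s g e₁ r₂ : ℤ) = e₁ + u₂ - e₁ := by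
    intro g
    refine cnt_eq_of_forall le_rfl (by omega) (by omega) fun x h1 h2 => ?_
    rw [m]; omega
  have c4 : ∀ g, (cnt s g (r₂ + 1) e₂ : ℤ) = r₂ + 1 + v₂ - (r₂ + 1) := by
    intro g
    refine cnt_eq_of_forall le_rfl (by omega) (by omega) fun x h1 h2 => ?_
    rw [m]; omega
  have c5 : (cnt s false e₂ (hi + 1) : ℤ) = t - e₂ := by
    refine cnt_eq_of_forall le_rfl ht0 ht1 fun x h1 h2 => ?_
    rw [m]
    simp only [iff_true]
    omega
  have c6 : (cnt s true e₂ (hi + 1) : ℤ) = hi + 1 - t := by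
    refine cnt_eq_of_forall ht0 ht1 le_rfl fun x h1 h2 => ?_
    rw [m]
    simp only [Bool.true_eq_false, iff_false]
    omega
  have n1 : ∀ g, (r₁, g) ∈ s ↔ g = f₁ := by
    intro g
    rw [m]
    constructor
    · rintro ⟨-, h | h | h | h | h | h | h⟩
      · omega
      · omega
      · omega
      · omega
      · exact h.2
      · omega
      · omega
    · intro h
      exact ⟨by omega, Or.inr (Or.inr (Or.inr (Or.inr (Or.inl ⟨rfl, h⟩))))⟩
  have n2 : ∀ g, (r₂, g) ∈ s ↔ g = f₂ := by
    intro g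
    rw [m]
    constructor
    · rintro ⟨-, h | h | h | h | h | h | h⟩
      · omega
      · omega
      · omega
      · omega
      · omega
      · exact h.2
      · omega
    · intro h
      exact ⟨by omega, Or.inr (Or.inr (Or.inr (Or.inr (Or.inr (Or.inl ⟨rfl, h⟩)))))⟩
  have hbox : InBox lo hi s := by
    rintro ⟨x, g⟩ h
    exact ((m x g).1 h).1
  have q1 : ∀ g, (cnt s g lo e₁ : ℤ) = u₁ + (if g = f₁ then 1 else 0) + v₁ := by
    intro g
    rw [cnt_total (by omega : lo ≤ r₁) (by omega : r₁ < e₁)]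
    push_cast
    simp only [n1, c1, c2]
    ring
  have q2 : ∀ g, (cnt s g lo r₂ : ℤ) = u₁ + (if g = f₁ then 1 else 0) + v₁ + u₂ := by
    intro g
    rw [← cnt_add (by omega : lo ≤ e₁) (by omega : e₁ ≤ r₂)]
    push_cast
    rw [q1, c3]
    ring
  have q3 : ∀ g, (cnt s g lo e₂ : ℤ) = u₁ + (if g = f₁ then 1 else 0) + v₁ + u₂ +
      (if g = f₂ then 1 else 0) + v₂ := by
    intro g
    rw [cnt_total (by omega : lo ≤ r₂) (by omega : r₂ < e₂)]
    push_cast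
    simp only [n2, q2, c4]
    ring
  refine ⟨s, r₁, r₂, by omega, ⟨hbox, by omega, by omega, (n1 _).2 rfl, by simp [n1]⟩,
    ⟨hbox, by omega, by omega, (n2 _).2 rfl, by simp [n2]⟩, ?_, ?_, ?_⟩
  · rw [level, c1, c1]; omega
  · rw [level, q2, q2]
    cases f₁ <;> simp <;> omega
  · intro g
    have i1 : (if true = f₁ then (1 : ℤ) else 0) + (if false = f₁ then 1 else 0) = 1 := by
      cases f₁ <;> simp
    have i2 : (if true = f₂ then (1 : ℤ) else 0) + (if false = f₂ then 1 else 0) = 1 := by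
      cases f₂ <;> simp
    have e := cnt_add (by omega : lo ≤ e₂) (by omega : e₂ ≤ hi + 1) s g
    have e' := q3 g
    zify at e ⊢
    cases g <;> linarith

end Edge

/-! ### Interchanging letters, and null-homotopic words -/

namespace Edge
variable {lo hi : ℤ} {s s' s₁ s₂ s₃ : Finset Site} {w w' : List Edge} {r r₁ r₂ x y : ℤ} {f g : Bool}

/-- Two rungs at different levels can be crossed in either order. -/
theorem exists_htpy_swap {v : List Edge} (hs : InBox lo hi s) (hl : level lo s (hi + 1) = 0)
    (hv : Vertical v) (hok : Ok lo hi s (Sum.inr x :: (v ++ [Sum.inr y])))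
    (hx : decide ((x, true) ∈ s) = f)
    (hy : decide ((y, true) ∈ run (toggle s (Sum.inr x)) v) = g)
    (hroom : ∀ b, |level lo s x| + |level lo (run (toggle s (Sum.inr x)) v) y| + 2 ≤
      cnt s b lo (hi + 1)) :
    ∃ w, Htpy lo hi s (Sum.inr x :: (v ++ [Sum.inr y])) w ∧
      letters lo s w = [(level lo (run (toggle s (Sum.inr x)) v) y, g), (level lo s x, f)] := by
  obtain ⟨hok1, hok2⟩ := hok
  obtain ⟨hokv, hok3⟩ := ok_append.1 hok2
  set s₃ := run (toggle s (Sum.inr x)) v with hs₃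
  have h1 := hopAt_of_valid hs hok1.1 hok1.2 hx
  have h3 : HopAt lo hi g s₃ y :=
    hopAt_of_valid ((hs.toggle hok1.1).run hokv) hok3.1.1 hok3.1.2 hy
  have hsum : (cnt s false lo (hi + 1) : ℤ) + cnt s true lo (hi + 1) = hi + 1 - lo := by
    rw [level] at hl; omega
  -- In the state `t` both rungs are available at once in different columns, where they commute. The
  -- first rung is transported to `r₁` in `t`, the second to `r₂` in the state after `r₁`; rung hops
  -- do not change levels.
  obtain ⟨t, r₁, r₂, hne, k1, k2, l1, l2, hct⟩ :=
    exists_hopAt_pair (level lo s x) (level lo s₃ y) f g (fun b => cnt s b lo (hi + 1)) hsum hroom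
  have k2' := k2.toggle_of_ne hne k1.fits
  have k1' := k1.toggle_of_ne hne.symm k2.fits
  obtain ⟨α, γ, hα, hγ, hrun, hh⟩ :=
    (rungEq_of_level h1 k1 (fun b => (hct b).symm) hl l1.symm).exists_htpy
  have ht : ∀ b, cnt s₃ b lo (hi + 1) = cnt (toggle t (Sum.inr r₁)) b lo (hi + 1) := by
    intro b
    rw [hv.cnt_run hokv]
    exact cnt_toggle_inr h1 k1 (fun b => (hct b).symm) b
  have hl3 : level lo s₃ (hi + 1) = 0 := by
    rw [hs₃, level_run hokv, level_toggle hok1.2 hok1.1.1 ?_, hl]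
    simp
  have hlev : level lo (toggle t (Sum.inr r₁)) r₂ = level lo t r₂ :=
    level_toggle k1.valid k1.lo_le (by simp)
  have hlev' : level lo (toggle t (Sum.inr r₂)) r₁ = level lo t r₁ :=
    level_toggle k2.valid k2.lo_le (by simp)
  obtain ⟨β, δ, hβ, hδ, hrun', hh'⟩ :=
    (rungEq_of_level h3 k2' ht hl3 (by rw [hlev, l2])).exists_htpy
  have hokα := (ok_append.1 hh.ok_right).1
  have hokβ := (ok_append.1 hh'.ok_right).1
  have hokγ : Ok lo hi (toggle t (Sum.inr r₁)) γ := by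
    have := (ok_append.1 hh.ok_right).2.2
    rwa [hrun] at this
  have hokδ : Ok lo hi (toggle (toggle t (Sum.inr r₁)) (Sum.inr r₂)) δ := by
    have := (ok_append.1 hh'.ok_right).2.2
    rwa [hrun'] at this
  have hrunγ : run (toggle t (Sum.inr r₁)) γ = toggle s (Sum.inr x) := by
    have := hh.run_eq
    simp only [run_append, run_cons, run_nil, hrun] at this
    exact this.symm
  have e1 : Htpy lo hi s (Sum.inr x :: (v ++ [Sum.inr y]))
      (α ++ Sum.inr r₁ :: (γ ++ v ++ [Sum.inr y])) := by
    simpa using hh.append_right (u := v ++ [Sum.inr y]) hok2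
  have e2 : Htpy lo hi (toggle t (Sum.inr r₁)) (γ ++ v ++ [Sum.inr y])
      (γ ++ v ++ (β ++ Sum.inr r₂ :: δ)) := by
    refine Htpy.append_left ?_ ?_
    · rw [ok_append, hrunγ]; exact ⟨hokγ, hokv⟩
    · rw [run_append, hrunγ]; exact hh'
  -- What lies between the two transported rungs is a rungless loop, hence contractible, so the
  -- rungs become consecutive.
  have e3 : Htpy lo hi (toggle t (Sum.inr r₁)) (γ ++ v ++ β ++ Sum.inr r₂ :: δ)
      ([] ++ Sum.inr r₂ :: δ) := by
    refine Htpy.append_right (Vertical.htpy ((hγ.append hv).append hβ) vertical_nil ?_ trivial ?_) ?_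
    · rw [ok_append, ok_append, run_append, hrunγ]; exact ⟨⟨hokγ, hokv⟩, hokβ⟩
    · rw [run_append, run_append, hrunγ]; exact hrun'
    · rw [run_append, run_append, hrunγ, ← hs₃, hrun']
      exact ⟨⟨k2'.fits, k2'.valid⟩, hokδ⟩
  have e4 : Htpy lo hi t (Sum.inr r₁ :: (γ ++ v ++ [Sum.inr y]))
      (Sum.inr r₂ :: Sum.inr r₁ :: δ) := by
    have h5 := Htpy.cons k1.fits k1.valid (e2.trans (by simpa using e3))
    exact h5.trans (htpy_comm h5.ok_right (disjoint_inr hne))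
  have e5 := e1.trans (Htpy.append_left hokα (by rwa [hrun]))
  refine ⟨_, e5, ?_⟩
  rw [letters_append, hα.letters_eq, hrun, letters_inr, letters_inr, hδ.letters_eq, k2.decide_eq,
    k1'.decide_eq, l2, hlev', l1]
  rfl

/-- The letter of the reversed rung. -/
def invLetter (A : ℤ × Bool) : ℤ × Bool := (A.1, !A.2)

/-- The summand `p.length` pays for the particles that the rungs before the pair may have taken from
a floor. -/
theorem exists_letters_swap {A B : ℤ × Bool} {p q : List (ℤ × Bool)} (hs : InBox lo hi s)
    (hl : level lo s (hi + 1) = 0) (hok : Ok lo hi s w) (hw : letters lo s w = p ++ A :: B :: q)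
    (hne : B ≠ invLetter A) (hroom : ∀ b, |A.1| + |B.1| + 2 + p.length ≤ cnt s b lo (hi + 1)) :
    ∃ w', Htpy lo hi s w w' ∧ letters lo s w' = p ++ B :: A :: q := by
  by_cases hAB : A = B
  · subst hAB
    exact ⟨w, Htpy.refl hok, hw⟩
  obtain ⟨w₁, w₂, rfl, hw1, hw2⟩ := exists_of_letters_append hw
  obtain ⟨u, x, w₃, rfl, hu, h1, h2, h3⟩ := exists_of_letters_cons hw2
  obtain ⟨v, y, w₄, rfl, hv, h4, h5, h6⟩ := exists_of_letters_cons h3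
  obtain ⟨ok1, ok2⟩ := ok_append.1 hok
  obtain ⟨oku, ok3⟩ := ok_append.1 ok2
  have ok4 : Ok lo hi (run (run s w₁) u) (Sum.inr x :: (v ++ [Sum.inr y]) ++ w₄) := by
    simpa using ok3
  obtain ⟨ok5, ok6⟩ := ok_append.1 ok4
  obtain ⟨w', hw', hlet⟩ := exists_htpy_swap (s := run (run s w₁) u)
    ((hs.run ok1).run oku) (by rw [level_run oku, level_run ok1, hl]) hv ok5 h2 h5 (by
      intro b
      rw [h1, h4, hu.cnt_run oku]
      have := cnt_le_cnt_run ok1 b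
      have := hroom b
      rw [hw1] at *
      omega)
  have e := Htpy.append_left ok1 (Htpy.append_left oku (hw'.append_right ok6))
  refine ⟨w₁ ++ (u ++ (w' ++ w₄)), by simpa using e, ?_⟩
  simp only [letters_append, hw1, hu.letters_eq, hlet, ← hw'.run_eq, h1, h4]
  simp only [run_cons, run_append, run_nil, h6]
  simp

theorem exists_letters_cancel {A : ℤ × Bool} {p q : List (ℤ × Bool)} (hs : InBox lo hi s)
    (hl : level lo s (hi + 1) = 0) (hok : Ok lo hi s w)
    (hw : letters lo s w = p ++ A :: invLetter A :: q) :
    ∃ w', Htpy lo hi s w w' ∧ letters lo s w' = p ++ q := by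
  obtain ⟨w₁, w₂, rfl, hw1, hw2⟩ := exists_of_letters_append hw
  obtain ⟨u, x, w₃, rfl, hu, h1, h2, h3⟩ := exists_of_letters_cons hw2
  obtain ⟨v, y, w₄, rfl, hv, h4, h5, h6⟩ := exists_of_letters_cons h3
  obtain ⟨ok1, ok2⟩ := ok_append.1 hok
  obtain ⟨oku, ok3⟩ := ok_append.1 ok2
  have ok4 : Ok lo hi (run (run s w₁) u) (Sum.inr x :: (v ++ [Sum.inr y]) ++ w₄) := by
    simpa using ok3
  obtain ⟨ok5, ok6⟩ := ok_append.1 ok4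
  obtain ⟨w', hvert, hw'⟩ := exists_htpy_cancel (s := run (run s w₁) u)
    ((hs.run ok1).run oku) (by rw [level_run oku, level_run ok1, hl]) hv ok5 h2 h5
    (by rw [h1, h4]; rfl)
  have e := Htpy.append_left ok1 (Htpy.append_left oku (hw'.append_right ok6))
  refine ⟨w₁ ++ (u ++ (w' ++ w₄)), by simpa using e, ?_⟩
  simp only [letters_append, hw1, hu.letters_eq, hvert.letters_eq, ← hw'.run_eq]
  simp only [run_cons, run_append, run_nil, h6]
  simp

/-- The letter `A` is moved to the right through `m`, one interchange at a time, until it meets its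
inverse. Interchanges keep the multiset of letters, so the bounds on levels and room persist. -/
theorem exists_letters_cancel_append {A : ℤ × Bool} {p m q : List (ℤ × Bool)} {K : ℤ}
    (hs : InBox lo hi s) (hl : level lo s (hi + 1) = 0) (hok : Ok lo hi s w)
    (hw : letters lo s w = p ++ A :: (m ++ invLetter A :: q)) (hm : invLetter A ∉ m)
    (hK : ∀ B ∈ letters lo s w, |B.1| ≤ K)
    (hroom : ∀ b, 2 * K + 2 + (letters lo s w).length ≤ cnt s b lo (hi + 1)) :
    ∃ w', Htpy lo hi s w w' ∧ letters lo s w' = p ++ m ++ q := by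
  induction m generalizing p w with
  | nil =>
    obtain ⟨w', h1, h2⟩ := exists_letters_cancel hs hl hok hw
    exact ⟨w', h1, by simpa using h2⟩
  | cons B m ih =>
    have hA := hK A (by rw [hw]; simp)
    have hB := hK B (by rw [hw]; simp)
    obtain ⟨w', h1, h2⟩ := exists_letters_swap hs hl hok (by simpa using hw)
      (fun h => hm (by rw [h]; simp)) (by
        intro b
        have := hroom b
        rw [hw] at this
        simp only [List.length_append, List.length_cons] at this
        omega)
    have hperm : ∀ C, C ∈ letters lo s w' ↔ C ∈ letters lo s w := by
      intro C
      rw [h2, hw]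
      simp only [List.mem_append, List.mem_cons]
      tauto
    have hlen : (letters lo s w').length = (letters lo s w).length := by
      rw [h2, hw]; simp
    obtain ⟨w'', h3, h4⟩ := ih (p := p ++ [B]) h1.ok_right (by rw [h2]; simp)
      (fun h => hm (List.mem_cons_of_mem _ h)) (fun C hC => hK C ((hperm C).1 hC))
      (by rw [hlen]; exact hroom)
    exact ⟨w'', h1.trans h3, by rw [h4]; simp⟩

/-- By equality of counts the first letter has an inverse later in the word. Cancelling the pair
removes two letters and preserves the equality. -/
theorem exists_vertical (n : ℕ) {K : ℤ} (hs : InBox lo hi s) (hl : level lo s (hi + 1) = 0)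
    (hok : Ok lo hi s w) (hn : (letters lo s w).length = n)
    (hcount : ∀ k, (letters lo s w).count (k, false) = (letters lo s w).count (k, true))
    (hK : ∀ B ∈ letters lo s w, |B.1| ≤ K)
    (hroom : ∀ b, 2 * K + 2 + n ≤ cnt s b lo (hi + 1)) :
    ∃ w', Vertical w' ∧ Htpy lo hi s w w' := by
  induction n using Nat.strong_induction_on generalizing w with
  | _ n ih =>
    rcases hw : letters lo s w with - | ⟨A, q⟩
    · exact ⟨w, vertical_of_letters_eq hw, Htpy.refl hok⟩
    have hmem : invLetter A ∈ q := by
      have h1 := hcount A.1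
      rw [hw] at h1
      have h2 : 0 < q.count (invLetter A) := by
        obtain ⟨k, f⟩ := A
        simp only [List.count_cons, invLetter] at h1 ⊢
        cases f <;> simp at h1 ⊢ <;> apply List.count_pos_iff.1 <;> omega
      exact List.count_pos_iff.1 h2
    obtain ⟨m, q', rfl, hm⟩ := List.eq_append_cons_of_mem hmem
    obtain ⟨w', h1, h2⟩ := exists_letters_cancel_append (p := []) hs hl hok hw hm hK
      (by rw [hn]; exact hroom)
    have hlen : (letters lo s w').length + 2 = n := by
      rw [← hn, hw, h2]; simp; omega
    obtain ⟨w'', h3, h4⟩ := ih (letters lo s w').length (by omega) h1.ok_right rfl (by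
        intro k
        have := hcount k
        rw [hw] at this
        rw [h2]
        obtain ⟨k', f⟩ := A
        simp only [List.count_cons, List.count_append, invLetter, List.nil_append] at this ⊢
        by_cases hk : k' = k
        · subst hk
          cases f <;> simp at this <;> omega
        · simp [hk] at this; omega)
      (fun B hB => hK B (by
        rw [h2] at hB
        rw [hw]
        simp only [List.nil_append, List.mem_append, List.mem_cons] at hB ⊢
        tauto))
      (fun b => by have := hroom b; omega)
    exact ⟨w'', h3, h1.trans h4⟩

/-- A closed word whose letters cancel is null-homotopic if there is room enough. -/
theorem htpy_nil_of_count {K : ℤ} (hs : InBox lo hi s) (hl : level lo s (hi + 1) = 0)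
    (hok : Ok lo hi s w) (hrun : run s w = s)
    (hcount : ∀ k, (letters lo s w).count (k, false) = (letters lo s w).count (k, true))
    (hK : ∀ B ∈ letters lo s w, |B.1| ≤ K)
    (hroom : ∀ b, 2 * K + 2 + (letters lo s w).length ≤ cnt s b lo (hi + 1)) :
    Htpy lo hi s w [] := by
  obtain ⟨w', h1, h2⟩ := exists_vertical _ hs hl hok rfl hcount hK hroom
  exact h2.trans (h1.htpy vertical_nil h2.ok_right trivial (by rw [← h2.run_eq, hrun]; rfl))

end Edge

/-! ### Flips, embeddings and stable connection -/

theorem unitVec_injective : Function.Injective unitVec := by decide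

theorem unitVec_ne_zero (i : Fin 3) : unitVec i ≠ 0 := by revert i; decide

theorem unitVec_add_ne_zero (i k : Fin 3) : unitVec i + unitVec k ≠ 0 := by
  revert i k; decide

namespace Tiling

theorem ext_dimers {R : Finset Cube} {t t' : Tiling R} (h : t.dimers = t'.dimers) : t = t' := by
  cases t; cases t'; cases h; rfl

theorem pair_ne_pair (c : Cube) {i k : Fin 3} (hik : i ≠ k) :
    ({c, c + unitVec i} : Finset Cube) ≠ {c, c + unitVec k} := by
  intro h
  have h1 : c + unitVec i ∈ ({c, c + unitVec k} : Finset Cube) := by rw [← h]; simp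
  simp only [mem_insert, add_eq_left, unitVec_ne_zero, mem_singleton, add_right_inj, false_or] at h1
  exact hik (unitVec_injective h1)

/-- Two parallel dimers of a slab can be flipped. -/
theorem exists_flip {R : Finset Cube} (t : Tiling R) {c : Cube} {i k : Fin 3} (hik : i ≠ k)
    (h1 : {c, c + unitVec i} ∈ t.dimers)
    (h2 : {c + unitVec k, c + unitVec k + unitVec i} ∈ t.dimers) :
    ∃ t' : Tiling R, IsFlip t t' ∧ ∀ e, e ∈ t'.dimers ↔
      (e ∈ t.dimers ∧ e ≠ {c, c + unitVec i} ∧ e ≠ {c + unitVec k, c + unitVec k + unitVec i}) ∨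
      e = {c, c + unitVec k} ∨ e = {c + unitVec i, c + unitVec i + unitVec k} := by
  have uniq : ∀ {d e : Finset Cube} {x : Cube}, d ∈ t.dimers → e ∈ t.dimers → x ∈ d → x ∈ e →
      d = e := by
    intro d e x hd he h1 h2
    by_contra hne
    exact Finset.disjoint_left.1 (t.disjoint d hd e he hne) h1 h2
  have hA := t.subset _ h1
  have hB := t.subset _ h2
  have hcd : Disjoint ({c, c + unitVec k} : Finset Cube)
      {c + unitVec i, c + unitVec i + unitVec k} := by
    simp only [disjoint_insert_left, mem_insert, mem_singleton, disjoint_singleton_left]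
    have e1 : unitVec i + unitVec k ≠ 0 := unitVec_add_ne_zero i k
    have e2 : unitVec i ≠ unitVec k := fun h => hik (unitVec_injective h)
    have := unitVec_ne_zero i
    have := unitVec_ne_zero k
    rw [add_assoc]
    simp [*, e2.symm]
  set A : Finset Cube := {c, c + unitVec i} with hAdef
  set B : Finset Cube := {c + unitVec k, c + unitVec k + unitVec i} with hBdef
  set C : Finset Cube := {c, c + unitVec k} with hCdef
  set D : Finset Cube := {c + unitVec i, c + unitVec i + unitVec k} with hDdef
  -- The old and the new pair of dimers cover the same four cubes, so the rest of the tiling is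
  -- unaffected.
  have hcover : ∀ x, (x ∈ A ∨ x ∈ B) ↔ (x ∈ C ∨ x ∈ D) := by
    intro x
    simp only [hAdef, hBdef, hCdef, hDdef, mem_insert, mem_singleton,
      add_right_comm c (unitVec k) (unitVec i)]
    tauto
  have hCt : C ∉ t.dimers := fun h => pair_ne_pair c hik (uniq h1 h
    (mem_insert_self _ _) (mem_insert_self _ _))
  have hDt : D ∉ t.dimers := by
    intro h
    have e1 := uniq h1 h (x := c + unitVec i) (by simp [hAdef]) (by simp [hDdef])
    have e2 : c ∈ D := by rw [← e1]; simp [hAdef]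
    exact Finset.disjoint_left.1 hcd (by simp [hCdef]) e2
  have hmem : ∀ e, e ∈ t.dimers \ {A, B} ∪ {C, D} ↔
      (e ∈ t.dimers ∧ e ≠ A ∧ e ≠ B) ∨ e = C ∨ e = D := by
    intro e
    simp only [mem_union, mem_sdiff, mem_insert, mem_singleton, not_or]
  have key : ∀ e, e ∈ t.dimers → e ≠ A → e ≠ B → Disjoint e C ∧ Disjoint e D := by
    intro e he hea heb
    have h3 : ∀ x ∈ e, ¬ (x ∈ A ∨ x ∈ B) := by
      rintro x hx (h | h)
      · exact hea (uniq he h1 hx h)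
      · exact heb (uniq he h2 hx h)
    refine ⟨Finset.disjoint_left.2 fun x hx h => h3 x hx ((hcover x).2 (Or.inl h)),
      Finset.disjoint_left.2 fun x hx h => h3 x hx ((hcover x).2 (Or.inr h))⟩
  refine ⟨⟨t.dimers \ {A, B} ∪ {C, D}, ?_, ?_, ?_, ?_⟩, ?_, hmem⟩
  · intro d hd
    rcases (hmem d).1 hd with h | rfl | rfl
    · exact t.isDimer d h.1
    · exact ⟨c, k, rfl⟩
    · exact ⟨c + unitVec i, k, rfl⟩
  · intro d hd x hx
    have : (x ∈ C ∨ x ∈ D) → x ∈ R := fun h => ((hcover x).2 h).elim (fun h => hA h) fun h => hB h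
    rcases (hmem d).1 hd with h | rfl | rfl
    · exact t.subset d h.1 hx
    · exact this (Or.inl hx)
    · exact this (Or.inr hx)
  · intro x hx
    obtain ⟨d, hd, hxd⟩ := t.covers x hx
    by_cases h : x ∈ C ∨ x ∈ D
    · rcases h with h | h
      · exact ⟨C, (hmem C).2 (Or.inr (Or.inl rfl)), h⟩
      · exact ⟨D, (hmem D).2 (Or.inr (Or.inr rfl)), h⟩
    · rw [← hcover] at h
      refine ⟨d, (hmem d).2 (Or.inl ⟨hd, ?_, ?_⟩), hxd⟩
      · rintro rfl; exact h (Or.inl hxd)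
      · rintro rfl; exact h (Or.inr hxd)
  · intro d hd e he hne
    rcases (hmem d).1 hd with h | rfl | rfl <;> rcases (hmem e).1 he with h' | rfl | rfl
    · exact t.disjoint d h.1 e h'.1 hne
    · exact (key d h.1 h.2.1 h.2.2).1
    · exact (key d h.1 h.2.1 h.2.2).2
    · exact (key e h'.1 h'.2.1 h'.2.2).1.symm
    · exact absurd rfl hne
    · exact hcd
    · exact (key e h'.1 h'.2.1 h'.2.2).2.symm
    · exact hcd.symm
    · exact absurd rfl hne
  · refine ⟨c, i, k, hik, h1, h2, (hmem C).2 (Or.inr (Or.inl rfl)),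
      (hmem D).2 (Or.inr (Or.inr rfl)), ?_⟩
    ext e
    simp only [mem_sdiff, mem_union, mem_insert, mem_singleton, not_or]
    constructor
    · rintro ⟨h3, h4⟩
      refine ⟨Or.inl ⟨h3, h4⟩, ?_, ?_⟩
      · rintro rfl; exact hCt h3
      · rintro rfl; exact hDt h3
    · rintro ⟨h3 | h3, h4⟩
      · exact h3
      · tauto

end Tiling

theorem IsFlip.symm {R : Finset Cube} {t t' : Tiling R} (h : IsFlip t t') : IsFlip t' t := by
  obtain ⟨c, i, k, hik, h1, h2, h3, h4, h5⟩ := h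
  exact ⟨c, k, i, hik.symm, h3, h4, h1, h2, h5.symm⟩

theorem FlipConnected.symm {R : Finset Cube} {t t' : Tiling R} (h : FlipConnected t t') :
    FlipConnected t' t := by
  induction h with
  | refl => exact .refl
  | tail _ h ih => exact .head h.symm ih

theorem IsFlip.connected {R : Finset Cube} {t t' : Tiling R} (h : IsFlip t t') :
    FlipConnected t t' := Relation.ReflTransGen.single h

namespace Tiling

variable {D E F : Finset Square}

theorem mem_embed {t : Tiling (duplex D)} {h : D ⊆ E} {d : Finset Cube} :
    d ∈ (t.embed h).dimers ↔ d ∈ t.dimers ∨ ∃ s ∈ E \ D, zDimer s = d := by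
  simp [embed, mem_union, mem_image]

theorem zDimer_injective : Function.Injective zDimer := by
  intro s s' h
  have : ((s, 0) : Cube) ∈ zDimer s' := by rw [← h]; exact mem_zDimer.2 ⟨rfl, Or.inl rfl⟩
  exact (mem_zDimer.1 this).1

theorem fst_mem_of_mem (t : Tiling (duplex D)) {d : Finset Cube} (hd : d ∈ t.dimers) {c : Cube}
    (hc : c ∈ d) : c.1 ∈ D ∧ (c.2 = 0 ∨ c.2 = 1) := mem_duplex.1 (t.subset d hd hc)

theorem mem_of_zDimer_mem (t : Tiling (duplex D)) {s : Square} (h : zDimer s ∈ t.dimers) : s ∈ D :=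
  (t.fst_mem_of_mem h (mem_zDimer.2 ⟨rfl, Or.inl rfl⟩ : (s, 0) ∈ zDimer s)).1

theorem embed_embed (t : Tiling (duplex D)) (h : D ⊆ E) (h' : E ⊆ F) :
    (t.embed h).embed h' = t.embed (h.trans h') := by
  apply ext_dimers
  ext d
  simp only [mem_embed, mem_sdiff]
  constructor
  · rintro ((h1 | ⟨s, hs, rfl⟩) | ⟨s, hs, rfl⟩)
    · exact Or.inl h1
    · exact Or.inr ⟨s, ⟨h' hs.1, hs.2⟩, rfl⟩
    · exact Or.inr ⟨s, ⟨hs.1, fun h3 => hs.2 (h h3)⟩, rfl⟩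
  · rintro (h1 | ⟨s, hs, rfl⟩)
    · exact Or.inl (Or.inl h1)
    · by_cases hE : s ∈ E
      · exact Or.inl (Or.inr ⟨s, ⟨hE, hs.2⟩, rfl⟩)
      · exact Or.inr ⟨s, ⟨hs.1, hE⟩, rfl⟩

theorem embed_refl (t : Tiling (duplex D)) (h : D ⊆ D) : t.embed h = t := by
  apply ext_dimers
  ext d
  simp [mem_embed]

end Tiling

variable {D E F : Finset Square}

theorem IsFlip.embed {t t' : Tiling (duplex D)} (h : IsFlip t t') (hDE : D ⊆ E) :
    IsFlip (t.embed hDE) (t'.embed hDE) := by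
  obtain ⟨c, i, k, hik, h1, h2, h3, h4, h5⟩ := h
  have notin : ∀ {t : Tiling (duplex D)} {d : Finset Cube}, d ∈ t.dimers →
      ¬ ∃ s, (s ∈ E ∧ s ∉ D) ∧ zDimer s = d := by
    rintro t d hd ⟨s, hs, rfl⟩
    exact hs.2 (t.mem_of_zDimer_mem hd)
  refine ⟨c, i, k, hik, Tiling.mem_embed.2 (Or.inl h1), Tiling.mem_embed.2 (Or.inl h2),
    Tiling.mem_embed.2 (Or.inl h3), Tiling.mem_embed.2 (Or.inl h4), ?_⟩
  have h1' := notin h1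
  have h2' := notin h2
  have h3' := notin h3
  have h4' := notin h4
  ext d
  have h5' := Finset.ext_iff.1 h5 d
  simp only [mem_sdiff, mem_insert, mem_singleton, not_or, Tiling.mem_embed (t := t),
    Tiling.mem_embed (t := t')] at h5' ⊢
  constructor
  · rintro ⟨h6 | h6, h7⟩
    · have := h5'.1 ⟨h6, h7⟩
      exact ⟨Or.inl this.1, this.2⟩
    · exact ⟨Or.inr h6, fun h => h3' (h ▸ h6), fun h => h4' (h ▸ h6)⟩
  · rintro ⟨h6 | h6, h7⟩
    · have := h5'.2 ⟨h6, h7⟩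
      exact ⟨Or.inl this.1, this.2⟩
    · exact ⟨Or.inr h6, fun h => h1' (h ▸ h6), fun h => h2' (h ▸ h6)⟩

theorem FlipConnected.embed {t t' : Tiling (duplex D)} (h : FlipConnected t t') (hDE : D ⊆ E) :
    FlipConnected (t.embed hDE) (t'.embed hDE) := by
  induction h with
  | refl => exact .refl
  | tail _ h ih => exact ih.tail (h.embed hDE)

/-- Two tilings are stably connected if they become flip connected when more space is added. -/
def StablyConnected (t : Tiling (duplex D)) (t' : Tiling (duplex E)) : Prop :=
  ∃ (F : Finset Square) (h : D ⊆ F) (h' : E ⊆ F), FlipConnected (t.embed h) (t'.embed h')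

theorem FlipConnected.stably {t t' : Tiling (duplex D)} (h : FlipConnected t t') :
    StablyConnected t t' := ⟨D, Subset.rfl, Subset.rfl, h.embed Subset.rfl⟩

theorem stablyConnected_embed (t : Tiling (duplex D)) (h : D ⊆ E) :
    StablyConnected t (t.embed h) :=
  ⟨E, h, Subset.rfl, by rw [Tiling.embed_refl]; exact .refl⟩

theorem StablyConnected.symm {t : Tiling (duplex D)} {t' : Tiling (duplex E)}
    (h : StablyConnected t t') : StablyConnected t' t := by
  obtain ⟨F, h1, h2, h3⟩ := h
  exact ⟨F, h2, h1, h3.symm⟩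

theorem StablyConnected.trans {t : Tiling (duplex D)} {t' : Tiling (duplex E)}
    {t'' : Tiling (duplex F)} (h : StablyConnected t t') (h' : StablyConnected t' t'') :
    StablyConnected t t'' := by
  obtain ⟨G, h1, h2, h3⟩ := h
  obtain ⟨H, h1', h2', h3'⟩ := h'
  refine ⟨G ∪ H, h1.trans subset_union_left, h2'.trans subset_union_right, ?_⟩
  have a := h3.embed (E := G ∪ H) subset_union_left
  have b := h3'.embed (E := G ∪ H) subset_union_right
  rw [Tiling.embed_embed, Tiling.embed_embed] at a b
  exact Relation.ReflTransGen.trans a b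

/-! ### Tilings as bricks and posts over the ladder -/

open Edge

/-- The height of a floor. -/
def floorHeight (f : Bool) : ℤ := if f then 1 else 0

@[simp] theorem floorHeight_false : floorHeight false = 0 := rfl
@[simp] theorem floorHeight_true : floorHeight true = 1 := rfl

theorem floorHeight_injective : Function.Injective floorHeight := by
  intro a b; cases a <;> cases b <;> simp

theorem floorHeight_eq (f : Bool) : floorHeight f = 0 ∨ floorHeight f = 1 := by
  cases f <;> simp

/-- The cube over the site `p` in row `y`. -/
def siteCube (p : Site) (y : ℤ) : Cube := ((p.1, y), floorHeight p.2)

theorem siteCube_inj {p q : Site} {y z : ℤ} : siteCube p y = siteCube q z ↔ p = q ∧ y = z := by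
  obtain ⟨x, f⟩ := p
  obtain ⟨x', f'⟩ := q
  simp only [siteCube, Prod.mk.injEq, floorHeight_injective.eq_iff]
  tauto

/-- The dimer over an edge of the ladder in row `y`. -/
def brick (d : Edge) (y : ℤ) : Finset Cube := {siteCube d.fst y, siteCube d.snd y}

/-- The dimer over the site `p` in the rows `y` and `y + 1`. -/
def post (p : Site) (y : ℤ) : Finset Cube := {siteCube p y, siteCube p (y + 1)}

theorem siteCube_mem_brick {p : Site} {d : Edge} {y z : ℤ} :
    siteCube p z ∈ brick d y ↔ p ∈ d.sites ∧ z = y := by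
  simp only [brick, mem_insert, mem_singleton, siteCube_inj, mem_sites]
  tauto

theorem siteCube_mem_post {p q : Site} {y z : ℤ} :
    siteCube p z ∈ post q y ↔ p = q ∧ (z = y ∨ z = y + 1) := by
  simp only [post, mem_insert, mem_singleton, siteCube_inj]
  tauto

theorem sites_injective : Function.Injective Edge.sites := by
  intro d e h
  have h1 : d.fst ∈ e.sites := h ▸ d.fst_mem_sites
  have h2 : d.snd ∈ e.sites := h ▸ d.snd_mem_sites
  have h3 : e.fst ∈ d.sites := h ▸ e.fst_mem_sites
  have h4 : e.snd ∈ d.sites := h ▸ e.snd_mem_sites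
  rcases d with ⟨x, f⟩ | x <;> rcases e with ⟨x', f'⟩ | x' <;>
    simp only [mem_sites, fst_inl, snd_inl, fst_inr, snd_inr, Prod.mk.injEq] at h1 h2 h3 h4
  · have : x = x' := by omega
    subst this
    simp at h1
    rw [h1]
  · omega
  · omega
  · simp at h1
    rw [h1]

theorem brick_inj {d e : Edge} {y z : ℤ} : brick d y = brick e z ↔ d = e ∧ y = z := by
  refine ⟨fun h => ?_, fun h => by rw [h.1, h.2]⟩
  have h1 : ∀ p, p ∈ d.sites → p ∈ e.sites ∧ y = z := fun p hp =>
    siteCube_mem_brick.1 (h ▸ siteCube_mem_brick.2 ⟨hp, rfl⟩)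
  have h2 : ∀ p, p ∈ e.sites → p ∈ d.sites ∧ z = y := fun p hp =>
    siteCube_mem_brick.1 (h ▸ siteCube_mem_brick.2 ⟨hp, rfl⟩)
  refine ⟨sites_injective (Finset.ext fun p => ⟨fun hp => (h1 p hp).1, fun hp => (h2 p hp).1⟩), ?_⟩
  exact (h1 _ d.fst_mem_sites).2

theorem brick_ne_post (d : Edge) (p : Site) (y z : ℤ) : brick d y ≠ post p z := by
  intro h
  have h1 := (siteCube_mem_brick.1 (h ▸ siteCube_mem_post.2 ⟨rfl, Or.inl rfl⟩ :
    siteCube p z ∈ brick d y)).2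
  have h2 := (siteCube_mem_brick.1 (h ▸ siteCube_mem_post.2 ⟨rfl, Or.inr rfl⟩ :
    siteCube p (z + 1) ∈ brick d y)).2
  omega

theorem brick_inr (x y : ℤ) : brick (Sum.inr x) y = zDimer (x, y) := rfl

/-- The direction of an edge. -/
def Edge.dir : Edge → Fin 3
  | Sum.inl _ => 0
  | Sum.inr _ => 2

theorem siteCube_snd (d : Edge) (y : ℤ) :
    siteCube d.snd y = siteCube d.fst y + unitVec d.dir := by
  rcases d with ⟨x, f⟩ | x <;> simp [siteCube, Edge.dir, unitVec]

theorem siteCube_succ (p : Site) (y : ℤ) : siteCube p (y + 1) = siteCube p y + unitVec 1 := by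
  simp [siteCube, unitVec]

theorem Edge.dir_ne_one (d : Edge) : d.dir ≠ 1 := by
  rcases d with p | x <;> simp [Edge.dir]

theorem brick_eq (d : Edge) (y : ℤ) :
    brick d y = {siteCube d.fst y, siteCube d.fst y + unitVec d.dir} := by
  rw [brick, siteCube_snd]

theorem brick_succ_eq (d : Edge) (y : ℤ) : brick d (y + 1) =
    {siteCube d.fst y + unitVec 1, siteCube d.fst y + unitVec 1 + unitVec d.dir} := by
  rw [brick, siteCube_snd, siteCube_succ]

theorem post_fst_eq (d : Edge) (y : ℤ) :
    post d.fst y = {siteCube d.fst y, siteCube d.fst y + unitVec 1} := by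
  rw [post, siteCube_succ]

theorem post_snd_eq (d : Edge) (y : ℤ) : post d.snd y =
    {siteCube d.fst y + unitVec d.dir, siteCube d.fst y + unitVec d.dir + unitVec 1} := by
  rw [post, siteCube_succ, siteCube_snd]

namespace Tiling

variable {D : Finset Square} {t t' : Tiling (duplex D)} {d e : Edge} {p q : Site} {x y z : ℤ}

theorem eq_of_brick_mem (h : brick d y ∈ t.dimers) (h' : brick e y ∈ t.dimers) (hp : p ∈ d.sites)
    (hp' : p ∈ e.sites) : d = e :=
  (brick_inj.1 (t.eq_of_mem h h' (siteCube_mem_brick.2 ⟨hp, rfl⟩)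
    (siteCube_mem_brick.2 ⟨hp', rfl⟩))).1

theorem not_post_of_brick (h : brick d y ∈ t.dimers) (hp : p ∈ d.sites) : post p y ∉ t.dimers :=
  fun h' => brick_ne_post d p y y (t.eq_of_mem h h' (siteCube_mem_brick.2 ⟨hp, rfl⟩)
    (siteCube_mem_post.2 ⟨rfl, Or.inl rfl⟩))

theorem not_post_pred_of_brick (h : brick d y ∈ t.dimers) (hp : p ∈ d.sites) :
    post p (y - 1) ∉ t.dimers :=
  fun h' => brick_ne_post d p y (y - 1) (t.eq_of_mem h h' (siteCube_mem_brick.2 ⟨hp, rfl⟩)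
    (siteCube_mem_post.2 ⟨rfl, Or.inr (by omega)⟩))

theorem not_post_of_post_pred (h : post p (y - 1) ∈ t.dimers) : post p y ∉ t.dimers := by
  intro h'
  have h1 := t.eq_of_mem h h' (siteCube_mem_post.2 ⟨rfl, Or.inr (by omega)⟩ :
    siteCube p y ∈ post p (y - 1)) (siteCube_mem_post.2 ⟨rfl, Or.inl rfl⟩)
  have h2 := (siteCube_mem_post.1 (h1 ▸ siteCube_mem_post.2 ⟨rfl, Or.inl rfl⟩ :
    siteCube p (y - 1) ∈ post p y)).2
  omega

/-- A dimer is a brick or a post. -/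
theorem exists_brick_or_post (t : Tiling (duplex D)) {c : Finset Cube} (hc : c ∈ t.dimers) :
    (∃ d y, c = brick d y) ∨ ∃ p y, c = post p y := by
  have hsub := t.subset c hc
  obtain ⟨⟨⟨x, y⟩, n⟩, i, rfl⟩ := t.isDimer c hc
  have h1 := (mem_duplex.1 (hsub (mem_insert_self _ _))).2
  have h2 := (mem_duplex.1 (hsub (mem_insert_of_mem (mem_singleton_self _)))).2
  have h3 : ∃ f, n = floorHeight f := by
    rcases h1 with h | h
    · exact ⟨false, h⟩
    · exact ⟨true, h⟩
  obtain ⟨f, rfl⟩ := h3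
  fin_cases i
  · exact Or.inl ⟨Sum.inl (x, f), y, by simp [brick, siteCube, unitVec]⟩
  · exact Or.inr ⟨(x, f), y, by simp [post, siteCube, unitVec]⟩
  · cases f
    · exact Or.inl ⟨Sum.inr x, y, by simp [brick, siteCube, unitVec]⟩
    · simp [unitVec] at h2

/-- A cube is covered by one of its two posts or by a brick. -/
theorem post_or_brick (t : Tiling (duplex D)) (h : (p.1, y) ∈ D) : post p (y - 1) ∈ t.dimers ∨
    post p y ∈ t.dimers ∨ ∃ d, p ∈ d.sites ∧ brick d y ∈ t.dimers := by
  obtain ⟨c, hc, hm⟩ := t.covers (siteCube p y) (mem_duplex.2 ⟨h, floorHeight_eq _⟩)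
  rcases t.exists_brick_or_post hc with ⟨d, z, rfl⟩ | ⟨q, z, rfl⟩
  · obtain ⟨h1, rfl⟩ := siteCube_mem_brick.1 hm
    exact Or.inr (Or.inr ⟨d, h1, hc⟩)
  · obtain ⟨rfl, rfl | rfl⟩ := siteCube_mem_post.1 hm
    · exact Or.inr (Or.inl hc)
    · left; rwa [add_sub_cancel_right]

theorem mem_of_post (h : post p y ∈ t.dimers) : (p.1, y) ∈ D ∧ (p.1, y + 1) ∈ D :=
  ⟨(t.fst_mem_of_mem h (siteCube_mem_post.2 ⟨rfl, Or.inl rfl⟩)).1,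
    (t.fst_mem_of_mem h (siteCube_mem_post.2 ⟨rfl, Or.inr rfl⟩)).1⟩

theorem mem_of_brick (h : brick d y ∈ t.dimers) (hp : p ∈ d.sites) : (p.1, y) ∈ D :=
  (t.fst_mem_of_mem h (siteCube_mem_brick.2 ⟨hp, rfl⟩)).1

/-- Two bricks over the same edge in successive rows can be removed. -/
theorem annihilate (h : brick d y ∈ t.dimers) (h' : brick d (y + 1) ∈ t.dimers) :
    ∃ t' : Tiling (duplex D), IsFlip t t' ∧ ∀ e z, brick e z ∈ t'.dimers ↔
      brick e z ∈ t.dimers ∧ ¬ (e = d ∧ (z = y ∨ z = y + 1)) := by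
  rw [brick_eq] at h
  rw [brick_succ_eq] at h'
  obtain ⟨t', h1, h2⟩ := t.exists_flip d.dir_ne_one h h'
  refine ⟨t', h1, fun e z => ?_⟩
  rw [h2, ← brick_eq, ← brick_succ_eq, ← post_fst_eq, ← post_snd_eq]
  simp only [ne_eq, brick_inj, brick_ne_post, or_false]
  tauto

/-- Two bricks over the same edge in successive rows can be inserted. -/
theorem create (h : post d.fst y ∈ t.dimers) (h' : post d.snd y ∈ t.dimers) :
    ∃ t' : Tiling (duplex D), IsFlip t t' ∧ ∀ e z, brick e z ∈ t'.dimers ↔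
      brick e z ∈ t.dimers ∨ (e = d ∧ (z = y ∨ z = y + 1)) := by
  rw [post_fst_eq] at h
  rw [post_snd_eq] at h'
  obtain ⟨t', h1, h2⟩ := t.exists_flip d.dir_ne_one.symm h h'
  refine ⟨t', h1, fun e z => ?_⟩
  rw [h2, ← brick_eq, ← brick_succ_eq, ← post_fst_eq, ← post_snd_eq]
  simp only [ne_eq, brick_inj, brick_ne_post, not_false_iff, and_true]
  tauto

/-- A square of the ladder can be flipped. -/
theorem switch (h : brick (Sum.inr x) y ∈ t.dimers) (h' : brick (Sum.inr (x + 1)) y ∈ t.dimers) :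
    ∃ t' : Tiling (duplex D), IsFlip t t' ∧ ∀ e z, brick e z ∈ t'.dimers ↔
      (brick e z ∈ t.dimers ∧ ¬ (z = y ∧ (e = Sum.inr x ∨ e = Sum.inr (x + 1)))) ∨
      (z = y ∧ (e = Sum.inl (x, false) ∨ e = Sum.inl (x, true))) := by
  have e1 : brick (Sum.inr x) y =
      {siteCube (x, false) y, siteCube (x, false) y + unitVec 2} := brick_eq _ _
  have e2 : brick (Sum.inr (x + 1)) y = {siteCube (x, false) y + unitVec 0,
      siteCube (x, false) y + unitVec 0 + unitVec 2} := by
    simp [brick, siteCube, unitVec]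
  have e3 : brick (Sum.inl (x, false)) y =
      {siteCube (x, false) y, siteCube (x, false) y + unitVec 0} := brick_eq _ _
  have e4 : brick (Sum.inl (x, true)) y = {siteCube (x, false) y + unitVec 2,
      siteCube (x, false) y + unitVec 2 + unitVec 0} := by
    simp [brick, siteCube, unitVec]
  rw [e1] at h
  rw [e2] at h'
  obtain ⟨t', h1, h2⟩ := t.exists_flip (by decide) h h'
  refine ⟨t', h1, fun e z => ?_⟩
  rw [h2, ← e1, ← e2, ← e3, ← e4]
  simp only [ne_eq, brick_inj]
  tauto

/-- A brick can be moved by two rows if nothing is in its way. -/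
theorem shift (h : brick d y ∈ t.dimers) (h1 : ∀ e, brick e (y + 1) ∈ t.dimers →
    Disjoint d.sites e.sites) (hf : (d.fst.1, y + 1) ∈ D) (hs : (d.snd.1, y + 1) ∈ D) :
    ∃ t' : Tiling (duplex D), FlipConnected t t' ∧ ∀ e z, brick e z ∈ t'.dimers ↔
      (brick e z ∈ t.dimers ∧ ¬ (e = d ∧ z = y)) ∨ (e = d ∧ z = y + 2) := by
  -- A cube above the brick is covered neither by a post from below, where the brick is, nor by a
  -- brick, by `h1`; so a post leads upwards from it.
  have key : ∀ p ∈ d.sites, (p.1, y + 1) ∈ D → post p (y + 1) ∈ t.dimers := by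
    intro p hp hD
    rcases t.post_or_brick hD with h2 | h2 | ⟨e, he, h2⟩
    · rw [add_sub_cancel_right] at h2
      exact absurd h2 (not_post_of_brick h hp)
    · exact h2
    · exact absurd he (Finset.disjoint_left.1 (h1 e h2) hp)
  have k1 := key _ d.fst_mem_sites hf
  have k2 := key _ d.snd_mem_sites hs
  obtain ⟨t₁, a1, a2⟩ := create k1 k2
  -- A pair of bricks was created in the rows `y + 1` and `y + 2`; the lower one is now annihilated
  -- with the original brick.
  obtain ⟨t₂, b1, b2⟩ := annihilate (t := t₁) (d := d) (y := y) ((a2 _ _).2 (Or.inl h))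
    ((a2 _ _).2 (Or.inr ⟨rfl, Or.inl rfl⟩))
  refine ⟨t₂, a1.connected.trans b1.connected, fun e z => ?_⟩
  rw [b2, a2]
  have n1 : brick d (y + 1) ∉ t.dimers := fun h2 => by
    have := Finset.disjoint_left.1 (h1 d h2) d.fst_mem_sites
    exact this d.fst_mem_sites
  by_cases he : e = d
  · subst he
    by_cases hz : z = y + 1
    · subst hz; simp [n1]
    · simp [hz, add_assoc]
      constructor
      · tauto
      · rintro (h | h)
        · exact ⟨Or.inl h.1, h.2⟩
        · exact ⟨Or.inr h, by omega⟩
  · simp [he]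

theorem shift_many (n : ℕ) (h : brick d y ∈ t.dimers)
    (h1 : ∀ e z, y < z → z ≤ y + 2 * n → brick e z ∈ t.dimers → Disjoint d.sites e.sites)
    (hD : ∀ p ∈ d.sites, ∀ z, y < z → z ≤ y + 2 * n → (p.1, z) ∈ D) :
    ∃ t' : Tiling (duplex D), FlipConnected t t' ∧ ∀ e z, brick e z ∈ t'.dimers ↔
      (brick e z ∈ t.dimers ∧ ¬ (e = d ∧ z = y)) ∨ (e = d ∧ z = y + 2 * n) := by
  induction n generalizing t with
  | zero =>
    refine ⟨t, .refl, fun e z => ?_⟩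
    simp only [Nat.cast_zero, mul_zero, add_zero]
    by_cases he : e = d ∧ z = y
    · obtain ⟨rfl, rfl⟩ := he; simp [h]
    · simp [he]
  | succ n ih =>
    push_cast at h1 hD
    obtain ⟨t₁, a1, a2⟩ := ih h (fun e z hz hz' => h1 e z hz (by omega))
      fun p hp z hz hz' => hD p hp z hz (by omega)
    obtain ⟨t₂, b1, b2⟩ := shift (t := t₁) (d := d) (y := y + 2 * n)
      ((a2 _ _).2 (Or.inr ⟨rfl, rfl⟩)) (by
        intro e he
        rcases (a2 _ _).1 he with h2 | h2
        · exact h1 e _ (by omega) (by omega) h2.1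
        · omega) (hD _ d.fst_mem_sites _ (by omega) (by omega))
        (hD _ d.snd_mem_sites _ (by omega) (by omega))
    refine ⟨t₂, a1.trans b1, fun e z => ?_⟩
    have n1 : 0 < n → brick d (y + 2 * n) ∉ t.dimers := by
      intro hn h2
      have := Finset.disjoint_left.1 (h1 d _ (by omega) (by omega) h2) d.fst_mem_sites
      exact this d.fst_mem_sites
    rw [b2, a2]
    push_cast
    by_cases he : e = d
    · subst he
      rcases Nat.eq_zero_or_pos n with rfl | hn
      · simp
        constructor
        · rintro (h | h)
          · exact Or.inl ⟨by tauto, by tauto⟩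
          · exact Or.inr h
        · rintro (h | h)
          · exact Or.inl ⟨Or.inl h, h.2⟩
          · exact Or.inr h
      · by_cases hz : z = y + 2 * n
        · subst hz
          simp [n1 hn]
        · rw [show y + 2 * ((n : ℤ) + 1) = y + 2 * n + 2 by ring]
          simp [hz]
    · simp [he]

end Tiling

/-! ### Occupation, and the word of hops of a tiling of a rectangle -/

/-- The rectangle of squares with the given bounds. -/
noncomputable abbrev rect (lo hi y₀ y₁ : ℤ) : Finset Square := Finset.Icc (lo, y₀) (hi, y₁)

theorem mem_rect {lo hi y₀ y₁ : ℤ} {s : Square} :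
    s ∈ rect lo hi y₀ y₁ ↔ (lo ≤ s.1 ∧ s.1 ≤ hi) ∧ y₀ ≤ s.2 ∧ s.2 ≤ y₁ := by
  simp only [rect, Finset.mem_Icc, Prod.le_def]
  tauto

/-- The occupied sites below the first row. -/
noncomputable def base (lo hi y₀ : ℤ) : Finset Site :=
  {p ∈ Finset.Icc lo hi ×ˢ univ | ¬ Even (p.1 + y₀ + floorHeight p.2)}

theorem mem_base {lo hi y₀ : ℤ} {p : Site} :
    p ∈ base lo hi y₀ ↔ (lo ≤ p.1 ∧ p.1 ≤ hi) ∧ ¬ Even (p.1 + y₀ + floorHeight p.2) := by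
  simp [base]

/-- The order of the hops does not matter for the final state, only the parity of the number of hops
that meet each site. -/
theorem mem_run_iff {s : Finset Site} {w : List Edge} {p : Site} :
    p ∈ run s w ↔ (p ∈ s ↔ Even (w.countP fun d => p ∈ d.sites)) := by
  induction w generalizing s with
  | nil => simp
  | cons d w ih =>
    rw [run_cons, ih, List.countP_cons, mem_toggle]
    by_cases h : p ∈ d.sites
    · simp only [h, not_true_eq_false, iff_false, decide_true, if_true, Nat.even_add_one]
      by_cases h1 : p ∈ s <;> simp [h1]
    · simp [h]

theorem countP_lt_succ (L : List (ℤ × Edge)) (y : ℤ) (p : Site) :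
    L.countP (fun a => a.1 < y + 1 ∧ p ∈ a.2.sites) =
      L.countP (fun a => a.1 < y ∧ p ∈ a.2.sites) + L.countP (fun a => a.1 = y ∧ p ∈ a.2.sites) := by
  induction L with
  | nil => rfl
  | cons a L ih =>
    simp only [List.countP_cons, ih]
    by_cases h : p ∈ a.2.sites
    · simp only [h, and_true, decide_eq_true_eq]
      split_ifs <;> omega
    · simp [h]

theorem even_snd_iff (d : Edge) (y : ℤ) : Even (d.snd.1 + y + floorHeight d.snd.2) ↔
    ¬ Even (d.fst.1 + y + floorHeight d.fst.2) := by
  rcases d with ⟨x, f⟩ | x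
  · rw [← Int.even_add_one]
    simp only [fst_inl, snd_inl]
    rw [show x + 1 + y + floorHeight f = x + y + floorHeight f + 1 by ring]
  · rw [← Int.even_add_one]
    simp

/-- The parity condition on the rows of a sequence of bricks. -/
def Timed : Finset Site → List (ℤ × Edge) → Prop
  | _, [] => True
  | s, a :: L => (a.2.fst ∈ s ↔ ¬ Even (a.2.fst.1 + a.1 + floorHeight a.2.fst.2)) ∧
      Timed (toggle s a.2) L

theorem timed_append {s : Finset Site} {L M : List (ℤ × Edge)} :
    Timed s (L ++ M) ↔ Timed s L ∧ Timed (run s (L.map Prod.snd)) M := by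
  induction L generalizing s with
  | nil => simp [Timed]
  | cons a L ih => simp [Timed, ih, and_assoc]

namespace Tiling

variable {D : Finset Square} {t t' : Tiling (duplex D)} {d e : Edge} {p q : Site}
  {lo hi x y z y₀ y₁ : ℤ} {L A B : List (ℤ × Edge)}

/-- The site `p` is occupied below the row `y`. -/
def Occ (t : Tiling (duplex D)) (y : ℤ) (p : Site) : Prop :=
  post p (y - 1) ∈ t.dimers ↔ Even (p.1 + y + floorHeight p.2)

/-- Where no brick meets the site, exactly one of the posts below and above is present, and the
parity alternates with the row, so the occupation persists. A brick excludes both posts, so only the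
parity changes. -/
theorem occ_succ (h : (p.1, y) ∈ D) :
    Occ t (y + 1) p ↔ (Occ t y p ↔ ¬ ∃ d, p ∈ d.sites ∧ brick d y ∈ t.dimers) := by
  have hp : Even (p.1 + (y + 1) + floorHeight p.2) ↔ ¬ Even (p.1 + y + floorHeight p.2) := by
    rw [← Int.even_add_one]
    rw [show p.1 + (y + 1) + floorHeight p.2 = p.1 + y + floorHeight p.2 + 1 by ring]
  rw [Occ, Occ, hp, add_sub_cancel_right]
  have h1 := t.post_or_brick h
  have h2 := @not_post_of_post_pred D t p y
  have h3 : (∃ d, p ∈ d.sites ∧ brick d y ∈ t.dimers) → post p y ∉ t.dimers :=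
    fun ⟨d, hd, hb⟩ => not_post_of_brick hb hd
  have h4 : (∃ d, p ∈ d.sites ∧ brick d y ∈ t.dimers) → post p (y - 1) ∉ t.dimers :=
    fun ⟨d, hd, hb⟩ => not_post_pred_of_brick hb hd
  generalize (∃ d, p ∈ d.sites ∧ brick d y ∈ t.dimers) = b at *
  generalize (post p (y - 1) ∈ t.dimers) = u at *
  generalize (post p y ∈ t.dimers) = v at *
  by_cases hb : b <;> by_cases hu : u <;> by_cases hv : v <;> simp_all

/-- There is no post below a brick. Hence the state fixes the row of a hop modulo two, which is the
condition in `Timed`. -/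
theorem occ_of_brick (h : brick d y ∈ t.dimers) (hp : p ∈ d.sites) :
    Occ t y p ↔ ¬ Even (p.1 + y + floorHeight p.2) := by
  have := not_post_pred_of_brick h hp
  rw [Occ]; tauto

/-- The bricks of the tiling are those of the list. -/
def Realizes (t : Tiling (duplex D)) (L : List (ℤ × Edge)) : Prop :=
  ∀ d y, brick d y ∈ t.dimers ↔ (y, d) ∈ L

theorem countP_eq_one {α : Type*} [DecidableEq α] {l : List α} (h : l.Nodup) {b : α} (hb : b ∈ l) :
    l.countP (fun a => a = b) = 1 := by
  rw [← List.count_eq_one_of_mem h hb, List.count]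
  exact List.countP_congr fun a _ => by simp

theorem even_countP_iff (hL : Realizes t L) (hn : L.Nodup) :
    (Even (L.countP fun a => a.1 = y ∧ p ∈ a.2.sites)) ↔
      ¬ ∃ d, p ∈ d.sites ∧ brick d y ∈ t.dimers := by
  by_cases h : ∃ d, p ∈ d.sites ∧ brick d y ∈ t.dimers
  · obtain ⟨d, hd, hb⟩ := h
    rw [List.countP_congr (q := fun a => a = (y, d)) ?_]
    · rw [countP_eq_one hn ((hL d y).1 hb)]
      simp only [Nat.not_even_one, false_iff, not_not]
      exact ⟨d, hd, hb⟩
    · rintro ⟨z, e⟩ he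
      simp only [decide_eq_true_eq, Prod.mk.injEq]
      constructor
      · rintro ⟨rfl, h2⟩
        exact ⟨rfl, eq_of_brick_mem ((hL e z).2 he) hb h2 hd⟩
      · rintro ⟨rfl, rfl⟩
        exact ⟨rfl, hd⟩
  · rw [List.countP_eq_zero.2]
    · simpa using h
    · rintro ⟨z, e⟩ he h2
      simp only [decide_eq_true_eq] at h2
      obtain ⟨rfl, h2⟩ := h2
      exact h ⟨e, h2, (hL e z).2 he⟩

theorem occ_iff {t : Tiling (duplex (rect lo hi y₀ y₁))} (hL : Realizes t L) (hn : L.Nodup)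
    (hp : lo ≤ p.1 ∧ p.1 ≤ hi) (hy : y₀ ≤ y) (hy' : y ≤ y₁ + 1) :
    Occ t y p ↔ (p ∈ base lo hi y₀ ↔ Even (L.countP fun a => a.1 < y ∧ p ∈ a.2.sites)) := by
  obtain ⟨n, rfl⟩ := Int.le.dest hy
  clear hy
  induction n with
  | zero =>
    simp only [Nat.cast_zero, add_zero]
    rw [List.countP_eq_zero.2]
    -- No post enters the first row, so the occupation there is given by parity alone; this is
    -- `base`.
    · have : post p (y₀ - 1) ∉ t.dimers := fun h => by
        have := (mem_rect.1 (mem_of_post h).1).2.1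
        simp only at this
        omega
      rw [Occ, mem_base]
      simp only [Even.zero]
      tauto
    · rintro ⟨z, e⟩ he h
      simp only [decide_eq_true_eq] at h
      have := (mem_rect.1 (mem_of_brick ((hL e z).2 he) h.2)).2.1
      simp only at this
      omega
  | succ n ih =>
    push_cast at hy' ⊢
    rw [← add_assoc, occ_succ (mem_rect.2 ⟨hp, by simp only; omega, by simp only; omega⟩),
      ih (by omega), countP_lt_succ, Nat.even_add, even_countP_iff hL hn]
    generalize (∃ d, p ∈ d.sites ∧ brick d (y₀ + n) ∈ t.dimers) = b
    generalize Even (List.countP _ L) = u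
    by_cases hb : b <;> by_cases hu : u <;> simp [hb, hu]

/-- Only bricks that meet `p` need to lie on the correct side of `y`. So the state within a word is
meaningful at the ends of the next brick even if several bricks share a row. -/
theorem occ_iff_mem_run {t : Tiling (duplex (rect lo hi y₀ y₁))} (hL : Realizes t (A ++ B))
    (hn : (A ++ B).Nodup) (hp : lo ≤ p.1 ∧ p.1 ≤ hi) (hy : y₀ ≤ y) (hy' : y ≤ y₁ + 1)
    (hA : ∀ a ∈ A, p ∈ a.2.sites → a.1 < y) (hB : ∀ a ∈ B, p ∈ a.2.sites → y ≤ a.1) :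
    Occ t y p ↔ p ∈ run (base lo hi y₀) (A.map Prod.snd) := by
  have hB0 : B.countP (fun a => a.1 < y ∧ p ∈ a.2.sites) = 0 := by
    refine List.countP_eq_zero.2 fun a ha h => ?_
    simp only [decide_eq_true_eq] at h
    have := hB a ha h.2
    omega
  have hA0 : A.countP (fun a => a.1 < y ∧ p ∈ a.2.sites) =
      A.countP ((fun d : Edge => decide (p ∈ d.sites)) ∘ Prod.snd) := by
    refine List.countP_congr fun a ha => ?_
    simp only [decide_eq_true_eq, Function.comp]
    exact ⟨fun h => h.2, fun h => ⟨hA a ha h, h⟩⟩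
  rw [occ_iff hL hn hp hy hy', mem_run_iff, List.countP_append, List.countP_map, hB0, add_zero, hA0]

theorem fits_of_brick {t : Tiling (duplex (rect lo hi y₀ y₁))} (h : brick d y ∈ t.dimers) :
    Fits lo hi d ∧ y₀ ≤ y ∧ y ≤ y₁ := by
  have h1 := mem_rect.1 (mem_of_brick h d.fst_mem_sites)
  have h2 := mem_rect.1 (mem_of_brick h d.snd_mem_sites)
  exact ⟨⟨h1.1.1, h2.1.2⟩, h1.2⟩

/-- At both ends of a brick, the occupation in its row is the state reached by the earlier hops,
since other bricks of that row are disjoint from it. The parities at the two ends are opposite, so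
exactly one end is occupied. -/
theorem timed_ok_of_realizes {t : Tiling (duplex (rect lo hi y₀ y₁))} (hL : Realizes t L)
    (hn : L.Nodup) (hs : L.Pairwise fun a b => a.1 ≤ b.1) :
    Timed (base lo hi y₀) L ∧ Ok lo hi (base lo hi y₀) (L.map Prod.snd) := by
  suffices h : ∀ A B, L = A ++ B → Timed (run (base lo hi y₀) (A.map Prod.snd)) B ∧
      Ok lo hi (run (base lo hi y₀) (A.map Prod.snd)) (B.map Prod.snd) from h [] L rfl
  intro A B hAB
  induction B generalizing A with
  | nil => exact ⟨trivial, trivial⟩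
  | cons a B ih =>
    obtain ⟨y, d⟩ := a
    subst hAB
    have hb : brick d y ∈ t.dimers := (hL d y).2 (by simp)
    obtain ⟨hf, hy, hy'⟩ := fits_of_brick hb
    have hle := fst_le_snd d
    have occ : ∀ p ∈ d.sites, (Occ t y p ↔ p ∈ run (base lo hi y₀) (A.map Prod.snd)) := by
      intro p hp
      refine occ_iff_mem_run hL hn (mem_rect.1 (mem_of_brick hb hp)).1 hy (by omega) ?_ ?_
      · rintro ⟨z, e⟩ he hpe
        have h1 : z ≤ y := (List.pairwise_append.1 hs).2.2 (z, e) he (y, d) (by simp)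
        refine lt_of_le_of_ne h1 ?_
        rintro rfl
        have h2 := eq_of_brick_mem ((hL e z).2 (by simp [he])) hb hpe hp
        subst h2
        exact (List.nodup_append.1 hn).2.2 _ he _ List.mem_cons_self rfl
      · rintro ⟨z, e⟩ he hpe
        rcases List.mem_cons.1 he with h | h
        · exact (congrArg Prod.fst h).ge
        · exact (List.pairwise_cons.1 (List.pairwise_append.1 hs).2.1).1 _ h
    have o1 := (occ _ d.fst_mem_sites).symm.trans (occ_of_brick hb d.fst_mem_sites)
    have o2 := (occ _ d.snd_mem_sites).symm.trans (occ_of_brick hb d.snd_mem_sites)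
    have hv : Valid (run (base lo hi y₀) (A.map Prod.snd)) d := by
      rw [Valid, o1, o2, even_snd_iff, not_not]
    have := ih (A ++ [(y, d)]) (by simp)
    simp only [List.map_append, List.map_cons, List.map_nil, run_append, run_cons, run_nil] at this
    exact ⟨⟨o1, this.1⟩, ⟨hf, hv⟩, this.2⟩

/-- A tiling of a rectangle is determined by its bricks. -/
theorem eq_of_realizes {t t' : Tiling (duplex (rect lo hi y₀ y₁))} (hL : Realizes t L)
    (hL' : Realizes t' L) (hn : L.Nodup) : t = t' := by
  have key : ∀ {t t' : Tiling (duplex (rect lo hi y₀ y₁))}, Realizes t L → Realizes t' L →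
      ∀ c ∈ t.dimers, c ∈ t'.dimers := by
    intro t t' hL hL' c hc
    rcases t.exists_brick_or_post hc with ⟨d, y, rfl⟩ | ⟨p, y, rfl⟩
    · exact (hL' d y).2 ((hL d y).1 hc)
    · obtain ⟨h1, h2⟩ := mem_of_post hc
      rw [mem_rect] at h1 h2
      -- The bricks determine the occupation, and the occupation determines the posts.
      have e1 := occ_iff (y := y + 1) hL hn h1.1 (by omega) (by omega)
      have e2 := occ_iff (y := y + 1) hL' hn h1.1 (by omega) (by omega)
      rw [Occ, add_sub_cancel_right] at e1 e2
      tauto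
  exact ext_dimers (Finset.ext fun c => ⟨key hL hL' c, key hL' hL c⟩)

theorem exists_realizes (t : Tiling (duplex (rect lo hi y₀ y₁))) :
    ∃ L, Realizes t L ∧ L.Nodup ∧ L.Pairwise fun a b => a.1 ≤ b.1 := by
  classical
  set S : Finset (ℤ × Edge) := {a ∈ Finset.Icc y₀ y₁ ×ˢ
    ((Finset.Icc lo hi ×ˢ (univ : Finset Bool)).disjSum (Finset.Icc lo hi)) |
      brick a.2 a.1 ∈ t.dimers} with hS
  refine ⟨S.toList.insertionSort fun a b => a.1 ≤ b.1, ?_, ?_, ?_⟩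
  · intro d y
    rw [(List.perm_insertionSort _ _).mem_iff, Finset.mem_toList, hS, mem_filter]
    simp only [mem_product, iff_and_self]
    intro h
    obtain ⟨h1, h2, h3⟩ := fits_of_brick h
    have hle := fst_le_snd d
    refine ⟨Finset.mem_Icc.2 ⟨h2, h3⟩, ?_⟩
    rcases d with ⟨x, f⟩ | x
    · simp only [Fits, fst_inl, snd_inl] at h1
      simp; omega
    · simp only [Fits, fst_inr, snd_inr] at h1
      simp; omega
  · exact (List.perm_insertionSort _ _).nodup_iff.2 S.nodup_toList
  · have : Std.Total fun a b : ℤ × Edge => a.1 ≤ b.1 := ⟨fun a b => le_total a.1 b.1⟩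
    have : IsTrans (ℤ × Edge) fun a b => a.1 ≤ b.1 := ⟨fun a b c => le_trans⟩
    exact List.pairwise_insertionSort _ _

end Tiling

/-! ### Scheduling and delaying the hops -/

theorem exists_row (s : Finset Site) (d : Edge) (y : ℤ) : ∃ z, y ≤ z ∧ z ≤ y + 1 ∧
    (d.fst ∈ s ↔ ¬ Even (d.fst.1 + z + floorHeight d.fst.2)) := by
  by_cases h : d.fst ∈ s ↔ ¬ Even (d.fst.1 + y + floorHeight d.fst.2)
  · exact ⟨y, le_rfl, by omega, h⟩
  · refine ⟨y + 1, by omega, le_rfl, ?_⟩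
    rw [show d.fst.1 + (y + 1) + floorHeight d.fst.2 = d.fst.1 + y + floorHeight d.fst.2 + 1 by ring,
      Int.even_add_one]
    tauto

theorem exists_bound (L : List (ℤ × Edge)) (y : ℤ) : ∃ z, y ≤ z ∧ ∀ a ∈ L, a.1 < z := by
  induction L with
  | nil => exact ⟨y, le_rfl, by simp⟩
  | cons a L ih =>
    obtain ⟨z, h1, h2⟩ := ih
    refine ⟨max z (a.1 + 1), by omega, fun b hb => ?_⟩
    rcases List.mem_cons.1 hb with rfl | hb
    · omega
    · have := h2 b hb
      omega

/-- A sequence of hops can be performed one row at a time, beginning arbitrarily late. -/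
theorem exists_timed (s : Finset Site) (w : List Edge) (y : ℤ) : ∃ L : List (ℤ × Edge),
    Timed s L ∧ L.map Prod.snd = w ∧ L.Pairwise (fun a b => a.1 < b.1) ∧ ∀ a ∈ L, y ≤ a.1 := by
  induction w generalizing s y with
  | nil => exact ⟨[], trivial, rfl, List.Pairwise.nil, by simp⟩
  | cons d w ih =>
    obtain ⟨z, h1, -, h2⟩ := exists_row s d y
    obtain ⟨L, l1, l2, l3, l4⟩ := ih (toggle s d) (z + 1)
    refine ⟨(z, d) :: L, ⟨h2, l1⟩, by simp [l2], List.pairwise_cons.2 ⟨fun a ha => ?_, l3⟩, ?_⟩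
    · exact Int.lt_of_add_one_le (l4 a ha)
    · intro a ha
      rcases List.mem_cons.1 ha with rfl | ha
      · exact h1
      · have := l4 a ha
        omega

/-- The brick `b` is the brick `a`, an even number of rows later. -/
def Delayed (a b : ℤ × Edge) : Prop := b.2 = a.2 ∧ ∃ n : ℕ, b.1 = a.1 + 2 * n

/-- The state before each hop depends on the word only, so its rows in the two schedules have the
same parity. The second schedule lies entirely at or above the first, so every delay is a
nonnegative even number. -/
theorem Timed.forall₂ {s : Finset Site} {L L' : List (ℤ × Edge)} (h : Timed s L) (h' : Timed s L')
    (hw : L.map Prod.snd = L'.map Prod.snd) {y : ℤ} (hy : ∀ a ∈ L, a.1 ≤ y)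
    (hy' : ∀ a ∈ L', y ≤ a.1) :
    List.Forall₂ Delayed L L' := by
  induction L generalizing s L' with
  | nil =>
    cases L' with
    | nil => exact .nil
    | cons b L' => simp at hw
  | cons a L ih =>
    cases L' with
    | nil => simp at hw
    | cons b L' =>
      simp only [List.map_cons, List.cons.injEq] at hw
      obtain ⟨z, d⟩ := a
      obtain ⟨z', d'⟩ := b
      obtain rfl : d = d' := hw.1
      refine .cons ⟨rfl, ?_⟩ (ih h.2 h'.2 hw.2 (fun a ha => hy a (List.mem_cons_of_mem _ ha))
        fun a ha => hy' a (List.mem_cons_of_mem _ ha))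
      have h1 := hy _ List.mem_cons_self
      have h2 := hy' _ List.mem_cons_self
      have h3 := not_iff_not.1 (h.1.symm.trans h'.1)
      simp only [Int.even_iff] at h1 h2 h3
      generalize floorHeight _ = u at h3
      refine ⟨((z' - z) / 2).toNat, ?_⟩
      simp only
      omega

namespace Tiling

variable {D : Finset Square} {d e : Edge} {p q : Site}
  {lo hi x y z y₀ y₁ : ℤ} {L L' M A B : List (ℤ × Edge)}

/-- Bricks can be delayed, each by an even number of rows. -/
theorem exists_delay {t : Tiling (duplex (rect lo hi y₀ y₁))} (hL : Realizes t (L ++ M))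
    (hn : L.Nodup) (hs : L.Pairwise fun a b => a.1 ≤ b.1)
    (hs' : L'.Pairwise fun a b => a.1 < b.1)
    (hLL : List.Forall₂ Delayed L L')
    (hM : ∀ a ∈ L', ∀ m ∈ M, a.1 < m.1) (hy : ∀ a ∈ L', a.1 ≤ y₁) :
    ∃ t' : Tiling (duplex (rect lo hi y₀ y₁)), FlipConnected t t' ∧ Realizes t' (L' ++ M) := by
  -- The last brick is moved first, so that every brick travels through rows that are free at its
  -- ends; `M` collects the bricks already in their new places.
  induction L using List.reverseRecOn generalizing L' M t with
  | nil =>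
    cases hLL
    exact ⟨t, .refl, hL⟩
  | append_singleton L a ih =>
    rcases List.eq_nil_or_concat L' with rfl | ⟨L', b, rfl⟩
    · have := hLL.length_eq; simp at this
    rw [List.concat_eq_append] at *
    obtain ⟨h1, h2⟩ : List.Forall₂ Delayed L L' ∧ Delayed a b := by
      have hr := List.forall₂_reverse_iff.2 hLL
      simp only [List.reverse_append, List.reverse_cons, List.reverse_nil, List.nil_append,
        List.cons_append, List.forall₂_cons] at hr
      exact ⟨List.forall₂_reverse_iff.1 hr.2, hr.1⟩
    obtain ⟨y, d⟩ := a
    obtain ⟨z, e⟩ := b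
    obtain ⟨hde, n, hz⟩ := h2
    simp only at hde hz
    subst hde hz
    simp only [List.pairwise_append, List.mem_append, List.mem_singleton, List.nodup_append,
      forall_eq] at hs hs' hn hM hy
    have hyM : ∀ m ∈ M, y + 2 * n < m.1 := fun m hm => hM _ (Or.inr rfl) m hm
    have hyb : y + 2 * n ≤ y₁ := hy _ (Or.inr rfl)
    have hb : brick e y ∈ t.dimers := (hL e y).2 (by simp)
    obtain ⟨hf, hb0, -⟩ := fits_of_brick hb
    obtain ⟨t₁, a1, a2⟩ := shift_many n hb (by
      intro c z hz1 hz2 hc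
      rw [hL] at hc
      simp only [List.mem_append, List.mem_singleton, Prod.mk.injEq] at hc
      rcases hc with (hc | hc) | hc
      · have : z ≤ y := hs.2.2 _ hc
        omega
      · omega
      · have : y + 2 * n < z := hyM _ hc
        omega) (by
      intro p hp z hz1 hz2
      have := mem_rect.1 (mem_of_brick hb hp)
      exact mem_rect.2 ⟨this.1, by simp only; omega, by simp only; omega⟩)
    have hreal : Realizes t₁ (L ++ (y + 2 * n, e) :: M) := by
      intro c z
      rw [a2, hL]
      simp only [List.mem_append, Prod.mk.injEq, List.mem_cons, List.not_mem_nil, or_false]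
      constructor
      · rintro (⟨(h | h) | h, h'⟩ | h)
        · exact Or.inl h
        · exact absurd ⟨h.2, h.1⟩ h'
        · exact Or.inr (Or.inr h)
        · exact Or.inr (Or.inl ⟨h.2, h.1⟩)
      · rintro (h | h | h)
        · refine Or.inl ⟨Or.inl (Or.inl h), ?_⟩
          rintro ⟨rfl, rfl⟩
          exact hn.2.2 _ h rfl
        · exact Or.inr ⟨h.2, h.1⟩
        · refine Or.inl ⟨Or.inr h, ?_⟩
          rintro ⟨rfl, rfl⟩
          have : z + 2 * n < z := hyM _ h
          omega
    obtain ⟨t₂, b1, b2⟩ := ih hreal hn.1 hs.1 hs'.1 h1 (by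
      intro a ha m hm
      rcases List.mem_cons.1 hm with rfl | hm
      · exact hs'.2.2 a ha
      · exact hM a (Or.inl ha) m hm) fun a ha => hy a (Or.inl ha)
    exact ⟨t₂, a1.trans b1, by simpa using b2⟩

/-- Pairs of rungs in successive rows can be removed. -/
theorem exists_annihilate {t : Tiling (duplex D)} (S : Finset Square) (y₀ : ℤ)
    (hS : ∀ s ∈ S, Even (s.2 - y₀) ∧ brick (Sum.inr s.1) s.2 ∈ t.dimers ∧
      brick (Sum.inr s.1) (s.2 + 1) ∈ t.dimers) :
    ∃ t' : Tiling (duplex D), FlipConnected t t' ∧ ∀ e z, brick e z ∈ t'.dimers ↔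
      brick e z ∈ t.dimers ∧ ∀ s ∈ S, ¬ (e = Sum.inr s.1 ∧ (z = s.2 ∨ z = s.2 + 1)) := by
  induction S using Finset.induction_on with
  | empty => exact ⟨t, .refl, by simp⟩
  | insert s S hs ih =>
    obtain ⟨t₁, a1, a2⟩ := ih fun s h => hS s (mem_insert_of_mem h)
    have key : ∀ z, z = s.2 ∨ z = s.2 + 1 → ∀ r ∈ S, ¬ ((Sum.inr s.1 : Edge) = Sum.inr r.1 ∧
        (z = r.2 ∨ z = r.2 + 1)) := by
      rintro z hz r hr ⟨h1, h2⟩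
      have h3 := (hS s (mem_insert_self _ _)).1
      have h4 := (hS r (mem_insert_of_mem hr)).1
      rw [Int.even_iff] at h3 h4
      have h5 : s.1 = r.1 := Sum.inr_injective h1
      have h6 : s.2 = r.2 := by omega
      exact hs (Prod.ext h5 h6 ▸ hr)
    obtain ⟨-, h1, h2⟩ := hS s (mem_insert_self _ _)
    obtain ⟨t₂, b1, b2⟩ := annihilate ((a2 _ _).2 ⟨h1, key _ (Or.inl rfl)⟩)
      ((a2 _ _).2 ⟨h2, key _ (Or.inr rfl)⟩)
    refine ⟨t₂, a1.trans b1.connected, fun e z => ?_⟩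
    rw [b2, a2, Finset.forall_mem_insert]
    tauto

/-- A tiling of a rectangle of even height extends to larger rectangles without new bricks. -/
theorem exists_extend (t : Tiling (duplex (rect lo hi y₀ y₁))) (ho : Odd (y₁ - y₀))
    {lo' hi' y₂ : ℤ} (hlo : lo' ≤ lo) (hhi : hi ≤ hi') (hy : y₁ ≤ y₂) (ho' : Odd (y₂ - y₀)) :
    ∃ t' : Tiling (duplex (rect lo' hi' y₀ y₂)), StablyConnected t t' ∧
      ∀ d y, brick d y ∈ t'.dimers ↔ brick d y ∈ t.dimers := by
  have hsub : rect lo hi y₀ y₁ ⊆ rect lo' hi' y₀ y₂ := by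
    intro s hs
    rw [mem_rect] at *
    omega
  rw [Int.odd_iff] at ho ho'
  -- The new space is filled with `z` dimers, which are annihilated in pairs of successive rows
  -- starting at even distance from `y₀`. As both heights are even, no pair straddles the top of the
  -- old or the new rectangle.
  obtain ⟨t', h1, h2⟩ := exists_annihilate (t := t.embed hsub)
    {s ∈ rect lo' hi' y₀ y₂ \ rect lo hi y₀ y₁ | Even (s.2 - y₀)} y₀ (by
    intro s hs
    simp only [mem_filter, mem_sdiff, mem_rect] at hs
    have he := hs.2
    rw [Int.even_iff] at he
    refine ⟨hs.2, mem_embed.2 (Or.inr ⟨s, ?_, rfl⟩), mem_embed.2 (Or.inr ⟨(s.1, s.2 + 1), ?_, rfl⟩)⟩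
    · simp only [mem_sdiff, mem_rect]; exact hs.1
    · simp only [mem_sdiff, mem_rect]; omega)
  refine ⟨t', (stablyConnected_embed t hsub).trans h1.stably, fun d y => ?_⟩
  rw [h2, mem_embed]
  constructor
  · rintro ⟨h3 | ⟨s, hs, h4⟩, h5⟩
    · exact h3
    · exfalso
      rw [← show brick (Sum.inr s.1) s.2 = zDimer s from rfl, brick_inj] at h4
      obtain ⟨rfl, rfl⟩ := h4
      by_cases he : Even (s.2 - y₀)
      · exact h5 s (mem_filter.2 ⟨hs, he⟩) ⟨rfl, Or.inl rfl⟩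
      · refine h5 (s.1, s.2 - 1) ?_ ⟨rfl, Or.inr (by simp)⟩
        rw [Int.even_iff] at he
        simp only [mem_filter, mem_sdiff, mem_rect, Int.even_iff] at hs ⊢
        omega
  · intro h
    refine ⟨Or.inl h, ?_⟩
    rintro s hs ⟨rfl, h5⟩
    simp only [mem_filter, mem_sdiff, mem_rect, Int.even_iff] at hs
    have h3 := mem_rect.1 (mem_of_brick h (fst_mem_sites _))
    simp only [fst_inr] at h3
    omega

/-! ### Homotopies of words realized by stable flips -/

/-- Up to stable connection, the hops of the tiling are those of the word `w`. -/
def Reaches (t : Tiling (duplex D)) (lo hi y₀ : ℤ) (w : List Edge) : Prop :=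
  ∃ y₁ L, ∃ t' : Tiling (duplex (rect lo hi y₀ y₁)), y₀ ≤ y₁ ∧ Odd (y₁ - y₀) ∧
    StablyConnected t t' ∧
    Realizes t' L ∧ L.Nodup ∧ L.Pairwise (fun a b => a.1 ≤ b.1) ∧ L.map Prod.snd = w

variable {t : Tiling (duplex D)} {w w' : List Edge}

/-- Every sufficiently late schedule of the word is realized: extend the rectangle upwards without
new bricks, then delay the bricks one by one. -/
theorem Reaches.exists_realizes (h : Reaches t lo hi y₀ w) : ∃ y, y₀ ≤ y ∧ ∀ L' : List (ℤ × Edge),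
    Timed (base lo hi y₀) L' → L'.map Prod.snd = w → L'.Pairwise (fun a b => a.1 < b.1) →
    (∀ a ∈ L', y ≤ a.1) → ∀ y₁, Odd (y₁ - y₀) → y ≤ y₁ → (∀ a ∈ L', a.1 ≤ y₁) →
    ∃ t' : Tiling (duplex (rect lo hi y₀ y₁)), StablyConnected t t' ∧ Realizes t' L' := by
  obtain ⟨y, L, t', hy, ho, hst, hr, hn, hs, hm⟩ := h
  refine ⟨y, hy, fun L' ht' hm' hs' hge y₁ ho' hy₁ hle => ?_⟩
  obtain ⟨t₁, a1, a2⟩ := exists_extend t' ho le_rfl le_rfl hy₁ ho'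
  have hr₁ : Realizes t₁ L := fun d y => (a2 d y).trans (hr d y)
  have htL := (timed_ok_of_realizes hr hn hs).1
  obtain ⟨t₂, b1, b2⟩ := exists_delay (M := []) (by simpa using hr₁) hn hs hs'
    (htL.forall₂ ht' (hm.trans hm'.symm) (fun a ha => (fits_of_brick ((hr a.2 a.1).2 ha)).2.2) hge)
    (by simp) hle
  exact ⟨t₂, (hst.trans a1).trans b1.stably, by simpa using b2⟩

end Tiling

namespace Tiling

variable {D : Finset Square} {d e : Edge} {p q : Site}
  {lo hi x y z y₀ y₁ : ℤ} {L L' M A B : List (ℤ × Edge)}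
variable {t : Tiling (duplex D)} {u v v' w w' : List Edge}

theorem Reaches.ok (h : Reaches t lo hi y₀ w) : Ok lo hi (base lo hi y₀) w := by
  obtain ⟨y, L, t', hy, ho, hst, hr, hn, hs, rfl⟩ := h
  exact (timed_ok_of_realizes hr hn hs).2

/-- A part of a word can be replaced if this is possible with no other bricks around. -/
theorem Reaches.replace (h : Reaches t lo hi y₀ (u ++ v ++ w)) : ∃ y, y₀ ≤ y ∧
    ∀ (z : ℤ) (M M' : List (ℤ × Edge)), y ≤ z → Timed (run (base lo hi y₀) u) M →
      M.map Prod.snd = v → M.Pairwise (fun a b => a.1 < b.1) →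
      (∀ a ∈ M, y ≤ a.1 ∧ a.1 < z) → M'.Nodup → M'.Pairwise (fun a b => a.1 ≤ b.1) →
      (∀ a ∈ M', y ≤ a.1 ∧ a.1 < z) →
      (∀ y₁ A B, ∀ t' : Tiling (duplex (rect lo hi y₀ y₁)), Realizes t' (A ++ M ++ B) →
        A.map Prod.snd = u → (∀ a ∈ A, a.1 < y) → (∀ b ∈ B, z ≤ b.1) →
        (A ++ M ++ B).Nodup → z ≤ y₁ →
        ∃ t'' : Tiling (duplex (rect lo hi y₀ y₁)), FlipConnected t' t'' ∧
          Realizes t'' (A ++ M' ++ B)) →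
      Reaches t lo hi y₀ (u ++ M'.map Prod.snd ++ w) := by
  obtain ⟨y, hy, h⟩ := h.exists_realizes
  -- The hops of `u` are scheduled before `y'` and those of `w` from `z` on, so the rows in between
  -- are free for the replacement.
  obtain ⟨A, a1, a2, a3, a4⟩ := exists_timed (base lo hi y₀) u y
  obtain ⟨y', hy', hb⟩ := exists_bound A y
  refine ⟨y', hy.trans hy', fun z M M' hz m1 m2 m3 m4 n1 n2 n3 hM => ?_⟩
  obtain ⟨B, b1, b2, b3, b4⟩ := exists_timed (run (base lo hi y₀) (u ++ v)) w z
  obtain ⟨z', hz', hb'⟩ := exists_bound B z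
  obtain ⟨y₁, hy₁, ho⟩ : ∃ y₁, z' ≤ y₁ ∧ Odd (y₁ - y₀) := by
    rcases Int.even_or_odd (z' - y₀) with h | h
    · exact ⟨z' + 1, by omega, by rw [add_sub_right_comm]; exact h.add_one⟩
    · exact ⟨z', le_rfl, h⟩
  have hs : (A ++ M ++ B).Pairwise fun a b => a.1 < b.1 := by
    simp only [List.pairwise_append, List.mem_append]
    refine ⟨⟨a3, m3, fun a ha b hb1 => (hb a ha).trans_le (m4 b hb1).1⟩, b3, ?_⟩
    rintro a (ha | ha) b hb1
    · have := hb a ha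
      have := b4 b hb1
      omega
    · have := m4 a ha
      have := b4 b hb1
      omega
  obtain ⟨t', t1, t2⟩ := h (A ++ M ++ B) (by
    simp only [timed_append, List.map_append, a2, m2]
    exact ⟨⟨a1, m1⟩, b1⟩) (by simp [a2, b2, m2]) hs (by
    simp only [List.mem_append]
    rintro a ((ha | ha) | ha)
    · exact a4 a ha
    · exact hy'.trans (m4 a ha).1
    · have := b4 a ha
      omega) y₁ ho (by omega) (by
    simp only [List.mem_append]
    rintro a ((ha | ha) | ha)
    · have := hb a ha
      omega
    · have := m4 a ha
      omega
    · have := hb' a ha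
      omega)
  obtain ⟨t'', c1, c2⟩ := hM y₁ A B t' t2 a2 hb b4
    (hs.imp fun {a b} hab => fun h => by subst h; exact lt_irrefl _ hab) (by omega)
  refine ⟨y₁, A ++ M' ++ B, t'', by omega, ho, t1.trans c1.stably, c2, ?_, ?_, by simp [a2, b2]⟩
  · simp only [List.nodup_append, List.mem_append]
    refine ⟨⟨a3.imp fun {a b} hab => fun h => by subst h; exact lt_irrefl _ hab, n1, ?_⟩,
      b3.imp fun {a b} hab => fun h => by subst h; exact lt_irrefl _ hab, ?_⟩
    · rintro a ha b hb1 rfl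
      have := hb a ha
      have := n3 a hb1
      omega
    · rintro a (ha | ha) b hb1 rfl
      · have := hb a ha
        have := b4 a hb1
        omega
      · have := n3 a ha
        have := b4 a hb1
        omega
  · simp only [List.pairwise_append, List.mem_append]
    refine ⟨⟨a3.imp le_of_lt, n2, fun a ha b hb1 => ((hb a ha).trans_le (n3 b hb1).1).le⟩,
      b3.imp le_of_lt, ?_⟩
    rintro a (ha | ha) b hb1
    · have := hb a ha
      have := b4 b hb1
      omega
    · have := n3 a ha
      have := b4 b hb1
      omega

theorem timed_pair {s : Finset Site} (h : d.fst ∈ s ↔ ¬ Even (d.fst.1 + y + floorHeight d.fst.2)) :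
    Timed s [(y, d), (y + 1, d)] := by
  refine ⟨h, ?_, trivial⟩
  simp only
  rw [mem_toggle_of_mem d.fst_mem_sites, h,
    show d.fst.1 + (y + 1) + floorHeight d.fst.2 = d.fst.1 + y + floorHeight d.fst.2 + 1 by ring,
    Int.even_add_one]

theorem Reaches.cancel (h : Reaches t lo hi y₀ (u ++ d :: d :: w)) :
    Reaches t lo hi y₀ (u ++ w) := by
  obtain ⟨y, -, h⟩ := Reaches.replace (v := [d, d]) (by simpa using h)
  obtain ⟨τ, h1, h2, h3⟩ := exists_row (run (base lo hi y₀) u) d y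
  -- The two copies of `d` stand in the rows `τ` and `τ + 1`, where `τ ≤ y + 1`, hence below `y +
  -- 3`; there they annihilate.
  have := h (y + 3) [(τ, d), (τ + 1, d)] [] (by omega) (timed_pair h3) rfl (by simp)
    (by simp; omega) (by simp) (by simp) (by simp) (by
    intro y₁ A B t' hr hA hAy hBy hn hy₁
    obtain ⟨t'', c1, c2⟩ := annihilate (t := t') (d := d) (y := τ) ((hr _ _).2 (by simp))
      ((hr _ _).2 (by simp))
    refine ⟨t'', c1.connected, fun c z => ?_⟩
    rw [c2, hr]
    simp only [List.mem_append, List.mem_cons, Prod.mk.injEq, List.not_mem_nil, or_false]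
    have e1 : (z, c) ∈ A → z < y := fun h => hAy _ h
    have e2 : (z, c) ∈ B → y + 3 ≤ z := fun h => hBy _ h
    constructor
    · rintro ⟨(h | h) | h, h'⟩
      · exact Or.inl h
      · exact absurd (h.imp And.left And.left) fun h1 => h' ⟨h.elim And.right And.right, h1⟩
      · exact Or.inr h
    · rintro (h | h)
      · have := e1 h
        exact ⟨Or.inl (Or.inl h), by omega⟩
      · have := e2 h
        exact ⟨Or.inr h, by omega⟩)
  simpa using this

/-- In a row of the right parity without bricks nearby, posts lead upwards from both ends of `d`,
and a pair of bricks can be created there. -/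
theorem Reaches.insert (h : Reaches t lo hi y₀ (u ++ w)) (hf : Fits lo hi d)
    (hv : Valid (run (base lo hi y₀) u) d) : Reaches t lo hi y₀ (u ++ d :: d :: w) := by
  obtain ⟨y, hy, h⟩ := Reaches.replace (v := []) (by simpa using h)
  obtain ⟨τ, h1, h2, h3⟩ := exists_row (run (base lo hi y₀) u) d y
  have h4 : d.snd ∈ run (base lo hi y₀) u ↔ ¬ Even (d.snd.1 + τ + floorHeight d.snd.2) := by
    rw [even_snd_iff, ← h3, show d.fst ∈ _ ↔ _ from hv, not_not]
  have := h (y + 3) [] [(τ, d), (τ + 1, d)] (by omega) trivial rfl (by simp)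
    (by simp) (by simp) (by simp) (by simp; omega) (by
    intro y₁ A B t' hr hA hAy hBy hn hy₁
    have hle := fst_le_snd d
    have key : ∀ p ∈ d.sites, (p ∈ run (base lo hi y₀) u ↔ ¬ Even (p.1 + τ + floorHeight p.2)) →
        post p τ ∈ t'.dimers := by
      intro p hp hpt
      have hp1 : lo ≤ p.1 ∧ p.1 ≤ hi := by
        rcases mem_sites.1 hp with rfl | rfl
        · exact ⟨hf.1, hle.trans hf.2⟩
        · exact ⟨hf.1.trans hle, hf.2⟩
      have ho := occ_iff_mem_run (y := τ) (by simpa using hr) (by simpa using hn) hp1 (by omega)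
        (by omega) (fun a ha _ => by have := hAy a ha; omega)
        (fun a ha _ => by have := hBy a ha; omega)
      rw [hA, hpt, Occ] at ho
      rcases t'.post_or_brick (p := p) (y := τ)
        (mem_rect.2 ⟨hp1, by simp only; omega, by simp only; omega⟩) with h | h | ⟨e, -, he⟩
      · tauto
      · exact h
      · rw [hr] at he
        simp only [List.mem_append, List.not_mem_nil, or_false] at he
        rcases he with he | he
        · have : τ < y := hAy _ he
          omega
        · have : y + 3 ≤ τ := hBy _ he
          omega
    obtain ⟨t'', c1, c2⟩ := create (key _ d.fst_mem_sites h3) (key _ d.snd_mem_sites h4)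
    refine ⟨t'', c1.connected, fun c z => ?_⟩
    rw [c2, hr]
    simp only [List.mem_append, List.mem_cons, Prod.mk.injEq, List.not_mem_nil, or_false]
    tauto)
  simpa using this

/-- The brick `d` in the row `τ` is moved up by four rows, past `e`, which stands in the row `τ + 1`
or `τ + 2` and is disjoint from it. -/
theorem Reaches.comm (h : Reaches t lo hi y₀ (u ++ d :: e :: w)) (hd : Disjoint d.sites e.sites) :
    Reaches t lo hi y₀ (u ++ e :: d :: w) := by
  have hne : e ≠ d := by
    rintro rfl
    exact Finset.disjoint_left.1 hd e.fst_mem_sites e.fst_mem_sites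
  obtain ⟨y, hy, h⟩ := Reaches.replace (v := [d, e]) (by simpa using h)
  obtain ⟨τ, h1, h2, h3⟩ := exists_row (run (base lo hi y₀) u) d y
  obtain ⟨σ, g1, g2, g3⟩ := exists_row (toggle (run (base lo hi y₀) u) d) e (τ + 1)
  have := h (τ + 5) [(τ, d), (σ, e)] [(σ, e), (τ + 4, d)] (by omega) ⟨h3, g3, trivial⟩ rfl
    (by simp; omega) (by simp; omega) (by simp [hne]) (by simp; omega) (by simp; omega) (by
    intro y₁ A B t' hr hA hAy hBy hn hy₁
    have hb : brick d τ ∈ t'.dimers := (hr _ _).2 (by simp)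
    obtain ⟨t'', c1, c2⟩ := shift_many 2 hb (by
      intro c z hz1 hz2 hc
      rw [hr] at hc
      simp only [List.mem_append, List.mem_cons, Prod.mk.injEq, List.not_mem_nil, or_false] at hc
      push_cast at hz2
      rcases hc with (hc | hc | hc) | hc
      · have : z < y := hAy _ hc
        omega
      · omega
      · exact hc.2 ▸ hd
      · have : τ + 5 ≤ z := hBy _ hc
        omega) (by
      intro p hp z hz1 hz2
      push_cast at hz2
      have := mem_rect.1 (mem_of_brick hb hp)
      exact mem_rect.2 ⟨this.1, by simp only; omega, by simp only; omega⟩)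
    refine ⟨t'', c1, fun c z => ?_⟩
    rw [c2, hr]
    simp only [List.mem_append, List.mem_cons, Prod.mk.injEq, List.not_mem_nil, or_false]
    push_cast
    have e1 : (z, c) ∈ A → z < y := fun h => hAy _ h
    have e2 : (z, c) ∈ B → τ + 5 ≤ z := fun h => hBy _ h
    constructor
    · rintro (⟨(h | h | h) | h, h'⟩ | h)
      · exact Or.inl (Or.inl h)
      · exact absurd ⟨h.2, h.1⟩ h'
      · exact Or.inl (Or.inr (Or.inl h))
      · exact Or.inr h
      · exact Or.inl (Or.inr (Or.inr ⟨h.2, h.1⟩))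
    · rintro ((h | h | h) | h)
      · have := e1 h
        exact Or.inl ⟨Or.inl (Or.inl h), by omega⟩
      · exact Or.inl ⟨Or.inl (Or.inr (Or.inr h)), by omega⟩
      · exact Or.inr ⟨h.2, h.1⟩
      · have := e2 h
        exact Or.inl ⟨Or.inr h, by omega⟩)
  simpa using this

/-- As the particles lie on a diagonal, neighbouring rungs may stand in rows of the same parity.
They are scheduled in the rows `τ` and `τ + 2`; the first is moved up beside the second, and the
slab is flipped. -/
theorem Reaches.flip (h : Reaches t lo hi y₀ (u ++ Sum.inr x :: Sum.inr (x + 1) :: w))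
    (hv : Valid (run (base lo hi y₀) u) (Sum.inl (x, false))) :
    Reaches t lo hi y₀ (u ++ Sum.inl (x, false) :: Sum.inl (x, true) :: w) := by
  have hd : Disjoint (sites (Sum.inr x)) (sites (Sum.inr (x + 1))) := disjoint_inr (by omega)
  obtain ⟨y, hy, h⟩ := Reaches.replace (v := [Sum.inr x, Sum.inr (x + 1)]) (by simpa using h)
  obtain ⟨τ, h1, h2, h3⟩ := exists_row (run (base lo hi y₀) u) (Sum.inr x) y
  have := h (τ + 3) [(τ, Sum.inr x), (τ + 2, Sum.inr (x + 1))]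
    [(τ + 2, Sum.inl (x, false)), (τ + 2, Sum.inl (x, true))] (by omega) (by
      refine ⟨h3, ?_, trivial⟩
      simp only [fst_inr, floorHeight_false, add_zero] at h3 ⊢
      rw [mem_toggle_of_notMem (by simp [mem_sites])]
      simp only [Valid, fst_inl, snd_inl] at hv
      rw [show x + 1 + (τ + 2) = x + τ + 1 + 2 by ring, Int.even_add, Int.even_add_one]
      simp only [even_two, iff_true, not_not]
      tauto) rfl
    (by simp) (by simp; omega) (by simp) (by simp) (by simp; omega) (by
    intro y₁ A B t' hr hA hAy hBy hn hy₁
    have hb : brick (Sum.inr x) τ ∈ t'.dimers := (hr _ _).2 (by simp)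
    obtain ⟨t₁, c1, c2⟩ := shift_many 1 hb (by
      intro c z hz1 hz2 hc
      rw [hr] at hc
      simp only [List.mem_append, List.mem_cons, Prod.mk.injEq, List.not_mem_nil, or_false] at hc
      push_cast at hz2
      rcases hc with (hc | hc | hc) | hc
      · have : z < y := hAy _ hc
        omega
      · omega
      · exact hc.2 ▸ hd
      · have : τ + 3 ≤ z := hBy _ hc
        omega) (by
      intro p hp z hz1 hz2
      push_cast at hz2
      have := mem_rect.1 (mem_of_brick hb hp)
      exact mem_rect.2 ⟨this.1, by simp only; omega, by simp only; omega⟩)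
    simp only [Nat.cast_one, mul_one] at c2
    obtain ⟨t₂, d1, d2⟩ := switch (t := t₁) (x := x) (y := τ + 2) ((c2 _ _).2 (by simp))
      ((c2 _ _).2 (Or.inl ⟨(hr _ _).2 (by simp), by simp⟩))
    refine ⟨t₂, c1.trans d1.connected, fun c z => ?_⟩
    rw [d2, c2, hr]
    simp only [List.mem_append, List.mem_cons, Prod.mk.injEq, List.not_mem_nil, or_false]
    have e1 : (z, c) ∈ A → z < y := fun h => hAy _ h
    have e2 : (z, c) ∈ B → τ + 3 ≤ z := fun h => hBy _ h
    constructor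
    · rintro (⟨⟨(h | h | h) | h, h'⟩ | h, h''⟩ | ⟨h, h' | h'⟩)
      · exact Or.inl (Or.inl h)
      · exact absurd ⟨h.2, h.1⟩ h'
      · exact absurd ⟨h.1, Or.inr h.2⟩ h''
      · exact Or.inr h
      · exact absurd ⟨h.2, Or.inl h.1⟩ h''
      · exact Or.inl (Or.inr (Or.inl ⟨h, h'⟩))
      · exact Or.inl (Or.inr (Or.inr ⟨h, h'⟩))
    · rintro ((h | h | h) | h)
      · have := e1 h
        exact Or.inl ⟨Or.inl ⟨Or.inl (Or.inl h), by omega⟩, by omega⟩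
      · exact Or.inr ⟨h.1, Or.inl h.2⟩
      · exact Or.inr ⟨h.1, Or.inr h.2⟩
      · have := e2 h
        exact Or.inl ⟨Or.inl ⟨Or.inr h, by omega⟩, by omega⟩)
  simpa using this

theorem Reaches.htpy (h : Reaches t lo hi y₀ w) (hw : Htpy lo hi (base lo hi y₀) w w') :
    Reaches t lo hi y₀ w' := by
  obtain ⟨-, hw⟩ := hw
  induction hw with
  | refl => exact h
  | tail _ hs ih =>
    cases hs with
    | cancel A B d => exact ih.cancel
    | insert A B d h1 h2 => exact ih.insert h1 h2
    | comm A B d e h1 => exact ih.comm h1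
    | flip A B x h1 h2 => exact ih.flip h1

/-- Both tilings are stably connected to tilings of one rectangle with the same schedule, and these
coincide because the bricks determine a tiling. -/
theorem Reaches.stablyConnected {D' : Finset Square} {t' : Tiling (duplex D')}
    (h : Reaches t lo hi y₀ w) (h' : Reaches t' lo hi y₀ w) : StablyConnected t t' := by
  obtain ⟨y, hy, h⟩ := h.exists_realizes
  obtain ⟨y', hy', h'⟩ := h'.exists_realizes
  obtain ⟨L, l1, l2, l3, l4⟩ := exists_timed (base lo hi y₀) w (max y y')
  obtain ⟨z, hz, hb⟩ := exists_bound L (max y y')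
  obtain ⟨y₁, hy₁, ho⟩ : ∃ y₁, z ≤ y₁ ∧ Odd (y₁ - y₀) := by
    rcases Int.even_or_odd (z - y₀) with h | h
    · exact ⟨z + 1, by omega, by rw [add_sub_right_comm]; exact h.add_one⟩
    · exact ⟨z, le_rfl, h⟩
  obtain ⟨t₁, a1, a2⟩ := h L l1 l2 l3 (fun a ha => (le_max_left _ _).trans (l4 a ha)) y₁ ho
    (by omega) fun a ha => (hb a ha).le.trans hy₁
  obtain ⟨t₂, b1, b2⟩ := h' L l1 l2 l3 (fun a ha => (le_max_right _ _).trans (l4 a ha)) y₁ ho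
    (by omega) fun a ha => (hb a ha).le.trans hy₁
  have := eq_of_realizes a2 b2 (l3.imp fun {a b} hab => fun h => by subst h; exact lt_irrefl _ hab)
  subst this
  exact a1.trans b1.symm

end Tiling

/-! ### The angle around a square outside a simply connected region -/

/-- A small ball around `x` misses the closed pieces that do not contain `x`. The part of the union
in the ball is therefore star convex about `x`. -/
theorem locallyPathConnectedSpace_biUnion {E ι : Type*} [NormedAddCommGroup E] [NormedSpace ℝ E]
    (I : Finset ι) (K : ι → Set E) (hc : ∀ i ∈ I, IsClosed (K i)) (hK : ∀ i ∈ I, Convex ℝ (K i)) :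
    LocallyPathConnectedSpace (⋃ i ∈ I, K i : Set E) := by
  classical
  set S : Set E := ⋃ i ∈ I, K i with hS
  refine ⟨fun x => ⟨fun s => ⟨fun hs => ?_, fun ⟨t, ht⟩ => Filter.mem_of_superset ht.1.1 ht.2⟩⟩⟩
  obtain ⟨u, hu, hus⟩ := (mem_nhds_subtype S x s).mp hs
  have hw : (⋃ i ∈ {i ∈ I | (x : E) ∉ K i}, K i)ᶜ ∈ nhds (x : E) := by
    refine IsOpen.mem_nhds ?_ ?_
    · refine isOpen_compl_iff.2 (isClosed_biUnion_finset fun i hi => hc i (mem_filter.1 hi).1)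
    · simp only [Set.mem_compl_iff, Set.mem_iUnion, mem_filter, not_exists]
      exact fun i hi h => hi.2 h
  obtain ⟨r, hr, hball⟩ := Metric.mem_nhds_iff.1 (Filter.inter_mem hu hw)
  refine ⟨(↑) ⁻¹' Metric.ball (x : E) r, ⟨?_, ?_⟩, fun y hy => hus (hball hy).1⟩
  · exact continuousAt_subtype_val.preimage_mem_nhds (Metric.ball_mem_nhds _ hr)
  · refine Subtype.preimage_coe_self_inter S (Metric.ball (x : E) r) ▸
      IsPathConnected.preimage_coe ?_ Set.inter_subset_left
    refine StarConvex.isPathConnected (a := (x : E)) ?_ ⟨x.2, Metric.mem_ball_self hr⟩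
    rintro y ⟨hyS, hyb⟩ a b ha hb hab
    simp only [hS, Set.mem_iUnion] at hyS
    obtain ⟨i, hi, hyi⟩ := hyS
    have hxi : (x : E) ∈ K i := by
      by_contra hxi
      refine (hball hyb).2 ?_
      simp only [Set.mem_iUnion]
      exact ⟨i, mem_filter.2 ⟨hi, hxi⟩, hyi⟩
    refine ⟨?_, convex_ball _ _ (Metric.mem_ball_self hr) hyb ha hb hab⟩
    simp only [hS, Set.mem_iUnion]
    exact ⟨i, hi, hK i hi hxi hyi ha hb hab⟩

theorem locallyPathConnectedSpace_planeRegion (D : Finset Square) :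
    LocallyPathConnectedSpace (planeRegion D) :=
  locallyPathConnectedSpace_biUnion D _ (fun _ _ => isClosed_Icc.prod isClosed_Icc)
    fun _ _ => (convex_Icc _ _).prod (convex_Icc _ _)

/-- The center of a square. -/
noncomputable def center (s : Square) : ℝ × ℝ := (s.1 + 1 / 2, s.2 + 1 / 2)

theorem mem_planeRegion {D : Finset Square} {z : ℝ × ℝ} : z ∈ planeRegion D ↔
    ∃ s ∈ D, ((s.1 : ℝ) ≤ z.1 ∧ z.1 ≤ s.1 + 1) ∧ (s.2 : ℝ) ≤ z.2 ∧ z.2 ≤ s.2 + 1 := by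
  simp only [planeRegion, Set.mem_iUnion, Set.mem_prod, Set.mem_Icc, exists_prop]

theorem center_mem {D : Finset Square} {s : Square} : center s ∈ planeRegion D ↔ s ∈ D := by
  rw [mem_planeRegion]
  constructor
  · rintro ⟨r, hr, ⟨h1, h2⟩, h3, h4⟩
    simp only [center] at h1 h2 h3 h4
    have a1 : (r.1 : ℝ) < s.1 + 1 := by linarith
    have a2 : (s.1 : ℝ) < r.1 + 1 := by linarith
    have a3 : (r.2 : ℝ) < s.2 + 1 := by linarith
    have a4 : (s.2 : ℝ) < r.2 + 1 := by linarith
    norm_cast at a1 a2 a3 a4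
    rwa [show s = r from Prod.ext (by omega) (by omega)]
  · intro hs
    refine ⟨s, hs, ?_⟩
    simp only [center]
    refine ⟨⟨?_, ?_⟩, ?_, ?_⟩ <;> linarith

theorem lineMap_center_mem {D : Finset Square} {u v : Square} (hu : u ∈ D) (hv : v ∈ D)
    (h : SquareAdj u v) {a : ℝ} (ha : a ∈ Set.Icc (0 : ℝ) 1) :
    AffineMap.lineMap (center u) (center v) a ∈ planeRegion D := by
  obtain ⟨u₁, u₂⟩ := u
  obtain ⟨v₁, v₂⟩ := v
  obtain ⟨h0, h1⟩ := ha
  rw [mem_planeRegion]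
  simp only [SquareAdj] at h
  simp only [AffineMap.lineMap_apply, center, vadd_eq_add,
    vsub_eq_sub, Prod.fst_add, Prod.snd_add, Prod.smul_fst, Prod.smul_snd, Prod.fst_sub,
    Prod.snd_sub, smul_eq_mul]
  rcases le_total a (1 / 2) with h2 | h2
  · refine ⟨_, hu, ?_⟩
    rcases h with ⟨rfl, rfl | rfl⟩ | ⟨rfl, rfl | rfl⟩ <;> push_cast <;>
      refine ⟨⟨?_, ?_⟩, ?_, ?_⟩ <;> linarith
  · refine ⟨_, hv, ?_⟩
    rcases h with ⟨rfl, rfl | rfl⟩ | ⟨rfl, rfl | rfl⟩ <;> push_cast <;>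
      refine ⟨⟨?_, ?_⟩, ?_, ?_⟩ <;> linarith

/-- If the ratio were real and nonpositive, the center of `j` would lie on the unit segment between
the two centers. This is excluded because two successive nonzero integers have the same sign. -/
theorem div_mem_slitPlane {j u v : Square} (hu : u ≠ j) (hv : v ≠ j) (h : SquareAdj u v) :
    relPos j v / relPos j u ∈ Complex.slitPlane := by
  rw [Complex.mem_slitPlane_iff]
  have hn : 0 < Complex.normSq (relPos j u) := Complex.normSq_pos.2 (relPos_ne_zero hu)
  by_contra hcon
  push Not at hcon
  obtain ⟨hre, him⟩ := hcon
  rw [Complex.div_re, ← add_div, div_nonpos_iff] at hre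
  rw [Complex.div_im, ← sub_div, div_eq_zero_iff] at him
  replace him := him.resolve_right hn.ne'
  replace hre := (hre.resolve_left fun h => hn.not_ge h.2).1
  simp only [relPos] at hre him
  norm_cast at hre him
  obtain ⟨u₁, u₂⟩ := u
  obtain ⟨v₁, v₂⟩ := v
  obtain ⟨j₁, j₂⟩ := j
  simp only [SquareAdj, ne_eq, Prod.mk.injEq] at h hu hv hre him
  have key : ∀ a b : ℤ, (b = a + 1 ∨ a = b + 1) → a ≠ 0 → b ≠ 0 → 0 < b * a := by
    intro a b hab ha hb
    rcases lt_or_gt_of_ne ha with ha | ha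
    · exact mul_pos_of_neg_of_neg (by omega) ha
    · exact mul_pos (by omega) ha
  rcases h with ⟨rfl, h⟩ | ⟨rfl, h⟩
  · have : (u₂ - j₂) * (u₁ - v₁) = 0 := by linarith
    have h0 : u₂ - j₂ = 0 := by
      rcases mul_eq_zero.1 this with h | h
      · exact h
      · omega
    have := key (u₁ - j₁) (v₁ - j₁) (by omega) (by omega) (by omega)
    simp only [h0, mul_zero, add_zero] at hre
    omega
  · have : (u₁ - j₁) * (u₂ - v₂) = 0 := by linarith
    have h0 : u₁ - j₁ = 0 := by
      rcases mul_eq_zero.1 this with h | h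
      · exact h
      · omega
    have := key (u₂ - j₂) (v₂ - j₂) (by omega) (by omega) (by omega)
    simp only [h0, mul_zero, zero_add] at hre
    omega

/-- The vector from the center of `j` to a point of the plane, as a complex number. -/
noncomputable def relPoint (j : Square) (z : ℝ × ℝ) : ℂ :=
  ⟨z.1 - (center j).1, z.2 - (center j).2⟩

theorem relPoint_center (j u : Square) : relPoint j (center u) = relPos j u := by
  simp [relPoint, center, relPos]

theorem continuous_relPoint (j : Square) : Continuous (relPoint j) := by
  have : relPoint j = fun z : ℝ × ℝ => ((z.1 - (center j).1 : ℝ) : ℂ) +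
      ((z.2 - (center j).2 : ℝ) : ℂ) * Complex.I := by
    funext z
    exact Complex.mk_eq_add_mul_I _ _
  rw [this]
  fun_prop

theorem relPoint_ne_zero {j : Square} {z : ℝ × ℝ} (h : z ≠ center j) : relPoint j z ≠ 0 := by
  intro h0
  apply h
  have h1 := congrArg Complex.re h0
  have h2 := congrArg Complex.im h0
  simp only [relPoint, Complex.zero_re, Complex.zero_im, sub_eq_zero] at h1 h2
  exact Prod.ext h1 h2

theorem relPoint_lineMap (j : Square) (z z' : ℝ × ℝ) (a : ℝ) :
    relPoint j (AffineMap.lineMap z z' a) =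
      AffineMap.lineMap (relPoint j z) (relPoint j z') a := by
  apply Complex.ext <;>
    simp [relPoint, AffineMap.lineMap_apply] <;> ring

/-- The angle around a square outside of a simply connected region has a continuous branch. -/
theorem exists_angle {D : Finset Square} (hD : IsSimplyConnected (planeRegion D)) {j : Square}
    (hj : j ∉ D) : ∃ θ : Square → ℝ, ∀ u ∈ D, ∀ v ∈ D, SquareAdj u v →
      θ v - θ u = Complex.arg (relPos j v / relPos j u) := by
  classical
  have := hD.simplyConnectedSpace
  have := locallyPathConnectedSpace_planeRegion D
  obtain ⟨z₀, hz₀⟩ := hD.nonempty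
  have hne : ∀ z : planeRegion D, relPoint j z ≠ 0 := fun z => relPoint_ne_zero fun h =>
    hj (center_mem.1 (h ▸ z.2))
  -- A logarithm of the vector from `j`, obtained by lifting through the covering `exp`; its
  -- imaginary part is the angle.
  obtain ⟨G, ⟨-, hG⟩, -⟩ := Complex.isCoveringMapOn_exp.existsUnique_continuousMap_lifts
    (⟨fun z : planeRegion D => relPoint j z, (continuous_relPoint j).comp continuous_subtype_val⟩)
    (a₀ := ⟨z₀, hz₀⟩) (Complex.exp_log (hne ⟨z₀, hz₀⟩)) hne
  have hG' : ∀ z : planeRegion D, Complex.exp (G z) = relPoint j z := fun z => congrFun hG z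
  refine ⟨fun u => if hu : u ∈ D then (G ⟨center u, center_mem.2 hu⟩).im else 0, ?_⟩
  intro u hu v hv huv
  simp only [hu, hv, dif_pos]
  have hju : u ≠ j := fun h => hj (h ▸ hu)
  have hjv : v ≠ j := fun h => hj (h ▸ hv)
  have hu0 := relPos_ne_zero hju
  let γ : C(unitInterval, planeRegion D) :=
    ⟨fun a => ⟨AffineMap.lineMap (center u) (center v) (a : ℝ), lineMap_center_mem hu hv huv a.2⟩,
      Continuous.subtype_mk (by fun_prop) _⟩
  have γ0 : γ 0 = ⟨center u, center_mem.2 hu⟩ := by simp [γ]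
  have γ1 : γ 1 = ⟨center v, center_mem.2 hv⟩ := by simp [γ]
  have hγ : ∀ a : unitInterval, relPoint j (γ a) / relPos j u =
      AffineMap.lineMap (1 : ℂ) (relPos j v / relPos j u) (a : ℝ) := by
    intro a
    simp only [γ, ContinuousMap.coe_mk, relPoint_lineMap, relPoint_center]
    simp only [AffineMap.lineMap_apply, vsub_eq_sub, vadd_eq_add, Complex.real_smul]
    field_simp
  have hslit : ∀ a : unitInterval, relPoint j (γ a) / relPos j u ∈ Complex.slitPlane := by
    intro a
    rw [hγ]
    refine Complex.starConvex_one_slitPlane.segment_subset (div_mem_slitPlane hju hjv huv) ?_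
    rw [segment_eq_image_lineMap]
    exact ⟨a, a.2, rfl⟩
  have : LocallyPathConnectedSpace unitInterval := (convex_Icc (0 : ℝ) 1).locallyPathConnectedSpace
  have : ContractibleSpace unitInterval := (convex_Icc (0 : ℝ) 1).contractibleSpace ⟨0, by simp⟩
  obtain ⟨_, -, huniq⟩ := Complex.isCoveringMapOn_exp.existsUnique_continuousMap_lifts
    (⟨fun a : unitInterval => relPoint j (γ a), (continuous_relPoint j).comp
      (continuous_subtype_val.comp γ.continuous)⟩) (a₀ := 0) (e₀ := G (γ 0)) (hG' _)
    fun a => hne (γ a)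
  -- On the segment between the centers, `G` and the principal logarithm of the ratio, shifted to
  -- the initial value, are lifts of the same path with the same start; so they agree at the end.
  have e1 := huniq (G.comp γ) ⟨rfl, funext fun a => hG' (γ a)⟩
  have e2 := huniq ⟨fun a => G (γ 0) + Complex.log (relPoint j (γ a) / relPos j u),
    continuous_const.add (Continuous.clog (((continuous_relPoint j).comp
      (continuous_subtype_val.comp γ.continuous)).div_const _) hslit)⟩ ⟨by
      simp only [ContinuousMap.coe_mk, γ0, relPoint_center, div_self hu0, Complex.log_one,
        add_zero], funext fun a => by
      simp only [Function.comp, ContinuousMap.coe_mk, Complex.exp_add, hG',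
        Complex.exp_log (Complex.slitPlane_ne_zero (hslit a))]
      rw [γ0, relPoint_center, mul_div_cancel₀ _ hu0]⟩
  have e3 := congrArg Complex.im (DFunLike.congr_fun (e1.trans e2.symm) 1)
  simp only [ContinuousMap.comp_apply, ContinuousMap.coe_mk, Complex.add_im, Complex.log_im, γ0,
    γ1, relPoint_center] at e3
  rw [e3, add_sub_cancel_left]

/-- Squares outside of a simply connected region that contains all cycles have winding number
zero. -/
theorem Tiling.winding_eq_zero {D E : Finset Square} (hD : IsSimplyConnected (planeRegion D))
    (t : Tiling (duplex E)) (ht : ∀ s ∈ E, s ∉ D → s ∈ t.jewels) {j : Square} (hj : j ∈ E)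
    (hjD : j ∉ D) : t.winding j = 0 := by
  obtain ⟨θ, hθ⟩ := exists_angle hD hjD
  have h1 := t.two_pi_mul_winding (ht j hj hjD)
  have h2 : ∀ p ∈ t.arcs, Complex.arg (relPos j p.2 / relPos j p.1) = θ p.2 - θ p.1 := by
    intro p hp
    obtain ⟨hE, h⟩ := mem_arcs.1 hp
    refine (hθ _ ?_ _ ?_ (t.adj_of_mem_arcs hp)).symm
    · by_contra hpD
      rcases h with h | h
      · exact t.notMem_jewels_of_mem (Or.inl rfl) h.2 (ht _ hE.1 hpD)
      · exact t.notMem_jewels_of_mem (Or.inr rfl) h.2 (ht _ hE.1 hpD)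
    · by_contra hpD
      rw [Finset.pair_comm (p.1, 0), Finset.pair_comm (p.1, 1)] at h
      rcases h with h | h
      · exact t.notMem_jewels_of_mem (Or.inl rfl) h.2 (ht _ hE.2 hpD)
      · exact t.notMem_jewels_of_mem (Or.inr rfl) h.2 (ht _ hE.2 hpD)
  -- The sum telescopes: each square without a jewel is the head of one arc and the tail of one arc.
  rw [Finset.sum_congr rfl h2, Finset.sum_sub_distrib, t.sum_arcs_fst θ, t.sum_arcs_snd θ,
    sub_self, mul_eq_zero, Int.cast_eq_zero] at h1
  exact h1.resolve_left (by positivity)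

/-! ### Winding numbers as fluxes, and the invariance under flips -/

/-- The direction in which a post over the site `p` with upper row `y` is crossed. -/
def siteSign (p : Site) (y : ℤ) : ℤ := if Even (p.1 + y + floorHeight p.2) then 1 else -1

theorem siteSign_succ (p : Site) (y : ℤ) : siteSign p (y + 1) = - siteSign p y := by
  rw [siteSign, siteSign,
    show p.1 + (y + 1) + floorHeight p.2 = p.1 + y + floorHeight p.2 + 1 by ring]
  simp only [Int.even_add_one]
  split_ifs <;> simp

theorem siteSign_pred (x : ℤ) (f : Bool) (y : ℤ) : siteSign (x - 1, f) y = - siteSign (x, f) y := by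
  rw [siteSign, siteSign,
    show (x, f).1 + y + floorHeight (x, f).2 = (x - 1) + y + floorHeight f + 1 by simp only; ring]
  simp only [Int.even_add_one]
  split_ifs <;> simp

theorem siteSign_snd (d : Edge) (y : ℤ) : siteSign d.snd y = - siteSign d.fst y := by
  rw [siteSign, siteSign]
  simp only [even_snd_iff]
  split_ifs <;> simp

theorem siteSign_true (x y : ℤ) : siteSign (x, true) y = - siteSign (x, false) y :=
  siteSign_snd (Sum.inr x) y

theorem sum_Ico_sub (a : ℤ) (n : ℕ) {g G : ℤ → ℤ} (h : ∀ x, g x = G x - G (x - 1)) :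
    ∑ x ∈ Ico a (a + n), g x = G (a + n - 1) - G (a - 1) := by
  induction n with
  | zero => simp
  | succ n ih =>
    have : Ico a (a + (n + 1 : ℕ)) = insert (a + n : ℤ) (Ico a (a + n)) := by
      ext x
      simp only [Finset.mem_Ico, mem_insert]
      omega
    rw [this, sum_insert (by simp), ih, h]
    push_cast
    rw [show a + ((n : ℤ) + 1) - 1 = a + n by ring]
    ring

namespace Tiling

variable {D E : Finset Square} {t t' : Tiling (duplex D)} {d e : Edge} {p q : Site}
  {lo hi x y z y₀ y₁ : ℤ}

/-- The signed number of arcs in the post over `p` with upper row `y`. -/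
def flux (t : Tiling (duplex D)) (p : Site) (y : ℤ) : ℤ :=
  if post p (y - 1) ∈ t.dimers then siteSign p y else 0

/-- The winding number counts the posts to the left. -/
theorem winding_eq (t : Tiling (duplex D)) (hlo : ∀ s ∈ D, lo ≤ s.1) (j : Square) :
    t.winding j = ∑ x ∈ Ico lo j.1, ∑ f, t.flux (x, f) j.2 := by
  rw [← Finset.sum_product' (f := fun x f => t.flux (x, f) j.2)]
  simp only [flux]
  rw [← Finset.sum_filter, winding]
  symm
  -- The arcs that cross the ray are the posts between the rows `j.2 - 1` and `j.2` to the left of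
  -- `j`; the parity of a post decides which of its squares is the tail.
  refine Finset.sum_of_injOn (fun p : Site => if Even (p.1 + j.2 + floorHeight p.2) then
    ((p.1, j.2), (p.1, j.2 - 1)) else ((p.1, j.2 - 1), (p.1, j.2))) ?_ ?_ ?_ ?_
  · rintro ⟨x, f⟩ - ⟨x', f'⟩ - h
    simp only at h
    have hx : x = x' := by split_ifs at h <;> simp_all
    subst hx
    cases f <;> cases f' <;> simp only [floorHeight_false, floorHeight_true, add_zero,
      Int.even_add_one] at h ⊢ <;> exfalso <;> split_ifs at h <;> simp at h
  · rintro ⟨x, f⟩ hp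
    simp only [coe_filter, Set.mem_ofPred_eq] at hp
    have hm := mem_of_post hp.2
    rw [sub_add_cancel] at hm
    have hp2 := hp.2
    simp only [post, siteCube, sub_add_cancel] at hp2
    simp only [Finset.mem_coe, mem_arcs]
    split_ifs with h <;> cases f <;> simp only [floorHeight_false, floorHeight_true, add_zero,
      Int.even_add_one] at h hp2 ⊢
    · exact ⟨⟨hm.2, hm.1⟩, Or.inl ⟨h, by rwa [Finset.pair_comm]⟩⟩
    · exact ⟨⟨hm.2, hm.1⟩, Or.inr ⟨h, by rwa [Finset.pair_comm]⟩⟩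
    · refine ⟨hm, Or.inl ⟨?_, hp2⟩⟩
      rw [Int.even_iff] at h ⊢
      omega
    · refine ⟨hm, Or.inr ⟨?_, hp2⟩⟩
      rw [Int.even_iff] at h ⊢
      omega
  · rintro ⟨⟨u₁, u₂⟩, v₁, v₂⟩ hp himg
    have hmem := (mem_arcs.1 hp).1
    have h := (mem_arcs.1 hp).2
    simp only at hmem h
    by_contra hc
    apply himg
    simp only [crossing] at hc
    simp only [Set.mem_image, coe_filter, Set.mem_ofPred_eq, mem_product, Finset.mem_Ico, mem_univ,
      and_true]
    have hu : lo ≤ u₁ := hlo _ hmem.1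
    split_ifs at hc with h1 h2 h3
    · obtain ⟨hlt, rfl⟩ := h1
      obtain ⟨rfl, rfl⟩ := h2
      rcases h with h | h
      · refine ⟨(v₁, false), ⟨⟨hu, hlt⟩, ?_⟩, ?_⟩
        · rw [Finset.pair_comm] at h
          simpa [post, siteCube] using h.2
        · simp [h.1]
      · refine ⟨(v₁, true), ⟨⟨hu, hlt⟩, ?_⟩, ?_⟩
        · rw [Finset.pair_comm] at h
          simpa [post, siteCube] using h.2
        · simp [h.1]
    · obtain ⟨hlt, rfl⟩ := h1
      obtain ⟨rfl, rfl⟩ := h3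
      have hpar : Even (v₁ + j.2) ↔ ¬ Even (v₁ + (j.2 - 1)) := by
        rw [Int.even_iff, Int.even_iff]; omega
      rcases h with h | h
      · refine ⟨(v₁, false), ⟨⟨hu, hlt⟩, ?_⟩, ?_⟩
        · simpa [post, siteCube] using h.2
        · simp [hpar, h.1]
      · refine ⟨(v₁, true), ⟨⟨hu, hlt⟩, ?_⟩, ?_⟩
        · simpa [post, siteCube] using h.2
        · simp [hpar, h.1]
    all_goals exact absurd rfl hc
  · rintro ⟨x, f⟩ hp
    simp only [mem_filter, mem_product, Finset.mem_Ico] at hp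
    simp only [siteSign]
    split_ifs with h <;> simp [crossing, hp.1.1.2]

/-- The signed number of arcs over a horizontal edge. -/
def hop (t : Tiling (duplex D)) (p : Site) (y : ℤ) : ℤ :=
  if brick (Sum.inl p) y ∈ t.dimers then siteSign p y else 0

/-- Conservation at one square on one floor. If the square is in `D` and no jewel, exactly one of
its two posts and two rails on this floor is present, and it contributes one end of an arc, whence
the source term. A jewel contributes none. -/
theorem flux_succ_sub (t : Tiling (duplex D)) (x : ℤ) (f : Bool) (y : ℤ) :
    t.flux (x, f) (y + 1) - t.flux (x, f) y =
      (if brick (Sum.inr x) y ∈ t.dimers ∨ (x, y) ∉ D then 0 else - siteSign (x, f) y) +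
        (t.hop (x, f) y - t.hop (x - 1, f) y) := by
  have m1 : (x, f) ∈ sites (Sum.inr x) := by cases f <;> simp [mem_sites]
  have m2 : (x, f) ∈ sites (Sum.inl (x, f)) := by simp [mem_sites]
  have m3 : (x, f) ∈ sites (Sum.inl (x - 1, f)) := by simp [mem_sites]
  have hall : ∀ d : Edge, (x, f) ∈ d.sites →
      d = Sum.inr x ∨ d = Sum.inl (x, f) ∨ d = Sum.inl (x - 1, f) := by
    rintro (⟨x', f'⟩ | x') h
    · simp only [mem_sites, fst_inl, snd_inl, Prod.mk.injEq] at h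
      rcases h with ⟨rfl, rfl⟩ | ⟨rfl, rfl⟩ <;> simp
    · simp only [mem_sites, fst_inr, snd_inr, Prod.mk.injEq] at h
      rcases h with ⟨rfl, -⟩ | ⟨rfl, -⟩ <;> simp
  simp only [flux, hop, siteSign_succ, siteSign_pred, add_sub_cancel_right]
  have hb : ∀ d : Edge, (x, f) ∈ d.sites → brick d y ∈ t.dimers →
      post (x, f) y ∉ t.dimers ∧ post (x, f) (y - 1) ∉ t.dimers ∧ (x, y) ∈ D ∧
      ∀ e : Edge, (x, f) ∈ e.sites → e ≠ d → brick e y ∉ t.dimers := fun d hd h =>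
    ⟨not_post_of_brick h hd, not_post_pred_of_brick h hd, mem_of_brick h hd,
      fun e he hne h' => hne (eq_of_brick_mem h' h he hd)⟩
  by_cases h1 : brick (Sum.inr x) y ∈ t.dimers
  · obtain ⟨a, b, c, h⟩ := hb _ m1 h1
    simp [h1, a, b, h _ m2 (by simp), h _ m3 (by simp)]
  by_cases h2 : brick (Sum.inl (x, f)) y ∈ t.dimers
  · obtain ⟨a, b, c, h⟩ := hb _ m2 h2
    simp [h1, h2, a, b, c, h _ m3 (by simp)]
  by_cases h3 : brick (Sum.inl (x - 1, f)) y ∈ t.dimers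
  · obtain ⟨a, b, c, h⟩ := hb _ m3 h3
    simp [h1, h2, h3, a, b, c]
  by_cases hD : (x, y) ∈ D
  · by_cases h4 : post (x, f) (y - 1) ∈ t.dimers
    · simp [h1, h2, h3, h4, hD, not_post_of_post_pred h4]
    · by_cases h5 : post (x, f) y ∈ t.dimers
      · simp [h1, h2, h3, h4, h5, hD]
      · exfalso
        rcases t.post_or_brick (p := (x, f)) hD with h | h | ⟨d, hd, h⟩
        · exact h4 h
        · exact h5 h
        · rcases hall d hd with rfl | rfl | rfl
          exacts [h1 h, h2 h, h3 h]
  · have h4 : post (x, f) (y - 1) ∉ t.dimers := fun h => by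
      have := (mem_of_post h).2
      rw [sub_add_cancel] at this
      exact hD this
    have h5 : post (x, f) y ∉ t.dimers := fun h => hD (mem_of_post h).1
    simp [h1, h2, h3, h4, h5, hD]

/-- The source terms of the two floors are opposite: a cycle that enters a square on one floor
leaves it on the other. -/
theorem sum_flux_succ_sub (t : Tiling (duplex D)) (x y : ℤ) :
    ∑ f, t.flux (x, f) (y + 1) - ∑ f, t.flux (x, f) y =
      ∑ f, t.hop (x, f) y - ∑ f, t.hop (x - 1, f) y := by
  have h1 := t.flux_succ_sub x true y
  have h2 := t.flux_succ_sub x false y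
  rw [siteSign_true] at h1
  simp only [Fintype.sum_bool]
  split_ifs at h1 h2 <;> linarith

/-- The flux through a segment is conserved up to the hops at its ends. -/
theorem sum_Ico_flux_succ (t : Tiling (duplex D)) {a b : ℤ} (hab : a ≤ b) (y : ℤ) :
    ∑ x ∈ Ico a b, ∑ f, t.flux (x, f) (y + 1) = ∑ x ∈ Ico a b, ∑ f, t.flux (x, f) y +
      (∑ f, t.hop (b - 1, f) y - ∑ f, t.hop (a - 1, f) y) := by
  obtain ⟨n, rfl⟩ := Int.le.dest hab
  rw [← sum_Ico_sub a n (t.sum_flux_succ_sub · y), ← Finset.sum_add_distrib]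
  exact Finset.sum_congr rfl fun x _ => by ring

theorem hop_eq_zero (h : (x, y) ∉ D) (f : Bool) : t.hop (x, f) y = 0 :=
  if_neg fun h' => h (mem_of_brick h' (fst_mem_sites _))

theorem hop_pred_eq_zero (h : (x, y) ∉ D) (f : Bool) : t.hop (x - 1, f) y = 0 :=
  if_neg fun h' => h (by simpa using mem_of_brick h' (snd_mem_sites _))

theorem hop_pred_eq_zero_of_rung (h : brick (Sum.inr x) y ∈ t.dimers) (f : Bool) :
    t.hop (x - 1, f) y = 0 := by
  refine if_neg fun h' => ?_
  have := eq_of_brick_mem (p := (x, f)) h h' (by cases f <;> simp [mem_sites])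
    (by simp [mem_sites])
  simp at this

theorem exists_lower_bound (D : Finset Square) : ∃ lo : ℤ, ∀ s ∈ D, lo ≤ s.1 := by
  obtain ⟨lo, h⟩ := (D.image Prod.fst).bddBelow
  exact ⟨lo, fun s hs => h (mem_coe.2 (mem_image_of_mem _ hs))⟩

/-- Jewels on top of each other have the same winding number. -/
theorem winding_succ (h : brick (Sum.inr x) y ∈ t.dimers) :
    t.winding (x, y + 1) = t.winding (x, y) := by
  obtain ⟨lo, hlo⟩ := exists_lower_bound D
  rw [t.winding_eq hlo, t.winding_eq hlo]
  have h1 : lo ≤ x := hlo _ (mem_of_brick h (fst_mem_sites _))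
  have h2 : (lo - 1, y) ∉ D := fun h => by have := hlo _ h; simp only at this; omega
  rw [t.sum_Ico_flux_succ h1]
  simp [hop_pred_eq_zero_of_rung h, hop_eq_zero h2]

/-- Jewels beside each other have the same winding number. -/
theorem winding_right (h : brick (Sum.inr x) y ∈ t.dimers) :
    t.winding (x + 1, y) = t.winding (x, y) := by
  obtain ⟨lo, hlo⟩ := exists_lower_bound D
  rw [t.winding_eq hlo, t.winding_eq hlo]
  have h1 : lo ≤ x := hlo _ (mem_of_brick h (fst_mem_sites _))
  have : Ico lo (x + 1) = insert x (Ico lo x) := by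
    ext; simp only [Finset.mem_Ico, mem_insert]; omega
  simp only [this, sum_insert, Finset.mem_Ico, lt_irrefl, and_false, not_false_eq_true]
  have hz : ∀ f, t.flux (x, f) y = 0 := fun f =>
    if_neg (not_post_pred_of_brick h (by cases f <;> simp [mem_sites]))
  simp [hz]

/-- The contribution of a jewel to the invariant. -/
noncomputable def term (j : Square) (k : ℤ) : LaurentPolynomial ℤ :=
  if Even (j.1 + j.2) then - LaurentPolynomial.T k else LaurentPolynomial.T k

theorem invariant_eq (t : Tiling (duplex D)) :
    t.invariant = ∑ j ∈ t.jewels, term j (t.winding j) := by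
  rw [invariant, Finset.sum_filter, Finset.sum_filter, ← Finset.sum_sub_distrib]
  refine Finset.sum_congr rfl fun j _ => ?_
  rw [term]
  split_ifs <;> simp

theorem mem_jewels {j : Square} : j ∈ t.jewels ↔ brick (Sum.inr j.1) j.2 ∈ t.dimers := by
  rw [jewels, mem_filter, brick_inr]
  exact ⟨fun h => h.2, fun h => ⟨t.mem_of_zDimer_mem h, h⟩⟩

theorem term_add_term {i j : Square} (h : Even (i.1 + i.2) ↔ ¬ Even (j.1 + j.2)) (k : ℤ) :
    term i k + term j k = 0 := by
  rw [term, term]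
  by_cases hj : Even (j.1 + j.2) <;> simp [h, hj]

end Tiling

namespace Tiling

variable {D E : Finset Square} {t t' : Tiling (duplex D)} {d e : Edge} {p q : Site}
  {lo hi x y z y₀ y₁ : ℤ}

theorem winding_congr (h : ∀ p y, post p y ∈ t'.dimers ↔ post p y ∈ t.dimers) (j : Square) :
    t'.winding j = t.winding j := by
  obtain ⟨lo, hlo⟩ := exists_lower_bound D
  rw [t.winding_eq hlo, t'.winding_eq hlo]
  simp only [flux, h]

/-- The two new posts have opposite signs and cancel whenever both are to the left of `j`. Only
`(d.snd.1, y + 1)` can have exactly one of them to its left. -/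
theorem winding_create (H : ∀ p z, post p z ∈ t'.dimers ↔
      post p z ∈ t.dimers ∨ (z = y ∧ p ∈ d.sites))
    (hn : ∀ p ∈ d.sites, post p y ∉ t.dimers) (hd : (d.fst.1, y) ∈ D) {j : Square}
    (hj : j ≠ (d.snd.1, y + 1)) : t'.winding j = t.winding j := by
  obtain ⟨lo, hlo⟩ := exists_lower_bound D
  have hl : lo ≤ d.fst.1 := hlo _ hd
  have hle := fst_le_snd d
  have hle' : d.snd.1 ≤ d.fst.1 + 1 := by rcases d with p | x <;> simp
  rw [t.winding_eq hlo, t'.winding_eq hlo]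
  have hf : ∀ p, t'.flux p j.2 = t.flux p j.2 +
      if j.2 - 1 = y ∧ p ∈ d.sites then siteSign p j.2 else 0 := by
    intro p
    simp only [flux, H]
    by_cases h1 : j.2 - 1 = y ∧ p ∈ d.sites
    · have := hn p h1.2
      simp [h1, this]
    · simp [h1]
  simp only [hf, Finset.sum_add_distrib, add_eq_left]
  by_cases hy : j.2 - 1 = y
  · simp only [hy, true_and]
    rw [← Finset.sum_product' (f := fun x f =>
      if ((x, f) : Site) ∈ d.sites then siteSign (x, f) j.2 else 0), ← Finset.sum_filter]
    by_cases hlt : d.fst.1 < j.1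
    · have hlt' : d.snd.1 < j.1 := by
        refine lt_of_le_of_ne (by omega) fun h => hj ?_
        exact Prod.ext h.symm (by simp only; omega)
      have : {p ∈ Ico lo j.1 ×ˢ (univ : Finset Bool) | (p.1, p.2) ∈ d.sites} = d.sites := by
        ext p
        simp only [mem_filter, mem_product, Finset.mem_Ico, mem_univ, and_true, Prod.mk.eta,
          and_iff_right_iff_imp]
        intro hp
        rcases mem_sites.1 hp with rfl | rfl <;> omega
      rw [this, sites, sum_insert (by simpa using d.fst_ne_snd), sum_singleton, siteSign_snd,
        add_neg_cancel]
    · refine Finset.sum_eq_zero fun p hp => ?_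
      simp only [mem_filter, mem_product, Finset.mem_Ico, Prod.mk.eta] at hp
      rcases mem_sites.1 hp.2 with rfl | rfl <;> omega
  · simp [hy]

/-- If `d` is a rail, no jewels change. If it is a rung, two jewels on top of each other disappear;
they have opposite colours and the same winding number, so their contributions cancel. -/
theorem invariant_create (h : brick d y ∈ t.dimers) (h' : brick d (y + 1) ∈ t.dimers)
    (H : ∀ e, e ∈ t'.dimers ↔ (e ∈ t.dimers ∧ e ≠ brick d y ∧ e ≠ brick d (y + 1)) ∨
      e = post d.fst y ∨ e = post d.snd y) : t'.invariant = t.invariant := by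
  have hp : ∀ p z, post p z ∈ t'.dimers ↔ post p z ∈ t.dimers ∨ (z = y ∧ p ∈ d.sites) := by
    intro p z
    have post_inj : ∀ {p q : Site} {y z}, post p y = post q z ↔ p = q ∧ y = z := by
      intro p q y z
      refine ⟨fun h => ?_, fun h => by rw [h.1, h.2]⟩
      have h1 := siteCube_mem_post.1 (h ▸ siteCube_mem_post.2 ⟨rfl, Or.inl rfl⟩ :
        siteCube p y ∈ post q z)
      have h2 := siteCube_mem_post.1 (h ▸ siteCube_mem_post.2 ⟨rfl, Or.inr rfl⟩ :
        siteCube p (y + 1) ∈ post q z)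
      exact ⟨h1.1, by omega⟩
    rw [H, post_inj, post_inj, mem_sites]
    have := brick_ne_post d p y z
    have := brick_ne_post d p (y + 1) z
    tauto
  have hb : ∀ e z, brick e z ∈ t'.dimers ↔ brick e z ∈ t.dimers ∧
      ¬ (e = d ∧ (z = y ∨ z = y + 1)) := by
    intro e z
    rw [H]
    simp only [ne_eq, brick_inj, brick_ne_post, or_false]
    tauto
  have hw : ∀ j ∈ t'.jewels, t'.winding j = t.winding j := by
    intro j hj
    refine winding_create hp (fun p hp => not_post_of_brick h hp)
      (mem_of_brick h d.fst_mem_sites) ?_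
    -- At the exceptional square a new post ends, so it is no jewel.
    rintro rfl
    rw [mem_jewels] at hj
    refine not_post_pred_of_brick (p := d.snd) hj ?_ ?_
    · cases d.snd with | mk a b => cases b <;> simp [mem_sites]
    · simp only [add_sub_cancel_right]
      exact (hp _ _).2 (Or.inr ⟨rfl, d.snd_mem_sites⟩)
  rw [invariant_eq, invariant_eq, Finset.sum_congr rfl fun j hj => by rw [hw j hj]]
  rcases d with p | x
  · refine Finset.sum_congr ?_ fun _ _ => rfl
    ext j
    simp [mem_jewels, hb]
  · have : t.jewels = insert (x, y) (insert (x, y + 1) t'.jewels) := by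
      ext ⟨a, b⟩
      simp only [mem_jewels, hb, mem_insert, Prod.mk.injEq, Sum.inr.injEq]
      constructor
      · tauto
      · rintro (⟨rfl, rfl⟩ | ⟨rfl, rfl⟩ | h3)
        exacts [h, h', h3.1]
    rw [this, sum_insert, sum_insert, ← add_assoc, winding_succ h, term_add_term, zero_add]
    · simp only
      rw [← add_assoc, Int.even_add_one, not_not]
    · simp [mem_jewels, hb]
    · simp [mem_jewels, hb]

/-- The posts, and with them all winding numbers, are unchanged. The two jewels lost are side by
side, of opposite colours and equal winding numbers. -/
theorem invariant_switch (h : brick (Sum.inr x) y ∈ t.dimers)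
    (h' : brick (Sum.inr (x + 1)) y ∈ t.dimers)
    (H : ∀ e, e ∈ t'.dimers ↔
      (e ∈ t.dimers ∧ e ≠ brick (Sum.inr x) y ∧ e ≠ brick (Sum.inr (x + 1)) y) ∨
      e = brick (Sum.inl (x, false)) y ∨ e = brick (Sum.inl (x, true)) y) :
    t'.invariant = t.invariant := by
  have hw : ∀ j, t'.winding j = t.winding j := winding_congr fun p z => by
    rw [H]
    simp [(brick_ne_post _ _ _ _).symm]
  simp only [invariant_eq, hw]
  have : t.jewels = insert (x, y) (insert (x + 1, y) t'.jewels) := by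
    ext ⟨a, b⟩
    simp only [mem_jewels, H, mem_insert, Prod.mk.injEq, ne_eq, brick_inj, Sum.inr.injEq]
    constructor
    · tauto
    · rintro (⟨rfl, rfl⟩ | ⟨rfl, rfl⟩ | h3)
      · exact h
      · exact h'
      · rcases h3 with h3 | h3 | h3
        exacts [h3.1, absurd h3.1 Sum.inr_ne_inl, absurd h3.1 Sum.inr_ne_inl]
  rw [this, sum_insert, sum_insert, ← add_assoc, winding_right h, term_add_term, zero_add]
  · simp only
    rw [add_right_comm, Int.even_add_one, not_not]
  · simp [mem_jewels, H, brick_inj]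
  · simp [mem_jewels, H, brick_inj]

end Tiling

theorem IsFlip.invariant_eq {D : Finset Square} {t t' : Tiling (duplex D)} (h : IsFlip t t') :
    t'.invariant = t.invariant := by
  obtain ⟨c, i, k, hik, h1, h2, h3, h4, h5⟩ := h
  have H : ∀ e, e ∈ t'.dimers ↔ (e ∈ t.dimers ∧ e ≠ {c, c + unitVec i} ∧
      e ≠ {c + unitVec k, c + unitVec k + unitVec i}) ∨
      e = {c, c + unitVec k} ∨ e = {c + unitVec i, c + unitVec i + unitVec k} := by
    intro e
    have := Finset.ext_iff.1 h5 e
    simp only [mem_sdiff, mem_insert, mem_singleton, not_or] at this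
    constructor
    · intro he
      by_cases h6 : e = {c, c + unitVec k} ∨ e = {c + unitVec i, c + unitVec i + unitVec k}
      · exact Or.inr h6
      · exact Or.inl (this.2 ⟨he, not_or.1 h6⟩)
    · rintro (he | rfl | rfl)
      exacts [(this.1 he).1, h3, h4]
  have H' : ∀ e, e ∈ t.dimers ↔ (e ∈ t'.dimers ∧ e ≠ {c, c + unitVec k} ∧
      e ≠ {c + unitVec i, c + unitVec i + unitVec k}) ∨
      e = {c, c + unitVec i} ∨ e = {c + unitVec k, c + unitVec k + unitVec i} := by
    intro e
    have := Finset.ext_iff.1 h5 e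
    simp only [mem_sdiff, mem_insert, mem_singleton, not_or] at this
    constructor
    · intro he
      by_cases h6 : e = {c, c + unitVec i} ∨ e = {c + unitVec k, c + unitVec k + unitVec i}
      · exact Or.inr h6
      · exact Or.inl (this.1 ⟨he, not_or.1 h6⟩)
    · rintro (he | rfl | rfl)
      exacts [(this.2 he).1, h1, h2]
  -- A flip either exchanges two bricks for two posts (`k = 1`) or two rungs for two rails (`i = 2`,
  -- `k = 0`), up to reversing it; this covers all pairs of directions.
  have key : ∀ t t' : Tiling (duplex D), ∀ c i k, i ≠ k → {c, c + unitVec i} ∈ t.dimers →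
      {c + unitVec k, c + unitVec k + unitVec i} ∈ t.dimers →
      (∀ e, e ∈ t'.dimers ↔ (e ∈ t.dimers ∧ e ≠ {c, c + unitVec i} ∧
        e ≠ {c + unitVec k, c + unitVec k + unitVec i}) ∨
        e = {c, c + unitVec k} ∨ e = {c + unitVec i, c + unitVec i + unitVec k}) →
      (k = 1 ∨ (i = 2 ∧ k = 0)) → t'.invariant = t.invariant := by
    clear h1 h2 h3 h4 h5 H H' hik
    intro t t' c i k hik h1 h2 H hk
    have hc : ∃ p y, c = siteCube p y ∧ (i = 2 → p.2 = false) := by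
      have m1 := (t.fst_mem_of_mem h1 (mem_insert_self _ _)).2
      have m2 := (t.fst_mem_of_mem h1 (mem_insert_of_mem (mem_singleton_self _))).2
      obtain ⟨⟨x, y⟩, n⟩ := c
      rcases m1 with rfl | rfl
      · exact ⟨(x, false), y, rfl, fun _ => rfl⟩
      · refine ⟨(x, true), y, rfl, ?_⟩
        rintro rfl
        simp [unitVec] at m2
    obtain ⟨⟨x, f⟩, y, rfl, hf⟩ := hc
    rcases hk with rfl | ⟨rfl, rfl⟩
    · obtain ⟨d, hd, rfl⟩ : ∃ d : Edge, d.fst = (x, f) ∧ d.dir = i := by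
        fin_cases i
        · exact ⟨Sum.inl (x, f), rfl, rfl⟩
        · exact absurd rfl hik
        · exact ⟨Sum.inr x, by rw [fst_inr, ← hf rfl], rfl⟩
      rw [← hd] at h1 h2 H
      rw [← brick_eq] at h1
      rw [← brick_succ_eq] at h2
      refine Tiling.invariant_create h1 h2 fun e => ?_
      rw [H, ← brick_eq, ← brick_succ_eq, ← post_fst_eq, ← post_snd_eq]
    · obtain rfl : f = false := hf rfl
      have e1 : brick (Sum.inr x) y =
          {siteCube (x, false) y, siteCube (x, false) y + unitVec 2} := brick_eq _ _
      have e2 : brick (Sum.inr (x + 1)) y = {siteCube (x, false) y + unitVec 0,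
          siteCube (x, false) y + unitVec 0 + unitVec 2} := by
        simp [brick, siteCube, unitVec]
      have e3 : brick (Sum.inl (x, false)) y =
          {siteCube (x, false) y, siteCube (x, false) y + unitVec 0} := brick_eq _ _
      have e4 : brick (Sum.inl (x, true)) y = {siteCube (x, false) y + unitVec 2,
          siteCube (x, false) y + unitVec 2 + unitVec 0} := by
        simp [brick, siteCube, unitVec]
      rw [← e1] at h1
      rw [← e2] at h2
      refine Tiling.invariant_switch h1 h2 fun e => ?_
      rw [H, ← e1, ← e2, ← e3, ← e4]
  by_cases hk : k = 1 ∨ (i = 2 ∧ k = 0)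
  · exact key t t' c i k hik h1 h2 H hk
  · refine (key t' t c k i hik.symm h3 h4 H' ?_).symm
    have : ∀ i k : Fin 3, i ≠ k → ¬ (k = 1 ∨ (i = 2 ∧ k = 0)) → i = 1 ∨ (k = 2 ∧ i = 0) := by
      decide
    exact this i k hik hk

theorem FlipConnected.invariant_eq {D : Finset Square} {t t' : Tiling (duplex D)}
    (h : FlipConnected t t') : t'.invariant = t.invariant := by
  induction h with
  | refl => rfl
  | tail _ h ih => rw [h.invariant_eq, ih]

/-! ### The invariant of an embedding -/

namespace Tiling

variable {D E : Finset Square} {lo hi y₀ y₁ : ℤ}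

theorem winding_embed (t : Tiling (duplex D)) (h : D ⊆ E) (j : Square) :
    (t.embed h).winding j = t.winding j := by
  obtain ⟨lo, hlo⟩ := exists_lower_bound E
  rw [(t.embed h).winding_eq hlo, t.winding_eq fun s hs => hlo s (h hs)]
  have : ∀ p z, post p z ∈ (t.embed h).dimers ↔ post p z ∈ t.dimers := by
    intro p z
    rw [mem_embed, or_iff_left]
    rintro ⟨s, -, hs⟩
    exact brick_ne_post (Sum.inr s.1) p s.2 z hs
  simp only [flux, this]

/-- The added jewels all have winding number zero, so the correction does not depend on the tiling.
-/
theorem invariant_embed (t : Tiling (duplex D)) (h : D ⊆ E)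
    (hw : ∀ j ∈ E, j ∉ D → t.winding j = 0) :
    (t.embed h).invariant = t.invariant + ∑ j ∈ E \ D, term j 0 := by
  have hj : (t.embed h).jewels = t.jewels ∪ (E \ D) := by
    ext j
    rw [mem_jewels, mem_union, mem_jewels, mem_embed, brick_inr]
    simp only [zDimer_injective.eq_iff, exists_eq_right]
  rw [invariant_eq, hj, sum_union, invariant_eq]
  · congr 1
    · exact Finset.sum_congr rfl fun j _ => by rw [winding_embed]
    · refine Finset.sum_congr rfl fun j hj => ?_
      rw [mem_sdiff] at hj
      rw [winding_embed, hw j hj.1 hj.2]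
  · refine Finset.disjoint_left.2 fun j hj hj' => (mem_sdiff.1 hj').2 ?_
    exact t.mem_of_zDimer_mem (mem_filter.1 hj).2

/-- For a rectangle this is elementary. To the left, below or above, the ray crosses no post; to the
right it sees the flux through a whole row, which is conserved and vanishes at the bottom. -/
theorem winding_eq_zero_of_notMem_rect (t : Tiling (duplex (rect lo hi y₀ y₁))) {j : Square}
    (hj : j ∉ rect lo hi y₀ y₁) : t.winding j = 0 := by
  rw [t.winding_eq (lo := lo) fun s hs => (mem_rect.1 hs).1.1]
  rcases le_or_gt j.1 lo with h | h
  · rw [Finset.Ico_eq_empty (by omega), sum_empty]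
  have hout : ∀ y, y ∉ Set.Icc (y₀ + 1) y₁ → ∑ x ∈ Ico lo j.1, ∑ f, t.flux (x, f) y = 0 := by
    intro y hy
    refine Finset.sum_eq_zero fun x _ => Finset.sum_eq_zero fun f _ => if_neg fun hp => hy ?_
    have h1 := mem_rect.1 (mem_of_post hp).1
    have h2 := mem_rect.1 (mem_of_post hp).2
    simp only at h1 h2
    constructor <;> omega
  by_cases hx : j.1 ≤ hi
  · refine hout _ fun hy => hj (mem_rect.2 ⟨⟨h.le, hx⟩, ?_⟩)
    have := hy.1
    exact ⟨by omega, hy.2⟩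
  · have hall : ∀ n : ℕ, ∑ x ∈ Ico lo j.1, ∑ f, t.flux (x, f) (y₀ + n) = 0 := by
      intro n
      induction n with
      | zero => exact hout _ fun hy => by have := hy.1; push_cast at this; omega
      | succ n ih =>
        have h1 : (j.1, y₀ + (n : ℤ)) ∉ rect lo hi y₀ y₁ := fun h => hx (mem_rect.1 h).1.2
        have h2 : (lo - 1, y₀ + (n : ℤ)) ∉ rect lo hi y₀ y₁ := fun h => by
          have := (mem_rect.1 h).1.1
          simp only at this
          omega
        push_cast
        rw [← add_assoc, t.sum_Ico_flux_succ h.le, ih]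
        simp [hop_eq_zero h2, hop_pred_eq_zero h1]
    by_cases hy : j.2 < y₀
    · exact hout _ fun h => by have := h.1; omega
    · have := hall (j.2 - y₀).toNat
      rwa [Int.toNat_of_nonneg (by omega), add_sub_cancel] at this

end Tiling

/-! ### The invariant as the weight of a word -/

namespace Edge

variable {lo hi : ℤ} {s : Finset Site} {w w' : List Edge} {x y y₀ : ℤ}

theorem inBox_base (lo hi y₀ : ℤ) : InBox lo hi (base lo hi y₀) := fun _ hp => (mem_base.1 hp).1

theorem level_succ (h : lo ≤ x) (s : Finset Site) : level lo s (x + 1) =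
    level lo s x + ((if (x, false) ∈ s then 1 else 0) + (if (x, true) ∈ s then 1 else 0) - 1) := by
  rw [level, level, cnt_succ h, cnt_succ h]
  push_cast
  ring

/-- In `base` each column has exactly one particle. -/
theorem level_base (h : lo ≤ x) (hx : x ≤ hi + 1) : level lo (base lo hi y₀) x = 0 := by
  obtain ⟨n, rfl⟩ := Int.le.dest h
  clear h
  induction n with
  | zero => simp [level, cnt_self]
  | succ n ih =>
    push_cast at hx ⊢
    rw [← add_assoc, level_succ (by omega), ih (by omega)]
    simp only [mem_base, floorHeight_false, floorHeight_true, add_zero, Int.even_add_one]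
    have : lo ≤ lo + (n : ℤ) ∧ lo + (n : ℤ) ≤ hi := by omega
    simp only [this, and_self, true_and]
    split_ifs <;> simp_all

/-- Any two successive columns of `base` contain one particle on each floor. -/
theorem cnt_base (f : Bool) (n m : ℕ) (h : n ≤ m) :
    cnt (base lo (lo + 2 * m - 1) y₀) f lo (lo + 2 * n) = n := by
  induction n with
  | zero => simp [cnt_self]
  | succ n ih =>
    push_cast at h ⊢
    rw [show lo + 2 * ((n : ℤ) + 1) = lo + 2 * n + 1 + 1 by ring, cnt_succ (by omega),
      cnt_succ (by omega), ih (by omega)]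
    have h1 : lo ≤ lo + 2 * (n : ℤ) ∧ lo + 2 * (n : ℤ) ≤ lo + 2 * m - 1 := by omega
    have h2 : lo ≤ lo + 2 * (n : ℤ) + 1 ∧ lo + 2 * (n : ℤ) + 1 ≤ lo + 2 * m - 1 := by omega
    simp only [mem_base, h1, h2, and_self, true_and]
    rw [show lo + 2 * (n : ℤ) + 1 + y₀ + floorHeight f = lo + 2 * (n : ℤ) + y₀ + floorHeight f + 1 by
      ring]
    simp only [Int.even_add_one]
    split_ifs <;> simp_all

theorem abs_level_toggle_sub_le {d : Edge} (hv : Valid s d) (hlo : lo ≤ d.fst.1) :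
    |level lo (toggle s d) x - level lo s x| ≤ 2 := by
  by_cases hx : d.fst.1 < x ↔ d.snd.1 < x
  · rw [level_toggle hv hlo hx]
    simp
  · have h1 : d.snd.1 = d.fst.1 + 1 := by
      rcases d with p | z
      · rfl
      · exact absurd Iff.rfl hx
    obtain rfl : x = d.fst.1 + 1 := by omega
    rw [level_succ hlo, level_succ hlo, level_toggle hv hlo (by omega)]
    rw [abs_le]
    split_ifs <;> constructor <;> omega

/-- A hop changes any level by at most two, a crude bound that suffices here. -/
theorem abs_le_of_mem_letters {c : ℤ} (hc : ∀ x, lo ≤ x → x ≤ hi + 1 → |level lo s x| ≤ c)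
    (hw : Ok lo hi s w) : ∀ B ∈ letters lo s w, |B.1| ≤ c + 2 * w.length := by
  induction w generalizing s c with
  | nil => simp
  | cons d w ih =>
    have h1 := ih (c := c + 2) (fun x hx hx' => by
      have h1 := hc x hx hx'
      have h2 := abs_level_toggle_sub_le (x := x) hw.1.2 hw.1.1.1
      rw [abs_le] at *
      omega) hw.2
    rcases d with p | z
    · intro B hB
      have := h1 B hB
      simp only [List.length_cons]
      push_cast
      omega
    · intro B hB
      rw [letters_inr, List.mem_cons] at hB
      simp only [List.length_cons]
      push_cast
      rcases hB with rfl | hB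
      · have h2 := hc z hw.1.1.1 (by have := hw.1.1.2; simp only [snd_inr] at this; omega)
        simp only
        omega
      · have := h1 B hB
        omega

theorem length_letters_le (lo : ℤ) (s : Finset Site) (w : List Edge) :
    (letters lo s w).length ≤ w.length := by
  induction w generalizing s with
  | nil => simp
  | cons d w ih =>
    rcases d with p | z
    · exact (ih _).trans (by simp)
    · simpa using ih _

/-- The contribution of a letter to the invariant. -/
noncomputable def weight (A : ℤ × Bool) : LaurentPolynomial ℤ :=
  if A.2 then - LaurentPolynomial.T A.1 else LaurentPolynomial.T A.1

/-- A rung crossed backwards has the same level and the other initial floor, hence the opposite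
weight. -/
theorem sum_weight_reverse (hw : Ok lo hi s w) :
    ((letters lo (run s w) w.reverse).map weight).sum = - ((letters lo s w).map weight).sum := by
  induction w generalizing s with
  | nil => simp
  | cons d w ih =>
    simp only [run_cons, List.reverse_cons, letters_append, List.map_append, List.sum_append,
      run_reverse]
    rw [ih hw.2]
    rcases d with p | x
    · simp
    · have h1 : level lo (toggle s (Sum.inr x)) x = level lo s x :=
        level_toggle hw.1.2 hw.1.1.1 (by simp)
      have h2 : decide ((x, true) ∈ toggle s (Sum.inr x)) = !decide ((x, true) ∈ s) := by
        have : (x, true) ∈ toggle s (Sum.inr x) ↔ (x, true) ∉ s :=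
          mem_toggle_of_mem (snd_mem_sites (Sum.inr x))
        simp [this]
      simp only [letters_inr, letters_nil, List.map_cons, List.map_nil, List.sum_cons, List.sum_nil,
        toggle_toggle, h1, h2, weight, add_zero, neg_add_rev]
      cases decide ((x, true) ∈ s) <;> simp

/-- The coefficient of `T k` in the sum is the difference of the two counts. -/
theorem count_eq_of_sum_weight_eq_zero {q : List (ℤ × Bool)} (h : (q.map weight).sum = 0) (k : ℤ) :
    q.count (k, false) = q.count (k, true) := by
  have key : ∀ q : List (ℤ × Bool), ((q.map weight).sum : LaurentPolynomial ℤ).coeff k =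
      (q.count (k, false) : ℤ) - q.count (k, true) := by
    intro q
    induction q with
    | nil => simp
    | cons A q ih =>
      obtain ⟨l, f⟩ := A
      rw [List.map_cons, List.sum_cons, AddMonoidAlgebra.coeff_add, Finsupp.add_apply, ih]
      cases f <;> by_cases hl : l = k <;> simp [weight, hl] <;> ring
  have := key q
  rw [h] at this
  simp at this
  omega

end Edge

namespace Tiling

variable {D E : Finset Square} {lo hi x y y₀ y₁ : ℤ} {L A B : List (ℤ × Edge)} {p : Site}

/-- The flux is the occupation minus a parity term. The parity terms of the two floors add up to
one, so summing over columns gives the excess of particles, that is, the level. -/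
theorem flux_eq (t : Tiling (duplex D)) (p : Site) (y : ℤ) [Decidable (Occ t y p)] : t.flux p y =
    (if Occ t y p then 1 else 0) - (if Even (p.1 + y + floorHeight p.2) then 0 else 1) := by
  have : Occ t y p ↔ (post p (y - 1) ∈ t.dimers ↔ Even (p.1 + y + floorHeight p.2)) := Iff.rfl
  rw [flux, siteSign]
  split_ifs <;> simp_all

/-- The winding number of a jewel is the level of the corresponding hop. -/
theorem level_eq_winding {t : Tiling (duplex (rect lo hi y₀ y₁))}
    (hL : Realizes t (A ++ (y, Sum.inr x) :: B))
    (hs : (A ++ (y, Sum.inr x) :: B).Pairwise fun a b => a.1 < b.1) :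
    level lo (run (base lo hi y₀) (A.map Prod.snd)) x = t.winding (x, y) := by
  classical
  obtain ⟨hf, hy, hy'⟩ := fits_of_brick ((hL (Sum.inr x) y).2 (by simp))
  rw [t.winding_eq (lo := lo) fun s hs => (mem_rect.1 hs).1.1]
  obtain ⟨hlo, hhi⟩ := hf
  simp only [fst_inr, snd_inr] at hlo hhi
  have key : ∀ n : ℕ, lo + n ≤ hi + 1 →
      level lo (run (base lo hi y₀) (A.map Prod.snd)) (lo + n) =
        ∑ z ∈ Ico lo (lo + n), ∑ f, t.flux (z, f) y := by
    intro n hn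
    induction n with
    | zero => simp [level, cnt_self]
    | succ n ih =>
      have hI : Ico lo (lo + (n + 1 : ℕ)) = insert (lo + n : ℤ) (Ico lo (lo + n)) := by
        ext x
        simp only [Finset.mem_Ico, mem_insert]
        omega
      push_cast at hn
      rw [hI, sum_insert (by simp), ← ih (by omega)]
      push_cast
      have ho : ∀ f, Occ t y (lo + n, f) ↔
          (lo + (n : ℤ), f) ∈ run (base lo hi y₀) (A.map Prod.snd) := fun f =>
        occ_iff_mem_run hL (hs.imp fun {a b} hab => fun h => by subst h; exact lt_irrefl _ hab)
          ⟨by simp, by simp only; omega⟩ hy (by omega)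
          (fun a ha _ => (List.pairwise_append.1 hs).2.2 a ha _ List.mem_cons_self) fun a ha _ => by
            rcases List.mem_cons.1 ha with rfl | ha
            · exact le_rfl
            · exact ((List.pairwise_cons.1 (List.pairwise_append.1 hs).2.1).1 a ha).le
      rw [← add_assoc, level_succ (by omega)]
      simp only [Fintype.sum_bool, flux_eq, ho, floorHeight_false, floorHeight_true, add_zero,
        Int.even_add_one]
      by_cases hE : Even (lo + (n : ℤ) + y) <;> simp [hE] <;> ring
  have := key (x - lo).toNat (by omega)
  rwa [Int.toNat_of_nonneg (by omega), add_sub_cancel] at this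

/-- Jewels are the rungs of the word, their winding numbers are the levels, and by the timing
condition white jewels are the hops that leave the floor `true`. With at most one brick per row, the
state before a hop describes the whole row. -/
theorem invariant_eq_sum_weight {t : Tiling (duplex (rect lo hi y₀ y₁))} (hL : Realizes t L)
    (hs : L.Pairwise fun a b => a.1 < b.1) : t.invariant =
      ((letters lo (base lo hi y₀) (L.map Prod.snd)).map weight).sum := by
  have hn : L.Nodup := hs.imp fun {a b} hab => fun h => by subst h; exact lt_irrefl _ hab
  have htimed := (timed_ok_of_realizes hL hn (hs.imp le_of_lt))
  let F : ℤ × Edge → LaurentPolynomial ℤ := fun a => match a.2 with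
    | Sum.inl _ => 0
    | Sum.inr x => term (x, a.1) (t.winding (x, a.1))
  have h1 : t.invariant = (L.map F).sum := by
    rw [invariant_eq, ← List.sum_toFinset _ hn]
    refine Finset.sum_of_injOn (fun j => (j.2, Sum.inr j.1)) ?_ ?_ ?_ ?_
    · rintro ⟨a, b⟩ - ⟨a', b'⟩ - h
      simp only [Prod.mk.injEq, Sum.inr.injEq] at h
      exact Prod.ext h.2 h.1
    · intro j hj
      exact List.mem_toFinset.2 ((hL _ _).1 (mem_jewels.1 hj))
    · rintro ⟨z, e | x⟩ he hne
      · rfl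
      · exact absurd ⟨(x, z), mem_jewels.2 ((hL _ _).2 (List.mem_toFinset.1 he)), rfl⟩ hne
    · intro j _
      rfl
  rw [h1]
  suffices h : ∀ A B, L = A ++ B → (B.map F).sum =
      ((letters lo (run (base lo hi y₀) (A.map Prod.snd)) (B.map Prod.snd)).map weight).sum from
    h [] L rfl
  intro A B hAB
  induction B generalizing A with
  | nil => simp
  | cons a B ih =>
    have h2 := ih (A ++ [a]) (by simp [hAB])
    simp only [List.map_append, List.map_cons, List.map_nil, run_append, run_cons, run_nil] at h2
    subst hAB
    obtain ⟨y, d⟩ := a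
    simp only [List.map_cons, List.sum_cons]
    rcases d with p | x
    · rw [letters_inl, ← h2]
      simp [F]
    · rw [letters_inr, List.map_cons, List.sum_cons, ← h2]
      congr 1
      have ht := (timed_append.1 htimed.1).2.1
      have hok := htimed.2
      rw [List.map_append, List.map_cons, ok_append, ok_cons] at hok
      have hv := hok.2.1.2
      simp only [fst_inr, floorHeight_false, add_zero] at ht
      simp only [Valid, fst_inr, snd_inr] at hv
      simp only [F, weight, term, level_eq_winding hL hs]
      by_cases hE : Even (x + y)
      · have : (x, true) ∈ run (base lo hi y₀) (A.map Prod.snd) := by tauto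
        simp [hE, this]
      · have : (x, true) ∉ run (base lo hi y₀) (A.map Prod.snd) := by tauto
        simp [hE, this]

end Tiling

/-- The contribution of the filling depends on the larger region only through the squares added;
subtracting the terms of all squares of the original region makes the invariants comparable. -/
theorem StablyConnected.invariant_eq {D E : Finset Square} {t : Tiling (duplex D)}
    {t' : Tiling (duplex E)} (h : StablyConnected t t') (ht : ∀ j ∉ D, t.winding j = 0)
    (ht' : ∀ j ∉ E, t'.winding j = 0) :
    t.invariant - ∑ j ∈ D, Tiling.term j 0 = t'.invariant - ∑ j ∈ E, Tiling.term j 0 := by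
  obtain ⟨F, h1, h2, h3⟩ := h
  have h4 := h3.invariant_eq
  rw [t.invariant_embed h1 fun j _ hj => ht j hj, t'.invariant_embed h2 fun j _ hj => ht' j hj] at h4
  have h5 := Finset.sum_sdiff h1 (f := fun j => Tiling.term j 0)
  have h6 := Finset.sum_sdiff h2 (f := fun j => Tiling.term j 0)
  rw [← eq_sub_iff_add_eq] at h5 h6
  rw [h5, h6] at h4
  linear_combination -h4

/-! ### Equal invariants imply stable connection -/

namespace Tiling

variable {D : Finset Square} {lo hi y₀ y₁ : ℤ} {L : List (ℤ × Edge)}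

/-- Adding the single square `j` with a `z` dimer makes it a jewel without changing its winding
number. -/
theorem winding_eq_zero_of_notMem (hD : IsSimplyConnected (planeRegion D))
    (t : Tiling (duplex D)) {j : Square} (hj : j ∉ D) : t.winding j = 0 := by
  rw [← t.winding_embed (subset_insert j D) j]
  refine winding_eq_zero hD _ (fun s hs hsD => ?_) (mem_insert_self j D) hj
  rw [mem_jewels, mem_embed]
  exact Or.inr ⟨s, mem_sdiff.2 ⟨hs, hsD⟩, rfl⟩

/-- The hops of a tiling of a rectangle of even height form a closed word. -/
theorem run_eq_base {t : Tiling (duplex (rect lo hi y₀ y₁))} (hy : y₀ ≤ y₁) (ho : Odd (y₁ - y₀))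
    (hL : Realizes t L) (hn : L.Nodup) (hs : L.Pairwise fun a b => a.1 ≤ b.1) :
    run (base lo hi y₀) (L.map Prod.snd) = base lo hi y₀ := by
  have hbox := (inBox_base lo hi y₀).run (timed_ok_of_realizes hL hn hs).2
  ext p
  by_cases hp : lo ≤ p.1 ∧ p.1 ≤ hi
  · have h1 := occ_iff_mem_run (A := L) (B := []) (y := y₁ + 1) (by simpa using hL)
      (by simpa using hn) hp (by omega) le_rfl (fun a ha _ => by
        have := (fits_of_brick ((hL a.2 a.1).2 ha)).2.2
        omega) (by simp)
    have h2 : post p y₁ ∉ t.dimers := fun h => by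
      have := (mem_rect.1 (mem_of_post h).2).2.2
      simp only at this
      omega
    rw [← h1, mem_base, Occ, add_sub_cancel_right]
    have h3 : Even (p.1 + (y₁ + 1) + floorHeight p.2) ↔ Even (p.1 + y₀ + floorHeight p.2) := by
      rw [Int.odd_iff] at ho
      rw [Int.even_iff, Int.even_iff]
      omega
    simp only [h2, hp, h3, false_iff, and_self, true_and]
  · exact iff_of_false (fun h => hp (hbox p h)) fun h => hp (mem_base.1 h).1

/-- Words reached by tilings with the same invariant have letters with the same weight. -/
theorem Reaches.sum_weight_eq {t t' : Tiling (duplex D)} {w w' : List Edge}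
    (h : Reaches t lo hi y₀ w) (h' : Reaches t' lo hi y₀ w') (hinv : t.invariant = t'.invariant)
    (hw : ∀ (t : Tiling (duplex D)), ∀ j ∉ D, t.winding j = 0) :
    ((letters lo (base lo hi y₀) w).map weight).sum =
      ((letters lo (base lo hi y₀) w').map weight).sum := by
  obtain ⟨y, hy, h⟩ := h.exists_realizes
  obtain ⟨y', hy', h'⟩ := h'.exists_realizes
  obtain ⟨L, l1, l2, l3, l4⟩ := exists_timed (base lo hi y₀) w y
  obtain ⟨L', l1', l2', l3', l4'⟩ := exists_timed (base lo hi y₀) w' y'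
  obtain ⟨z, hz, hb⟩ := exists_bound (L ++ L') (max y y')
  obtain ⟨y₁, hy₁, ho⟩ : ∃ y₁, z ≤ y₁ ∧ Odd (y₁ - y₀) := by
    rcases Int.even_or_odd (z - y₀) with h | h
    · exact ⟨z + 1, by omega, by rw [add_sub_right_comm]; exact h.add_one⟩
    · exact ⟨z, le_rfl, h⟩
  obtain ⟨t₁, a1, a2⟩ := h L l1 l2 l3 l4 y₁ ho (by omega) fun a ha =>
    (hb a (List.mem_append_left _ ha)).le.trans hy₁
  obtain ⟨t₂, b1, b2⟩ := h' L' l1' l2' l3' l4' y₁ ho (by omega) fun a ha =>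
    (hb a (List.mem_append_right _ ha)).le.trans hy₁
  -- Both schedules live on the same rectangle, so the corrections on the two sides agree.
  have e1 := a1.invariant_eq (hw t) fun j hj => winding_eq_zero_of_notMem_rect _ hj
  have e2 := b1.invariant_eq (hw t') fun j hj => winding_eq_zero_of_notMem_rect _ hj
  rw [← l2, ← l2', ← invariant_eq_sum_weight a2 l3, ← invariant_eq_sum_weight b2 l3']
  linear_combination e2 - e1 + hinv

/-- A tiling reaches a closed word, the same one in all wide enough strips. -/
theorem exists_reaches (t : Tiling (duplex D)) {hi₀ : ℤ} (hD : D ⊆ rect lo hi₀ y₀ y₁)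
    (hy : y₀ ≤ y₁) (ho : Odd (y₁ - y₀)) : ∃ w, ∀ hi, hi₀ ≤ hi → Reaches t lo hi y₀ w ∧
      run (base lo hi y₀) w = base lo hi y₀ := by
  obtain ⟨L, l1, l2, l3⟩ := (t.embed hD).exists_realizes
  refine ⟨L.map Prod.snd, fun hi hhi => ?_⟩
  -- Widening adds no bricks, so the word of the first rectangle serves for every `hi`.
  obtain ⟨t', h1, h2⟩ := exists_extend (t.embed hD) ho le_rfl hhi le_rfl ho
  have hr : Realizes t' L := fun d y => (h2 d y).trans (l1 d y)
  exact ⟨⟨y₁, L, t', hy, ho, (stablyConnected_embed t hD).trans h1, hr, l2, l3, rfl⟩,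
    run_eq_base hy ho hr l2 l3⟩

theorem stablyConnected_of_invariant_eq (hD : IsSimplyConnected (planeRegion D))
    {t₀ t₁ : Tiling (duplex D)} (h : t₀.invariant = t₁.invariant) : StablyConnected t₀ t₁ := by
  obtain ⟨s, hs⟩ : D.Nonempty := by
    obtain ⟨z, hz⟩ := hD.nonempty
    obtain ⟨s, hs, -⟩ := mem_planeRegion.1 hz
    exact ⟨s, hs⟩
  obtain ⟨a, ha⟩ := D.bddBelow
  obtain ⟨b, hb⟩ := D.bddAbove
  have hab : a.2 ≤ b.2 := ((ha hs).trans (hb hs)).2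
  obtain ⟨y₁, hy₁, ho⟩ : ∃ y₁, b.2 ≤ y₁ ∧ Odd (y₁ - a.2) := by
    rcases Int.even_or_odd (b.2 - a.2) with h | h
    · exact ⟨b.2 + 1, by omega, by rw [add_sub_right_comm]; exact h.add_one⟩
    · exact ⟨b.2, le_rfl, h⟩
  have hsub : D ⊆ rect a.1 b.1 a.2 y₁ := by
    intro s hs
    have h1 := ha hs
    have h2 := hb hs
    exact mem_rect.2 ⟨⟨h1.1, h2.1⟩, h1.2, h2.2.trans hy₁⟩
  obtain ⟨w₀, hw₀⟩ := t₀.exists_reaches hsub (hab.trans hy₁) ho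
  obtain ⟨w₁, hw₁⟩ := t₁.exists_reaches hsub (hab.trans hy₁) ho
  obtain ⟨N, hN⟩ : ∃ N, N = w₀.length + w₁.length := ⟨_, rfl⟩
  -- A strip of width `2 * m` has `m` particles on each floor. With levels bounded by `2 * N` and at
  -- most `N` letters, the room needed is `2 * (2 * N) + 2 + N`; the last summand makes the strip
  -- contain `D`.
  obtain ⟨m, hm⟩ : ∃ m, m = 5 * N + 2 + (b.1 - a.1 + 1).toNat := ⟨_, rfl⟩
  obtain ⟨hi, hhi⟩ : ∃ hi, hi = a.1 + 2 * m - 1 := ⟨_, rfl⟩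
  obtain ⟨r₀, e₀⟩ := hw₀ hi (by omega)
  obtain ⟨r₁, e₁⟩ := hw₁ hi (by omega)
  set s := base a.1 hi a.2 with hs
  have hok₁ : Ok a.1 hi s w₁.reverse := by
    have := ok_reverse r₁.ok
    rwa [e₁] at this
  have hok : Ok a.1 hi s (w₀ ++ w₁.reverse) := ok_append.2 ⟨r₀.ok, by rwa [e₀]⟩
  have hrun : run s (w₀ ++ w₁.reverse) = s := by
    rw [run_append, e₀]
    conv_lhs => rw [← e₁]
    exact run_reverse
  have hsum : ((letters a.1 s (w₀ ++ w₁.reverse)).map weight).sum = 0 := by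
    rw [letters_append, List.map_append, List.sum_append, e₀,
      r₀.sum_weight_eq r₁ h fun t j hj => winding_eq_zero_of_notMem hD t hj]
    have := sum_weight_reverse (lo := a.1) r₁.ok
    rw [e₁] at this
    rw [this, add_neg_cancel]
  have hlen := length_letters_le a.1 s (w₀ ++ w₁.reverse)
  have hlen' : (w₀ ++ w₁.reverse).length = N := by simp [hN]
  have hnil : Htpy a.1 hi s (w₀ ++ w₁.reverse) [] := by
    refine htpy_nil_of_count (K := 2 * N) (inBox_base _ _ _) (level_base (by omega) le_rfl) hok hrun
      (count_eq_of_sum_weight_eq_zero hsum) ?_ ?_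
    · intro B hB
      have := abs_le_of_mem_letters (c := 0) (fun x hx hx' => by
        rw [hs, level_base hx hx', abs_zero]) hok B hB
      rw [hlen'] at this
      omega
    · intro b
      have := cnt_base (lo := a.1) (y₀ := a.2) b m m le_rfl
      rw [hs, hhi, show a.1 + 2 * (m : ℤ) - 1 + 1 = a.1 + 2 * m by ring, this, ← hhi, ← hs]
      omega
  -- Append the trivial loop of `w₁` reversed followed by `w₁`, then contract `w₀` followed by the
  -- reverse of `w₁`.
  have hword : Htpy a.1 hi s w₀ w₁ := by
    have h1 : Htpy a.1 hi s (w₀ ++ []) (w₀ ++ (w₁.reverse ++ w₁)) := by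
      refine Htpy.append_left r₀.ok ?_
      have := (htpy_reverse_append r₁.ok).symm
      rwa [e₁, ← e₀] at this
    have h2 : Htpy a.1 hi s (w₀ ++ w₁.reverse ++ w₁) ([] ++ w₁) :=
      hnil.append_right (by rw [hrun]; exact r₁.ok)
    simp only [List.append_nil, List.nil_append, List.append_assoc] at h1 h2
    exact h1.trans h2
  exact (r₀.htpy hword).stablyConnected r₁

end Tiling

theorem mainTheorem1 (D : Finset Square) (hD : IsSimplyConnected (planeRegion D))
    (t₀ t₁ : Tiling (duplex D)) :
    t₀.invariant = t₁.invariant ↔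
      ∃ (a b : Square) (h : D ⊆ Finset.Icc a b), FlipConnected (t₀.embed h) (t₁.embed h) := by
  constructor
  · intro h
    obtain ⟨F, h1, h2, h3⟩ := Tiling.stablyConnected_of_invariant_eq hD h
    obtain ⟨a, ha⟩ := F.bddBelow
    obtain ⟨b, hb⟩ := F.bddAbove
    have hF : F ⊆ Finset.Icc a b := fun s hs => Finset.mem_Icc.2 ⟨ha hs, hb hs⟩
    refine ⟨a, b, h1.trans hF, ?_⟩
    have := h3.embed hF
    rwa [Tiling.embed_embed, Tiling.embed_embed] at this
  · rintro ⟨a, b, hsub, h⟩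
    have := h.invariant_eq
    -- Both embeddings add the same constant, because winding numbers vanish outside of `D`.
    rw [t₀.invariant_embed hsub fun j _ hj => Tiling.winding_eq_zero_of_notMem hD t₀ hj,
      t₁.invariant_embed hsub fun j _ hj => Tiling.winding_eq_zero_of_notMem hD t₁ hj] at this
    exact (add_right_cancel this).symm
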